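/- For $n\ge 0$ let $\widehat{\beta_n}$ be the annular closure of the positive braid $\beta_n=\sigma_1\sigma_2\cdots\sigma_n$ on $n+1$ strands (the $n$-fold positive stabilization of the nontrivial annular unknot). Let $\mathrm{SKh}(\widehat{\beta_n})$ be its sutured annular Khovanov homology over $\mathbb C$, i.e. the homology of the annular Khovanov complex $\mathrm{CKh}$ of the standard diagram of the braid closure with respect to the part $\partial_0$ of Khovanov's differential that preserves the annular grading $k$. It carries the homological grading $i$ and the gradings $j'=j-k$ and $k$, where $j$ is Khovanov's quantum grading. Let $\mathfrak{sl}_2(\wedge)$ be the Lie superalgebra with even generators $e,f,h$ (degree $0$, the standard basis of $\mathfrak{sl}_2$) and odd generators $v_2,v_0,v_{-2}$ (degree $1$), where $\mathfrak{sl}_2$ acts on the odd part by the adjoint representation, with $$[e,v_2]=0,\quad [e,v_0]=-2v_2,\quad [e,v_{-2}]=v_0,\quad [f,v_2]=-v_0,\quad [f,v_0]=2v_{-2},\quad [f,v_{-2}]=0,\quad [h,v_m]=m\,v_m,$$ and $[v_l,v_m]=0$ for all $l,m$. It acts on $\mathrm{SKh}(\widehat{\beta_n})$ as follows. In each resolution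 the nontrivial circles carry alternately the defining representation $V$ of $\mathfrak{sl}_2$ and its dual $V^*$ (starting with $V$ at the inner boundary of the annulus), the trivial circles carry a trivial two-dimensional representation, and $e,f,h$ act on the tensor products of these; $v_{-2}$ is induced by the part of $k$-degree $-2$ of Khovanov's differential, $v_2$ by the part of $k$-degree $+2$ of Lee's deformation, and $v_0=[e,v_{-2}]$. Let $V_{(m)}$ be the $(m+1)$-dimensional irreducible representation of $\mathfrak{sl}_2$, with $V_{(-1)}=0$, placed in $j'$-degree $0$ and with $k$-grading given by the weight, and let $\{m\}$ raise the $j'$-degree by $m$ and preserve the $k$-degree. Then for all $n\ge 0$, as bigraded representations of $\mathfrak{sl}_2$, $$\mathrm{SKh}^i(\widehat{\beta_n})\cong\begin{cases}V_{(n+1)}\{n\}& i=0,\\ V_{(n-1)}\{n+2\}& i=1,\\ 0&\text{otherwise.}\end{cases}$$ As a module over $\mathfrak{sl}_2(\wedge)$, $\mathrm{SKh}(\widehat{\beta_n})$ is indecomposable, and for $n\ge 1$ the generator $v_{-2}$ takes every highest weight vector of $V_{(n+1)}$ to a (nonzero) highest weight vector of $V_{(n-1)}$. These facts determine the module structure: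 every $\mathbb Z$-graded $\mathfrak{sl}_2(\wedge)$-module $M$ with $M^0\cong V_{(n+1)}$ and $M^1\cong V_{(n-1)}$ as $\mathfrak{sl}_2$-representations, with $M^i=0$ for $i\ne 0,1$, and, if $n\ge 1$, such that $v_{-2}$ takes some highest weight vector of $M^0$ to a highest weight vector of $M^1$, is isomorphic to $\mathrm{SKh}(\widehat{\beta_n})$ as a graded $\mathfrak{sl}_2(\wedge)$-module. -/

import Mathlib

noncomputable section

namespace AnnularKhovanov

open Module

/-! ## Representations of `sl₂` over `ℂ` -/

/-- A representation of `sl₂(ℂ)` on `V`, given by the operators of the standard basis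
`e, f, h`; the bracket of `Module.End ℂ V` is the commutator. -/
structure SlTwoRep (V : Type*) [AddCommGroup V] [Module ℂ V] where
  e : End ℂ V
  f : End ℂ V
  h : End ℂ V
  lie_e_f : ⁅e, f⁆ = h
  lie_h_e : ⁅h, e⁆ = 2 • e
  lie_h_f : ⁅h, f⁆ = -(2 • f)

/-- `φ` intertwines two representations of `sl₂`. -/
def SlTwoRep.Intertwines {V W : Type*} [AddCommGroup V] [Module ℂ V] [AddCommGroup W]
    [Module ℂ W] (A : SlTwoRep V) (B : SlTwoRep W) (φ : V ≃ₗ[ℂ] W) : Prop :=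
  (∀ x, φ (A.e x) = B.e (φ x)) ∧ (∀ x, φ (A.f x) = B.f (φ x)) ∧ (∀ x, φ (A.h x) = B.h (φ x))

/-- Isomorphism of representations of `sl₂`. -/
def SlTwoRep.Iso {V W : Type*} [AddCommGroup V] [Module ℂ V] [AddCommGroup W] [Module ℂ W]
    (A : SlTwoRep V) (B : SlTwoRep W) : Prop :=
  ∃ φ : V ≃ₗ[ℂ] W, A.Intertwines B φ

/-- Isomorphism of bigraded representations of `sl₂`: `gA j' k` and `gB j' k` are the homogeneous
pieces of bidegree `(j', k)`. -/
def SlTwoRep.BigradedIso {V W : Type*} [AddCommGroup V] [Module ℂ V] [AddCommGroup W]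
    [Module ℂ W] (A : SlTwoRep V) (gA : ℤ → ℤ → Submodule ℂ V)
    (B : SlTwoRep W) (gB : ℤ → ℤ → Submodule ℂ W) : Prop :=
  ∃ φ : V ≃ₗ[ℂ] W, A.Intertwines B φ ∧
    ∀ j' k : ℤ, (gA j' k).map (φ : V →ₗ[ℂ] W) = gB j' k

/-- `x` is a highest weight vector of weight `N`. -/
def SlTwoRep.IsHighestWeight {V : Type*} [AddCommGroup V] [Module ℂ V]
    (A : SlTwoRep V) (N : ℤ) (x : V) : Prop :=
  x ≠ 0 ∧ A.e x = 0 ∧ A.h x = (N : ℂ) • x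

/-- The `d`-dimensional irreducible representation of `sl₂` (zero for `d = 0`), with basis
`v_0, …, v_{d-1}`, where `f v_i = v_{i+1}`, `h v_i = (d - 1 - 2 i) v_i`,
`e v_i = i (d - i) v_{i-1}`.  In terms of highest weights, `V_{(m)}` is `irrep (m + 1)`
for `m ≥ 0`, and `V_{(-1)} = 0` is `irrep 0`. -/
def irrep (d : ℕ) : SlTwoRep (Fin d → ℂ) where
  e :=
    { toFun := fun c i =>
        if hi : i.1 + 1 < d then ((i.1 : ℂ) + 1) * ((d : ℂ) - (i.1 + 1)) * c ⟨i.1 + 1, hi⟩ else 0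
      map_add' := by intro a b; ext i; by_cases hi : i.1 + 1 < d <;> simp [hi]; ring
      map_smul' := by intro a b; ext i; by_cases hi : i.1 + 1 < d <;> simp [hi]; ring }
  f :=
    { toFun := fun c i => if 0 < i.1 then c ⟨i.1 - 1, by omega⟩ else 0
      map_add' := by intro a b; ext i; by_cases hi : 0 < i.1 <;> simp [hi]
      map_smul' := by intro a b; ext i; by_cases hi : 0 < i.1 <;> simp [hi] }
  h :=
    { toFun := fun c i => ((d : ℂ) - 1 - 2 * i.1) * c i
      map_add' := by intro a b; ext i; simp; ring
      map_smul' := by intro a b; ext i; simp; ring }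
  lie_e_f := by
    ext c i
    simp only [LinearMap.comp_apply, Ring.lie_def, LinearMap.sub_apply, Module.End.mul_apply,
      LinearMap.coe_mk, AddHom.coe_mk, Pi.sub_apply]
    obtain ⟨i, hi⟩ := i
    rcases i with _ | i
    · by_cases h1 : 1 < d
      · simp [h1]
      · have : d = 1 := by omega
        subst this
        simp
    · by_cases h1 : i + 2 < d
      · simp [h1, hi]
        ring
      · have : d = i + 2 := by omega
        subst this
        simp
        ring
  lie_h_e := by
    ext c i
    simp only [LinearMap.comp_apply, Ring.lie_def, LinearMap.sub_apply, Module.End.mul_apply,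
      LinearMap.coe_mk, AddHom.coe_mk, Pi.sub_apply, LinearMap.smul_apply, Pi.smul_apply]
    by_cases h1 : i.1 + 1 < d
    · simp [h1]
      ring
    · simp [h1]
  lie_h_f := by
    ext c i
    simp only [LinearMap.comp_apply, Ring.lie_def, LinearMap.sub_apply, Module.End.mul_apply,
      LinearMap.coe_mk, AddHom.coe_mk, Pi.sub_apply, LinearMap.smul_apply, Pi.smul_apply,
      LinearMap.neg_apply, Pi.neg_apply]
    obtain ⟨i, hi⟩ := i
    rcases i with _ | i
    · simp
    · simp
      ring

/-- The bigrading of `V_{(d-1)}{m}`: the `j'`-degree is concentrated in degree `m`, and the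
`k`-grading is the weight space grading. -/
def irrepGrading (d : ℕ) (m : ℤ) (j' k : ℤ) : Submodule ℂ (Fin d → ℂ) :=
  if j' = m then End.eigenspace (irrep d).h (k : ℂ) else ⊥

/-! ## Representations of the exterior current algebra `sl₂(∧)` -/

/-- A `ℤ`-graded representation on `M` of the Lie superalgebra `sl₂(∧)`, which has even generators
`e, f, h` (of degree `0`) and odd generators `v₂, v₀, v₋₂` (of degree `1`, written
`v2, v0, vm2`).  The bracket of an even generator with any generator acts as a commutator, the
bracket of two odd generators as an anticommutator. -/
structure CurrentRep (M : Type*) [AddCommGroup M] [Module ℂ M] extends SlTwoRep M where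
  v2 : End ℂ M
  v0 : End ℂ M
  vm2 : End ℂ M
  lie_e_v2 : ⁅e, v2⁆ = 0
  lie_e_v0 : ⁅e, v0⁆ = -(2 • v2)
  lie_e_vm2 : ⁅e, vm2⁆ = v0
  lie_f_v2 : ⁅f, v2⁆ = -v0
  lie_f_v0 : ⁅f, v0⁆ = 2 • vm2
  lie_f_vm2 : ⁅f, vm2⁆ = 0
  lie_h_v2 : ⁅h, v2⁆ = 2 • v2
  lie_h_v0 : ⁅h, v0⁆ = 0
  lie_h_vm2 : ⁅h, vm2⁆ = -(2 • vm2)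
  anti_v2_v2 : v2 * v2 + v2 * v2 = 0
  anti_v0_v0 : v0 * v0 + v0 * v0 = 0
  anti_vm2_vm2 : vm2 * vm2 + vm2 * vm2 = 0
  anti_v2_v0 : v2 * v0 + v0 * v2 = 0
  anti_v2_vm2 : v2 * vm2 + vm2 * v2 = 0
  anti_v0_vm2 : v0 * vm2 + vm2 * v0 = 0
  /-- The homogeneous components of `M`. -/
  deg : ℤ → Submodule ℂ M
  isInternal : DirectSum.IsInternal deg
  e_mem : ∀ i, ∀ x ∈ deg i, e x ∈ deg i
  f_mem : ∀ i, ∀ x ∈ deg i, f x ∈ deg i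
  h_mem : ∀ i, ∀ x ∈ deg i, h x ∈ deg i
  v2_mem : ∀ i, ∀ x ∈ deg i, v2 x ∈ deg (i + 1)
  v0_mem : ∀ i, ∀ x ∈ deg i, v0 x ∈ deg (i + 1)
  vm2_mem : ∀ i, ∀ x ∈ deg i, vm2 x ∈ deg (i + 1)

namespace CurrentRep

variable {M : Type*} [AddCommGroup M] [Module ℂ M]

/-- The `sl₂`-representation on the homogeneous component of degree `i`. -/
def degRep (ρ : CurrentRep M) (i : ℤ) : SlTwoRep (ρ.deg i) where
  e := ρ.e.restrict (ρ.e_mem i)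
  f := ρ.f.restrict (ρ.f_mem i)
  h := ρ.h.restrict (ρ.h_mem i)
  lie_e_f := by
    ext x
    simpa [Ring.lie_def] using LinearMap.congr_fun ρ.lie_e_f (x : M)
  lie_h_e := by
    ext x
    simpa [Ring.lie_def] using LinearMap.congr_fun ρ.lie_h_e (x : M)
  lie_h_f := by
    ext x
    simpa [Ring.lie_def] using LinearMap.congr_fun ρ.lie_h_f (x : M)

/-- `A` is an `sl₂(∧)`-submodule (not required to be graded). -/
def IsInvariant (ρ : CurrentRep M) (A : Submodule ℂ M) : Prop :=
  ∀ x ∈ A, ρ.e x ∈ A ∧ ρ.f x ∈ A ∧ ρ.h x ∈ A ∧ ρ.v2 x ∈ A ∧ ρ.v0 x ∈ A ∧ ρ.vm2 x ∈ A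

/-- `M` is nonzero and is not the direct sum of two nonzero `sl₂(∧)`-submodules. -/
def IsIndecomposable (ρ : CurrentRep M) : Prop :=
  Nontrivial M ∧ ∀ A B : Submodule ℂ M, ρ.IsInvariant A → ρ.IsInvariant B → IsCompl A B →
    A = ⊥ ∨ B = ⊥

/-- Isomorphism of graded `sl₂(∧)`-modules. -/
def Iso {M' : Type*} [AddCommGroup M'] [Module ℂ M'] (ρ : CurrentRep M) (σ : CurrentRep M') :
    Prop :=
  ∃ φ : M ≃ₗ[ℂ] M', ρ.toSlTwoRep.Intertwines σ.toSlTwoRep φ ∧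
    (∀ x, φ (ρ.v2 x) = σ.v2 (φ x)) ∧ (∀ x, φ (ρ.v0 x) = σ.v0 (φ x)) ∧
    (∀ x, φ (ρ.vm2 x) = σ.vm2 (φ x)) ∧
    ∀ i, (ρ.deg i).map (φ : M →ₗ[ℂ] M') = σ.deg i

end CurrentRep

/-! ## Annular braid closures and their resolutions -/

/-- A braid word with `N` letters on `s + 1` strands.  The letter `(i, true)` is the positive
crossing `σ_{i+1}` between the strands in the positions `i` and `i + 1` (counted from `0`), and
`(i, false)` is its inverse. -/
abbrev BraidWord (s N : ℕ) := Fin N → Fin s × Bool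

/-- The word `σ_1 σ_2 ⋯ σ_n` in the braid group on `n + 1` strands. -/
def stabWord (n : ℕ) : BraidWord n n := fun t => (t, true)

variable {s N : ℕ}

/-- Marked points on the closed diagram: the point `(t, p)` lies on the strand in position `p`,
at level `t`; the `t`-th crossing is between the levels `t` and `t + 1`. The level `N` is glued to
the level `0`, so that the strands run once around the core of the annulus.  The radial arc `γ` at
level `0` runs from the basepoint `𝕏` (inner boundary) to `𝕆` (outer boundary) and meets the
diagram in `(0, 0), …, (0, s)`, in this order. -/
abbrev Point (s N : ℕ) := Fin (N + 1) × Fin (s + 1)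

/-- A vertex of the cube of resolutions: at each crossing the `0`-resolution (`false`) or the
`1`-resolution (`true`). -/
abbrev Vertex (N : ℕ) := Fin N → Bool

/-- The arcs of the resolved diagram.  The `0`-resolution of a positive crossing and the
`1`-resolution of a negative crossing consist of two arcs in braid direction; the other resolutions
consist of a cap and a cup. -/
inductive Arc (w : BraidWord s N) (a : Vertex N) : Point s N → Point s N → Prop
  | close (p : Fin (s + 1)) : Arc w a (Fin.last N, p) (0, p)
  | away (t : Fin N) (p : Fin (s + 1)) (h₁ : p ≠ (w t).1.castSucc) (h₂ : p ≠ (w t).1.succ) :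
      Arc w a (t.castSucc, p) (t.succ, p)
  | straight (t : Fin N) (p : Fin (s + 1)) (h : a t ≠ (w t).2) :
      Arc w a (t.castSucc, p) (t.succ, p)
  | turnBelow (t : Fin N) (h : a t = (w t).2) :
      Arc w a (t.castSucc, (w t).1.castSucc) (t.castSucc, (w t).1.succ)
  | turnAbove (t : Fin N) (h : a t = (w t).2) :
      Arc w a (t.succ, (w t).1.castSucc) (t.succ, (w t).1.succ)

/-- The circles of the resolution `a`. -/
abbrev Circle (w : BraidWord s N) (a : Vertex N) := Quot (Arc w a)

instance (w : BraidWord s N) (a : Vertex N) : Fintype (Circle w a) := Fintype.ofFinite _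

/-- The positions in which the circle `C` meets the arc `γ`. -/
def hits (w : BraidWord s N) (a : Vertex N) (C : Circle w a) : Set (Fin (s + 1)) :=
  {p | Quot.mk (Arc w a) (0, p) = C}

/-- A circle is nontrivial (essential in the annulus) iff it meets `γ` in an odd number of
points. -/
def IsNontrivial (w : BraidWord s N) (a : Vertex N) (C : Circle w a) : Prop :=
  Odd (hits w a C).ncard

/-- The number of nontrivial circles on the same side of the nontrivial circle `C` as `𝕏`.
Nontrivial circles are nested, so `C'` is one of them iff `γ`, starting at `𝕏`, meets `C'` before
it meets `C`. -/
def numInside (w : BraidWord s N) (a : Vertex N) (C : Circle w a) : ℕ :=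
  {C' : Circle w a | IsNontrivial w a C' ∧ ∃ p ∈ hits w a C', ∀ q ∈ hits w a C, p < q}.ncard

/-- The sign `ε(C)`: a nontrivial circle carries `V` if it is `1` and `V*` if it is `-1`. -/
def eps (w : BraidWord s N) (a : Vertex N) (C : Circle w a) : ℂ := (-1) ^ numInside w a C

/-! ## The sutured annular Khovanov complex -/

/-- Enhanced Kauffman states: a resolution with a label `+` (`true`) or `-` (`false`) on each
circle.  A nontrivial circle labelled `±` stands for the basis vector `v_±` of `V` (or `v̄_±` of
`V*`), a trivial one for `w_±` in `W`. -/
abbrev State (w : BraidWord s N) := (a : Vertex N) × (Circle w a → Bool)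

instance (w : BraidWord s N) : Fintype (State w) := Fintype.ofFinite _

/-- The chain space: the sum over all resolutions of the tensor products over their circles of the
spaces `V`, `V*`, `W`, in coordinates with respect to the basis of enhanced states. -/
abbrev Chain (w : BraidWord s N) := State w → ℂ

/-- The value of a label. -/
def signVal (b : Bool) : ℤ := if b then 1 else -1

/-- The number of `+` minus the number of `-`. -/
def tau (w : BraidWord s N) (x : State w) : ℤ := ∑ C, signVal (x.2 C)

open scoped Classical in
/-- The `k`-grading: the number of `+` minus the number of `-` on the nontrivial circles. -/
def kDeg (w : BraidWord s N) (x : State w) : ℤ :=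
  ∑ C, if IsNontrivial w x.1 C then signVal (x.2 C) else 0

/-- The number `r` of `1`-resolutions. -/
def numOnes (w : BraidWord s N) (x : State w) : ℕ := {t : Fin N | x.1 t = true}.ncard

/-- The number `n₊` of positive crossings (all strands oriented in braid direction). -/
def numPos (w : BraidWord s N) : ℕ := {t : Fin N | (w t).2 = true}.ncard

/-- The number `n₋` of negative crossings. -/
def numNeg (w : BraidWord s N) : ℕ := {t : Fin N | (w t).2 = false}.ncard

/-- The homological grading `i = r - n₋`. -/
def iDeg (w : BraidWord s N) (x : State w) : ℤ := numOnes w x - numNeg w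

/-- Khovanov's quantum grading `j = τ + r + n₊ - 2 n₋`. -/
def jDeg (w : BraidWord s N) (x : State w) : ℤ :=
  tau w x + numOnes w x + numPos w - 2 * numNeg w

/-- The filtration-adjusted quantum grading `j' = j - k`. -/
def jDeg' (w : BraidWord s N) (x : State w) : ℤ := jDeg w x - kDeg w x

/-- `P` is one of the four endpoints of the `t`-th crossing. -/
def IsCorner (w : BraidWord s N) (t : Fin N) (P : Point s N) : Prop :=
  (P.1 = t.castSucc ∨ P.1 = t.succ) ∧ (P.2 = (w t).1.castSucc ∨ P.2 = (w t).1.succ)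

/-- `y` arises from `x` by changing the `t`-th crossing from the `0`- to the `1`-resolution and
relabelling only circles that pass through this crossing. -/
def IsEdge (w : BraidWord s N) (t : Fin N) (x y : State w) : Prop :=
  x.1 t = false ∧ y.1 = Function.update x.1 t true ∧
    ∀ P : Point s N,
      (∀ Q, IsCorner w t Q → Quot.mk (Arc w x.1) Q ≠ Quot.mk (Arc w x.1) P) →
        y.2 (Quot.mk _ P) = x.2 (Quot.mk _ P)

/-- The sign of an edge of the cube: `(-1)` to the number of `1`-resolutions before `t`. -/
def edgeSign (t : Fin N) (a : Vertex N) : ℂ := (-1) ^ {u : Fin N | u < t ∧ a u = true}.ncard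

open scoped Classical in
/-- The part of `k`-degree `δk` of the signed sum over all edges of the cube of the merge and split
maps that change `τ` by `δτ`.

For `δτ = -1` these are Khovanov's maps: merging two circles sends
`++ ↦ +`, `+- ↦ -`, `-+ ↦ -`, `-- ↦ 0`, and splitting a circle sends `+ ↦ (+-) + (-+)`,
`- ↦ --`; the pairs of labels listed are exactly those whose value `τ` drops by `1`.

For `δτ = 3` these are the maps of Lee's deformation: merging sends `-- ↦ +`, splitting sends
`- ↦ ++`, and all other labels are sent to `0`.

The `(y, x)` entry of the matrix is the coefficient of `y` in the image of `x`. -/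
def cubeMap (w : BraidWord s N) (δτ δk : ℤ) : Chain w →ₗ[ℂ] Chain w :=
  Matrix.mulVecLin <| Matrix.of fun y x : State w =>
    ∑ t : Fin N,
      if IsEdge w t x y ∧ tau w y = tau w x + δτ ∧ kDeg w y = kDeg w x + δk then
        edgeSign t x.1 else 0

/-- The sutured differential `∂₀`, the `k`-preserving part of Khovanov's differential. -/
def partialZero (w : BraidWord s N) : Chain w →ₗ[ℂ] Chain w := cubeMap w (-1) 0

/-- The part `∂₋` of `k`-degree `-2` of Khovanov's differential. -/
def partialMinus (w : BraidWord s N) : Chain w →ₗ[ℂ] Chain w := cubeMap w (-1) (-2)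

/-- The part `∂₊^{Lee}` of `k`-degree `2` of Lee's deformation. -/
def partialLeePlus (w : BraidWord s N) : Chain w →ₗ[ℂ] Chain w := cubeMap w 3 2

open scoped Classical in
/-- The operator that, on a state, adds up over all nontrivial circles `C` labelled `b` the state
in which the label of `C` is reversed, with coefficient `ε(C)`. -/
def flipMap (w : BraidWord s N) (b : Bool) : Chain w →ₗ[ℂ] Chain w :=
  Matrix.mulVecLin <| Matrix.of fun y x : State w =>
    ∑ C : Circle w x.1,
      if IsNontrivial w x.1 C ∧ x.2 C = b ∧ y = ⟨x.1, Function.update x.2 C (!b)⟩ then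
        eps w x.1 C else 0

/-- The raising operator of the tensor product representation: `e v₋ = v₊`, `e v̄₋ = - v̄₊`. -/
def chainE (w : BraidWord s N) : Chain w →ₗ[ℂ] Chain w := flipMap w false

/-- The lowering operator of the tensor product representation: `f v₊ = v₋`, `f v̄₊ = - v̄₋`. -/
def chainF (w : BraidWord s N) : Chain w →ₗ[ℂ] Chain w := flipMap w true

/-- The weight operator of the tensor product representation: it multiplies each state by its
`k`-degree. -/
def chainH (w : BraidWord s N) : Chain w →ₗ[ℂ] Chain w :=
  LinearMap.pi fun x : State w => (kDeg w x : ℂ) • LinearMap.proj x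

/-! ## Sutured annular Khovanov homology -/

/-- The cycles of `∂₀`. -/
abbrev Cycles (w : BraidWord s N) : Submodule ℂ (Chain w) := LinearMap.ker (partialZero w)

/-- Sutured annular Khovanov homology of the closure of `w`: cycles modulo boundaries. -/
abbrev SKh (w : BraidWord s N) :=
  Cycles w ⧸ (LinearMap.range (partialZero w)).submoduleOf (Cycles w)

/-- The homology class of a cycle. -/
def homClass (w : BraidWord s N) : Cycles w →ₗ[ℂ] SKh w := Submodule.mkQ _

/-- The chains that are combinations of the states in `S`. -/
def chainsOn (w : BraidWord s N) (S : Set (State w)) : Submodule ℂ (Chain w) where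
  carrier := {z | ∀ x, x ∉ S → z x = 0}
  zero_mem' := fun _ _ => rfl
  add_mem' := fun ha hb x hx => by simp [ha x hx, hb x hx]
  smul_mem' := fun c _ ha x hx => by simp [ha x hx]

/-- The homology classes of the cycles that are combinations of the states in `S`. -/
def classesOn (w : BraidWord s N) (S : Set (State w)) : Submodule ℂ (SKh w) :=
  ((chainsOn w S).submoduleOf (Cycles w)).map (homClass w)

/-- `SKh^i`. -/
def SKhDeg (w : BraidWord s N) (i : ℤ) : Submodule ℂ (SKh w) :=
  classesOn w {x | iDeg w x = i}

/-- The piece of `SKh^i` of bidegree `(j', k)`. -/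
def SKhPiece (w : BraidWord s N) (i j' k : ℤ) : Submodule ℂ (SKh w) :=
  classesOn w {x | iDeg w x = i ∧ jDeg' w x = j' ∧ kDeg w x = k}

/-- The chain operator `T` takes cycles to cycles and induces the operator `T'` on homology. -/
def Induces (w : BraidWord s N) (T : Chain w →ₗ[ℂ] Chain w) (T' : End ℂ (SKh w)) : Prop :=
  ∀ z : Cycles w, ∃ hz : T z ∈ Cycles w, T' (homClass w z) = homClass w ⟨T z, hz⟩

/-- `ρ` is the action of `sl₂(∧)` on `SKh`: it is graded by the homological degree, `e, f, h` act
by the tensor product representations on the chain spaces, `v₂` by `∂₊^{Lee}` and `v₋₂` by `∂₋`.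
(The operator `v₀ = [e, v₋₂]` is then determined.) -/
structure IsAnnularAction (w : BraidWord s N) (ρ : CurrentRep (SKh w)) : Prop where
  deg_eq : ρ.deg = SKhDeg w
  e_induced : Induces w (chainE w) ρ.e
  f_induced : Induces w (chainF w) ρ.f
  h_induced : Induces w (chainH w) ρ.h
  v2_induced : Induces w (partialLeePlus w) ρ.v2
  vm2_induced : Induces w (partialMinus w) ρ.vm2

/-- The bigrading by `(j', k)` of the homological degree `i` part of `SKh`. -/
def SKhBigrading (w : BraidWord s N) (ρ : CurrentRep (SKh w)) (i j' k : ℤ) :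
    Submodule ℂ (ρ.deg i) :=
  (SKhPiece w i j' k).submoduleOf (ρ.deg i)

end AnnularKhovanov

end

open AnnularKhovanov

/-!
In every resolution of the closure of `σ₁ ⋯ σₙ` two points lie on the same circle iff all crossings
between their positions are `1`-resolved.  So the circles are the blocks of consecutive strands, a
circle is nontrivial iff its number of strands is odd, and all edges of the cube of resolutions are
merges of adjacent circles.  An enhanced state is therefore a word (`Word`), with one label per
block and the letter `none` for each joined crossing, and the complex is a bar complex: the
differential multiplies adjacent labels.  The bijection is `wordEquiv`, and `chainEquiv_cubeMap` and
`chainEquiv_flipMap` translate the operators.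

The word operators are defined by recursion on the first letter.  For these, `d² = 0` amounts to
associativity of the multiplication of labels (`Coeffs.Assoc`).  The multiplications that belong to
`∂₀`, `∂₋`, `∂₊^{Lee}`, `∂₀ + ∂₋` and `∂₀ + ∂₊^{Lee}` are associative, so that `∂₋` and `∂₊^{Lee}`
anticommute with `∂₀`.  In the same way the commutators of `e` and `f` with the differentials reduce
to finitely many identities between structure constants (`Coeffs.defect`).  This gives the action
`annularRep` up to the relations between two odd generators.  Those hold for degree reasons, once the
homology is known to live in two adjacent degrees.

The homology is computed by stripping first letters.  The complex is bigraded by `i` and `j'`; in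
all bidegrees other than `(0, n)` and `(1, n + 2)` it is exact, first for the subcomplex of words
that do not start with `-` (`exists_wordDiffZero_of_part_eq_zero`), the quotient by which is a
shorter complex of the same kind, then for the whole complex (`exists_wordDiffZero_eq`).  In the two
remaining bidegrees there are no boundaries, and a cycle is determined by its values at the words
with sorted labels, so that the dimensions are at most `n + 2` and `n`
(`eq_zero_of_sortedWord`, `eq_zero_of_sortedWordPair`).  On the other hand the cycle `+⋯+` is a
highest weight vector of weight `n + 1`, and for `n ≥ 1`, `∂₋` takes it to a highest weight vector of
weight `n - 1`; these generate representations of dimensions `n + 2` and `n`.  By the bounds on the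
dimensions, they are everything (`SlTwoRep.exists_irrep_iso`).

The remaining claims hold for every module with these two properties (`CurrentRep.IsStandard`).  Its
weight space of weight `n + 1` is a line and generates the module, so that one of any two
complementary submodules is everything.  Two such modules are isomorphic: `v₋₂` commutes with `f`,
so that it is determined by the image of a highest weight vector, and `v₀ = [e, v₋₂]` and
`-2 v₂ = [e, v₀]`.
-/

noncomputable section

namespace AnnularKhovanov

open Module

/-! ### Representations of `sl₂` generated by a highest weight vector -/

namespace SlTwoRep

variable {V W : Type*} [AddCommGroup V] [Module ℂ V] [AddCommGroup W] [Module ℂ W]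

theorem e_f_apply (A : SlTwoRep V) (x : V) : A.e (A.f x) = A.f (A.e x) + A.h x := by
  have h := LinearMap.congr_fun A.lie_e_f x
  simp only [Ring.lie_def, LinearMap.sub_apply, Module.End.mul_apply] at h
  rw [← h]; abel

theorem h_f_apply (A : SlTwoRep V) (x : V) : A.h (A.f x) = A.f (A.h x) - (2 : ℂ) • A.f x := by
  have h := LinearMap.congr_fun A.lie_h_f x
  simp only [Ring.lie_def, LinearMap.sub_apply, Module.End.mul_apply, LinearMap.neg_apply,
    LinearMap.smul_apply] at h
  rw [sub_eq_iff_eq_add] at h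
  rw [h, two_smul, two_smul]; abel

theorem h_pow_f (A : SlTwoRep V) {μ : ℂ} {x : V} (hx : A.h x = μ • x) (i : ℕ) :
    A.h ((A.f ^ i) x) = (μ - 2 * i) • (A.f ^ i) x := by
  induction i with
  | zero => simpa using hx
  | succ i ih =>
    rw [pow_succ', Module.End.mul_apply, h_f_apply, ih, map_smul, ← sub_smul]
    congr 1; push_cast; ring

theorem e_pow_f (A : SlTwoRep V) {μ : ℂ} {x : V} (he : A.e x = 0) (hx : A.h x = μ • x) (i : ℕ) :
    A.e ((A.f ^ (i + 1)) x) = ((i + 1 : ℂ) * (μ - i)) • (A.f ^ i) x := by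
  induction i with
  | zero => simp [e_f_apply, he, hx]
  | succ i ih =>
    rw [pow_succ', Module.End.mul_apply, e_f_apply, ih, h_pow_f A hx, map_smul,
      ← Module.End.mul_apply, ← pow_succ', ← add_smul]
    congr 1; push_cast; ring

theorem pow_f_ne_zero (A : SlTwoRep V) {d : ℕ} {x : V} (h0 : x ≠ 0) (he : A.e x = 0)
    (hx : A.h x = ((d : ℂ) - 1) • x) {i : ℕ} (hi : i < d) : (A.f ^ i) x ≠ 0 := by
  induction i with
  | zero => simpa using h0
  | succ i ih =>
    intro h
    have h1 := e_pow_f A he hx i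
    rw [h, map_zero] at h1
    rcases smul_eq_zero.1 h1.symm with h2 | h2
    · rcases mul_eq_zero.1 h2 with h3 | h3
      · exact (Nat.cast_add_one_ne_zero i) h3
      · have : (d : ℂ) = ((i + 1 : ℕ) : ℂ) := by push_cast; linear_combination h3
        have := Nat.cast_injective this
        omega
    · exact ih (by omega) h2

/-- Nonzero vectors `f^i x` lie in different weight spaces. -/
theorem linearIndependent_pow_f (A : SlTwoRep V) {μ : ℂ} {x : V} (hx : A.h x = μ • x) (m : ℕ)
    (h0 : ∀ i < m, (A.f ^ i) x ≠ 0) : LinearIndependent ℂ fun i : Fin m => (A.f ^ i.1) x := by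
  refine Module.End.eigenvectors_linearIndependent' A.h (fun i : Fin m => μ - 2 * (i.1 : ℂ)) ?_ _ ?_
  · intro i j hij
    have : (i.1 : ℂ) = j.1 := by linear_combination (-1 / 2 : ℂ) * hij
    exact Fin.ext (Nat.cast_injective this)
  · intro i
    exact ⟨Module.End.mem_eigenspace_iff.2 (h_pow_f A hx i), h0 i i.2⟩

theorem pow_f_eq_zero (A : SlTwoRep V) [FiniteDimensional ℂ V] {d : ℕ} {x : V}
    (he : A.e x = 0) (hx : A.h x = ((d : ℂ) - 1) • x) (hd : finrank ℂ V ≤ d) :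
    (A.f ^ d) x = 0 := by
  by_contra hne
  have h0 : x ≠ 0 := by rintro rfl; simp at hne
  have := linearIndependent_pow_f A hx (d + 1) (fun i hi => by
    rcases Nat.lt_succ_iff_lt_or_eq.1 hi with h | rfl
    · exact pow_f_ne_zero A h0 he hx h
    · exact hne)
  have := this.fintype_card_le_finrank
  simp at this
  omega

/-- The map `irrep d → V` that sends the `i`-th basis vector to `f^i x`. -/
def ofVector (A : SlTwoRep V) (d : ℕ) (x : V) : (Fin d → ℂ) →ₗ[ℂ] V :=
  Fintype.linearCombination ℂ fun i : Fin d => (A.f ^ i.1) x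

theorem ofVector_single (A : SlTwoRep V) (d : ℕ) (x : V) (i : Fin d) :
    A.ofVector d x (Pi.single i 1) = (A.f ^ i.1) x := by
  simp [ofVector, Fintype.linearCombination_apply_single]

end SlTwoRep

theorem irrep_f_single (d : ℕ) (i : Fin d) : (irrep d).f (Pi.single i 1) =
    if h : i.1 + 1 < d then Pi.single ⟨i.1 + 1, h⟩ 1 else 0 := by
  ext j
  simp only [irrep, LinearMap.coe_mk, AddHom.coe_mk]
  split_ifs with h1 h2 h2 <;> simp [Pi.single_apply, Fin.ext_iff]
  all_goals grind

theorem irrep_e_single (d : ℕ) (i : Fin d) : (irrep d).e (Pi.single i 1) =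
    if h : 0 < i.1 then ((i.1 : ℂ) * (d - i.1)) • Pi.single ⟨i.1 - 1, by omega⟩ 1 else 0 := by
  ext j
  simp only [irrep, LinearMap.coe_mk, AddHom.coe_mk]
  split_ifs with h1 h2 h2 <;> simp [Pi.single_apply, Fin.ext_iff]
  · split_ifs with h3 h4 h4
    · rw [← h3]; push_cast; ring
    · omega
    · omega
    · rfl
  · intro h3; omega
  · intro h3; omega

theorem irrep_h_apply (d : ℕ) (c : Fin d → ℂ) (i : Fin d) :
    (irrep d).h c i = ((d : ℂ) - 1 - 2 * i.1) * c i := rfl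

theorem irrep_h_single (d : ℕ) (i : Fin d) : (irrep d).h (Pi.single i 1) =
    ((d : ℂ) - 1 - 2 * i.1) • Pi.single i 1 := by
  ext j
  rw [irrep_h_apply]
  by_cases h : j = i
  · subst h; simp
  · simp [h]

namespace SlTwoRep

variable {V W X : Type*} [AddCommGroup V] [Module ℂ V] [AddCommGroup W] [Module ℂ W]
  [AddCommGroup X] [Module ℂ X]

theorem Intertwines.symm {A : SlTwoRep V} {B : SlTwoRep W} {φ : V ≃ₗ[ℂ] W}
    (h : A.Intertwines B φ) : B.Intertwines A φ.symm := by
  refine ⟨fun x => ?_, fun x => ?_, fun x => ?_⟩ <;> rw [LinearEquiv.symm_apply_eq]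
  · rw [h.1, φ.apply_symm_apply]
  · rw [h.2.1, φ.apply_symm_apply]
  · rw [h.2.2, φ.apply_symm_apply]

theorem Intertwines.trans {A : SlTwoRep V} {B : SlTwoRep W} {C : SlTwoRep X} {φ : V ≃ₗ[ℂ] W}
    {ψ : W ≃ₗ[ℂ] X} (h : A.Intertwines B φ) (h' : B.Intertwines C ψ) :
    A.Intertwines C (φ.trans ψ) := by
  refine ⟨fun x => ?_, fun x => ?_, fun x => ?_⟩ <;> simp only [LinearEquiv.trans_apply]
  · rw [h.1, h'.1]
  · rw [h.2.1, h'.2.1]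
  · rw [h.2.2, h'.2.2]

/-- A representation of dimension at most `d` with a highest weight vector `x` of weight `d - 1`
is the irreducible one: the vectors `f^i x` with `i < d` have different weights, so that they form
a basis. -/
theorem exists_irrep_iso (A : SlTwoRep V) [FiniteDimensional ℂ V] {d : ℕ} {x : V} {N : ℤ}
    (hN : (N : ℂ) = (d : ℂ) - 1) (hx : A.IsHighestWeight N x) (hd : finrank ℂ V ≤ d) :
    ∃ φ : (Fin d → ℂ) ≃ₗ[ℂ] V, (irrep d).Intertwines A φ ∧
      ∀ i, φ (Pi.single i 1) = (A.f ^ i.1) x := by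
  obtain ⟨h0, he, hh⟩ := hx
  rw [hN] at hh
  have hli := linearIndependent_pow_f A hh d (fun i hi => pow_f_ne_zero A h0 he hh hi)
  have hinj : Function.Injective (A.ofVector d x) :=
    linearIndependent_iff_injective_fintypeLinearCombination.1 hli
  have hdim : finrank ℂ (Fin d → ℂ) = finrank ℂ V := by
    have := hli.fintype_card_le_finrank
    simp at this ⊢
    omega
  refine ⟨LinearEquiv.ofInjectiveOfFinrankEq _ hinj hdim, ?_, fun i => ?_⟩
  · have key : ∀ (S : End ℂ (Fin d → ℂ)) (T : End ℂ V),
        (∀ i, A.ofVector d x (S (Pi.single i 1)) = T (A.ofVector d x (Pi.single i 1))) →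
        ∀ c, A.ofVector d x (S c) = T (A.ofVector d x c) := by
      intro S T h c
      have : (A.ofVector d x) ∘ₗ S = T ∘ₗ (A.ofVector d x) := by
        refine LinearMap.pi_ext' fun i => LinearMap.ext_ring ?_
        simpa using h i
      exact LinearMap.congr_fun this c
    refine ⟨key _ _ fun i => ?_, key _ _ fun i => ?_, key _ _ fun i => ?_⟩
    · rw [irrep_e_single, ofVector_single]
      obtain ⟨i, hi⟩ := i
      rcases i with _ | i
      · simp [he]
      · rw [dif_pos (by simp), map_smul, ofVector_single]
        simp only [Nat.add_sub_cancel]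
        rw [e_pow_f A he hh]
        congr 1; push_cast; ring
    · rw [irrep_f_single, ofVector_single, ← Module.End.mul_apply, ← pow_succ']
      split_ifs with h
      · rw [ofVector_single]
      · have : i.1 + 1 = d := by omega
        rw [this, pow_f_eq_zero A he hh hd, map_zero]
    · rw [irrep_h_single, ofVector_single, map_smul, ofVector_single, h_pow_f A hh]
  · exact ofVector_single A d x i

/-- A subspace that contains the highest weight vector and is stable under `f` is everything. -/
theorem eq_top_of_highestWeight_mem (A : SlTwoRep V) [FiniteDimensional ℂ V] {d : ℕ} {x : V}
    {N : ℤ} (hN : (N : ℂ) = (d : ℂ) - 1) (hx : A.IsHighestWeight N x) (hd : finrank ℂ V ≤ d)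
    (U : Submodule ℂ V) (hU : x ∈ U) (hf : ∀ u ∈ U, A.f u ∈ U) : U = ⊤ := by
  obtain ⟨φ, -, hφ⟩ := A.exists_irrep_iso hN hx hd
  have hpow : ∀ i, (A.f ^ i) x ∈ U := by
    intro i
    induction i with
    | zero => simpa using hU
    | succ i ih => rw [pow_succ', Module.End.mul_apply]; exact hf _ ih
  rw [eq_top_iff]
  intro v _
  obtain ⟨c, rfl⟩ := φ.surjective v
  rw [pi_eq_sum_univ' c, map_sum]
  refine U.sum_mem fun i _ => ?_
  rw [map_smul, hφ]
  exact U.smul_mem _ (hpow _)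

end SlTwoRep

/-! ### Modules over `sl₂(∧)` in two adjacent degrees -/

theorem irrep_eq_smul_single {d : ℕ} (hd : 0 < d) {c : Fin d → ℂ}
    (hc : (irrep d).h c = ((d : ℂ) - 1) • c) : c = c ⟨0, hd⟩ • Pi.single ⟨0, hd⟩ 1 := by
  ext i
  have h := congrFun hc i
  rw [irrep_h_apply, Pi.smul_apply, smul_eq_mul] at h
  by_cases hi : i = ⟨0, hd⟩
  · subst hi; simp
  · have h0 : (i.1 : ℂ) ≠ 0 := by
      rw [Ne, Nat.cast_eq_zero]
      exact fun h => hi (Fin.ext h)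
    have : (i.1 : ℂ) * c i = 0 := by linear_combination (-1 / 2 : ℂ) * h
    simp [hi, (mul_eq_zero.1 this).resolve_left h0]

theorem irrep_eq_zero_of_weight {d : ℕ} {c : Fin d → ℂ}
    (hc : (irrep d).h c = ((d : ℂ) + 1) • c) : c = 0 := by
  ext i
  have h := congrFun hc i
  rw [irrep_h_apply, Pi.smul_apply, smul_eq_mul] at h
  have : ((i.1 : ℂ) + 1) * c i = 0 := by linear_combination (-1 / 2 : ℂ) * h
  exact (mul_eq_zero.1 this).resolve_left (Nat.cast_add_one_ne_zero _)

theorem irrep_isHighestWeight_single {d : ℕ} (hd : 0 < d) {N : ℤ} (hN : (N : ℂ) = (d : ℂ) - 1) :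
    (irrep d).IsHighestWeight N (Pi.single ⟨0, hd⟩ 1) := by
  refine ⟨fun h => ?_, ?_, ?_⟩
  · simpa using congrFun h ⟨0, hd⟩
  · simp [irrep_e_single]
  · rw [irrep_h_single, hN]; simp

theorem SlTwoRep.Intertwines.isHighestWeight {V W : Type*} [AddCommGroup V] [Module ℂ V]
    [AddCommGroup W] [Module ℂ W] {A : SlTwoRep V} {B : SlTwoRep W} {φ : V ≃ₗ[ℂ] W}
    (h : A.Intertwines B φ) {N : ℤ} {x : V} (hx : A.IsHighestWeight N x) :
    B.IsHighestWeight N (φ x) := by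
  refine ⟨by simpa using hx.1, ?_, ?_⟩
  · rw [← h.1, hx.2.1, map_zero]
  · rw [← h.2.2, hx.2.2, map_smul]

namespace CurrentRep

variable {M : Type*} [AddCommGroup M] [Module ℂ M] {M' : Type*} [AddCommGroup M'] [Module ℂ M']

/-- The module has `V_{(n+1)}` in degree `0`, `V_{(n-1)}` in degree `1`, and `v₋₂` takes some
highest weight vector to a highest weight vector (if `n ≥ 1`). -/
structure IsStandard (σ : CurrentRep M) (n : ℕ) : Prop where
  iso_zero : (irrep (n + 2)).Iso (σ.degRep 0)
  iso_one : (irrep n).Iso (σ.degRep 1)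
  deg_eq_bot : ∀ i : ℤ, i ≠ 0 → i ≠ 1 → σ.deg i = ⊥
  exists_highestWeight : 1 ≤ n → ∃ x ∈ σ.deg 0, σ.IsHighestWeight (n + 1) x ∧
    σ.IsHighestWeight (n - 1) (σ.vm2 x)

theorem v0_apply (σ : CurrentRep M) (x : M) : σ.v0 x = σ.e (σ.vm2 x) - σ.vm2 (σ.e x) := by
  rw [← σ.lie_e_vm2]; rfl

theorem v2_apply (σ : CurrentRep M) (x : M) :
    σ.v2 x = (-1 / 2 : ℂ) • (σ.e (σ.v0 x) - σ.v0 (σ.e x)) := by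
  have h := LinearMap.congr_fun σ.lie_e_v0 x
  simp only [Ring.lie_def, LinearMap.sub_apply, Module.End.mul_apply, LinearMap.neg_apply,
    LinearMap.smul_apply] at h
  rw [h, ← Nat.cast_smul_eq_nsmul ℂ, smul_neg, ← neg_smul, smul_smul]
  norm_num

theorem f_vm2 (σ : CurrentRep M) (x : M) : σ.f (σ.vm2 x) = σ.vm2 (σ.f x) := by
  have h := LinearMap.congr_fun σ.lie_f_vm2 x
  simpa [Ring.lie_def, sub_eq_zero] using h

theorem isHighestWeight_degRep {σ : CurrentRep M} {i N : ℤ} {x : σ.deg i} :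
    (σ.degRep i).IsHighestWeight N x ↔ σ.IsHighestWeight N x.1 := by
  refine and_congr ?_ (and_congr ?_ ?_)
  · rw [Ne, Ne, ← Submodule.coe_eq_zero]
  · rw [← Submodule.coe_eq_zero]; rfl
  · rw [Subtype.ext_iff]; rfl

namespace IsStandard

variable {σ : CurrentRep M} {σ' : CurrentRep M'} {n : ℕ}

theorem isCompl (h : σ.IsStandard n) : IsCompl (σ.deg 0) (σ.deg 1) := by
  have hi := DirectSum.isInternal_submodule_iff_iSupIndep_and_iSup_eq_top _ |>.1 σ.isInternal
  refine ⟨hi.1.pairwiseDisjoint (by norm_num), ?_⟩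
  rw [codisjoint_iff, eq_top_iff, ← hi.2]
  refine iSup_le fun i => ?_
  by_cases h0 : i = 0
  · subst h0; exact le_sup_left
  by_cases h1 : i = 1
  · subst h1; exact le_sup_right
  · rw [h.deg_eq_bot i h0 h1]; exact bot_le

theorem exists_add (h : σ.IsStandard n) (m : M) :
    ∃ x ∈ σ.deg 0, ∃ y ∈ σ.deg 1, m = x + y := by
  have : m ∈ σ.deg 0 ⊔ σ.deg 1 := by rw [h.isCompl.sup_eq_top]; trivial
  obtain ⟨x, hx, y, hy, rfl⟩ := Submodule.mem_sup.1 this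
  exact ⟨x, hx, y, hy, rfl⟩

theorem add_inj (h : σ.IsStandard n) {x x' y y' : M} (hx : x ∈ σ.deg 0) (hx' : x' ∈ σ.deg 0)
    (hy : y ∈ σ.deg 1) (hy' : y' ∈ σ.deg 1) (hxy : x + y = x' + y') : x = x' ∧ y = y' := by
  have h1 : x - x' = y' - y := by rw [sub_eq_sub_iff_add_eq_add, hxy, add_comm]
  have h2 := Submodule.disjoint_def.1 h.isCompl.disjoint (x - x') (sub_mem hx hx')
    (by rw [h1]; exact sub_mem hy' hy)
  refine ⟨sub_eq_zero.1 h2, ?_⟩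
  rw [h2] at h1
  exact (sub_eq_zero.1 h1.symm).symm

theorem finrank_zero (h : σ.IsStandard n) : finrank ℂ (σ.deg 0) = n + 2 := by
  obtain ⟨φ, -⟩ := h.iso_zero
  simpa using φ.finrank_eq.symm

theorem finrank_one (h : σ.IsStandard n) : finrank ℂ (σ.deg 1) = n := by
  obtain ⟨φ, -⟩ := h.iso_one
  simpa using φ.finrank_eq.symm

theorem finite_zero (h : σ.IsStandard n) : FiniteDimensional ℂ (σ.deg 0) := by
  obtain ⟨φ, -⟩ := h.iso_zero
  exact Module.Finite.equiv φ

theorem finite_one (h : σ.IsStandard n) : FiniteDimensional ℂ (σ.deg 1) := by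
  obtain ⟨φ, -⟩ := h.iso_one
  exact Module.Finite.equiv φ

/-- The highest weight line: a vector that spans the weight space of weight `n + 1`, and that
`v₋₂` takes to a highest weight vector. -/
theorem exists_generator (h : σ.IsStandard n) : ∃ x ∈ σ.deg 0, σ.IsHighestWeight (n + 1) x ∧
    (1 ≤ n → σ.IsHighestWeight (n - 1) (σ.vm2 x)) ∧
    ∀ m, σ.h m = (((n + 1 : ℤ) : ℂ)) • m → ∃ c : ℂ, m = c • x := by
  have hw : ∃ x ∈ σ.deg 0, σ.IsHighestWeight (n + 1) x ∧
      (1 ≤ n → σ.IsHighestWeight (n - 1) (σ.vm2 x)) := by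
    by_cases hn : 1 ≤ n
    · obtain ⟨x, h1, h2, h3⟩ := h.exists_highestWeight hn
      exact ⟨x, h1, h2, fun _ => h3⟩
    · obtain ⟨φ, hφ⟩ := h.iso_zero
      refine ⟨_, (φ (Pi.single ⟨0, by omega⟩ 1)).2, isHighestWeight_degRep.1
        (hφ.isHighestWeight (irrep_isHighestWeight_single (by omega) ?_)), fun h => absurd h hn⟩
      push_cast; ring
  obtain ⟨x, hx0, hx, hx1⟩ := hw
  refine ⟨x, hx0, hx, hx1, fun m hm => ?_⟩
  obtain ⟨a, ha, b, hb, rfl⟩ := h.exists_add m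
  rw [map_add, smul_add] at hm
  obtain ⟨hma, hmb⟩ := h.add_inj (σ.h_mem 0 a ha) (Submodule.smul_mem _ _ ha) (σ.h_mem 1 b hb)
    (Submodule.smul_mem _ _ hb) hm
  -- the weights of `V_{(n-1)}` are smaller than `n + 1`
  have hb0 : b = 0 := by
    obtain ⟨φ, hφ⟩ := h.iso_one
    have h1 : (irrep n).h (φ.symm ⟨b, hb⟩) = ((n : ℂ) + 1) • φ.symm ⟨b, hb⟩ := by
      rw [hφ.symm.2.2 ⟨b, hb⟩ |>.symm, ← map_smul]
      congr 1
      ext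
      simpa [degRep] using hmb
    have h2 := irrep_eq_zero_of_weight h1
    simpa using h2
  have key : ∀ u (hu : u ∈ σ.deg 0), σ.h u = (((n + 1 : ℤ) : ℂ)) • u →
      ∀ φ : (Fin (n + 2) → ℂ) ≃ₗ[ℂ] σ.deg 0, (irrep (n + 2)).Intertwines (σ.degRep 0) φ →
      ∃ c : ℂ, u = c • (φ (Pi.single ⟨0, by omega⟩ 1) : σ.deg 0).1 := by
    intro u hu huw φ hφ
    have h1 : (irrep (n + 2)).h (φ.symm ⟨u, hu⟩) = (((n + 2 : ℕ) : ℂ) - 1) • φ.symm ⟨u, hu⟩ := by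
      rw [hφ.symm.2.2 ⟨u, hu⟩ |>.symm, ← map_smul]
      congr 1
      ext
      have : (((n + 2 : ℕ) : ℂ) - 1) = ((n + 1 : ℤ) : ℂ) := by push_cast; ring
      rw [this]
      simpa [degRep] using huw
    have h2 := irrep_eq_smul_single (by omega) h1
    refine ⟨φ.symm ⟨u, hu⟩ ⟨0, by omega⟩, ?_⟩
    rw [← Submodule.coe_smul, ← map_smul, ← h2, φ.apply_symm_apply]
  obtain ⟨φ, hφ⟩ := h.iso_zero
  obtain ⟨c, hc⟩ := key a ha hma φ hφ
  obtain ⟨c', hc'⟩ := key x hx0 hx.2.2 φ hφ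
  have hc0 : c' ≠ 0 := by
    rintro rfl
    exact hx.1 (by rw [hc', zero_smul])
  refine ⟨c * c'⁻¹, ?_⟩
  rw [hb0, add_zero, hc, hc', smul_smul, mul_assoc, inv_mul_cancel₀ hc0, mul_one]

theorem isHighestWeight_vm2 (h : σ.IsStandard n) (hn : 1 ≤ n) {x : M} (hx0 : x ∈ σ.deg 0)
    (hx : σ.IsHighestWeight (n + 1) x) :
    σ.vm2 x ∈ σ.deg 1 ∧ σ.IsHighestWeight (n - 1) (σ.vm2 x) := by
  refine ⟨by simpa using σ.vm2_mem 0 x hx0, ?_⟩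
  obtain ⟨y, -, -, hy, hgen⟩ := h.exists_generator
  obtain ⟨c, rfl⟩ := hgen x hx.2.2
  have hc : c ≠ 0 := by rintro rfl; exact hx.1 (zero_smul _ _)
  obtain ⟨h1, h2, h3⟩ := hy hn
  refine ⟨?_, ?_, ?_⟩
  · simp [hc, h1]
  · simp [h2]
  · rw [map_smul, map_smul, h3, smul_comm]

/-- A submodule that contains the generator in degree `0` is everything. -/
theorem eq_top_of_mem (h : σ.IsStandard n) {x : M} (hx0 : x ∈ σ.deg 0)
    (hx : σ.IsHighestWeight (n + 1) x) {A : Submodule ℂ M} (hA : σ.IsInvariant A) (hxA : x ∈ A) :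
    A = ⊤ := by
  have hle0 : σ.deg 0 ≤ A := by
    have := h.finite_zero
    have := (σ.degRep 0).eq_top_of_highestWeight_mem (d := n + 2) (x := ⟨x, hx0⟩)
      (N := n + 1) (by push_cast; ring) (isHighestWeight_degRep.2 hx) h.finrank_zero.le
      (A.submoduleOf (σ.deg 0)) hxA (fun u hu => (hA u hu).2.1)
    intro u hu
    exact (this ▸ Submodule.mem_top : (⟨u, hu⟩ : σ.deg 0) ∈ A.submoduleOf (σ.deg 0))
  have hle1 : σ.deg 1 ≤ A := by
    have := h.finite_one
    rcases Nat.eq_zero_or_pos n with rfl | hn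
    · have : Subsingleton (σ.deg 1) := finrank_zero_iff.1 h.finrank_one
      rw [Submodule.subsingleton_iff_eq_bot.1 this]
      exact bot_le
    · obtain ⟨hy0, hy⟩ := h.isHighestWeight_vm2 hn hx0 hx
      have := (σ.degRep 1).eq_top_of_highestWeight_mem (d := n) (x := ⟨_, hy0⟩)
        (N := n - 1) (by push_cast; ring) (isHighestWeight_degRep.2 hy) h.finrank_one.le
        (A.submoduleOf (σ.deg 1)) (hA x hxA).2.2.2.2.2 (fun u hu => (hA u hu).2.1)
      intro u hu
      exact (this ▸ Submodule.mem_top : (⟨u, hu⟩ : σ.deg 1) ∈ A.submoduleOf (σ.deg 1))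
  rw [eq_top_iff, ← h.isCompl.sup_eq_top]
  exact sup_le hle0 hle1

/-- Since the weight space of weight `n + 1` is a line, one of two complementary submodules
contains it, and it generates the module. -/
theorem isIndecomposable (h : σ.IsStandard n) : σ.IsIndecomposable := by
  obtain ⟨x, hx0, hx, -, hgen⟩ := h.exists_generator
  refine ⟨⟨x, 0, hx.1⟩, fun A B hA hB hAB => ?_⟩
  obtain ⟨a, ha, b, hb, hab⟩ : ∃ a ∈ A, ∃ b ∈ B, a + b = x :=
    Submodule.mem_sup.1 (by rw [hAB.sup_eq_top]; trivial)
  have hw := hx.2.2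
  rw [← hab, map_add, smul_add] at hw
  have h1 : σ.h a - (((n + 1 : ℤ) : ℂ)) • a = (((n + 1 : ℤ) : ℂ)) • b - σ.h b := by
    rw [sub_eq_sub_iff_add_eq_add, hw, add_comm]
  have h2 := Submodule.disjoint_def.1 hAB.disjoint _
    (sub_mem (hA a ha).2.2.1 (A.smul_mem _ ha))
    (by rw [h1]; exact sub_mem (B.smul_mem _ hb) (hB b hb).2.2.1)
  rw [h2] at h1
  obtain ⟨c, hc⟩ := hgen a (sub_eq_zero.1 h2)
  obtain ⟨c', hc'⟩ := hgen b (sub_eq_zero.1 h1.symm).symm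
  by_cases hc0 : c = 0
  · left
    have hxB : x ∈ B := by rw [← hab, hc, hc0, zero_smul, zero_add]; exact hb
    have := h.eq_top_of_mem hx0 hx hB hxB
    exact hAB.disjoint.eq_bot_of_le (this ▸ le_top)
  · right
    have hxA : x ∈ A := by
      have : x = c⁻¹ • a := by rw [hc, smul_smul, inv_mul_cancel₀ hc0, one_smul]
      exact this ▸ A.smul_mem _ ha
    have := h.eq_top_of_mem hx0 hx hA hxA
    exact hAB.disjoint.symm.eq_bot_of_le (this ▸ le_top)

theorem exists_intertwines_zero (h : σ.IsStandard n) (h' : σ'.IsStandard n) {x : M} {x' : M'}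
    (hx0 : x ∈ σ.deg 0) (hx : σ.IsHighestWeight (n + 1) x)
    (hx0' : x' ∈ σ'.deg 0) (hx' : σ'.IsHighestWeight (n + 1) x') :
    ∃ φ : σ.deg 0 ≃ₗ[ℂ] σ'.deg 0, (σ.degRep 0).Intertwines (σ'.degRep 0) φ ∧
      φ ⟨x, hx0⟩ = ⟨x', hx0'⟩ := by
  have := h.finite_zero
  have := h'.finite_zero
  obtain ⟨φ, hφ, hφ0⟩ := (σ.degRep 0).exists_irrep_iso (d := n + 2) (x := ⟨x, hx0⟩)
    (N := n + 1) (by push_cast; ring) (isHighestWeight_degRep.2 hx) h.finrank_zero.le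
  obtain ⟨ψ, hψ, hψ0⟩ := (σ'.degRep 0).exists_irrep_iso (d := n + 2) (x := ⟨x', hx0'⟩)
    (N := n + 1) (by push_cast; ring) (isHighestWeight_degRep.2 hx') h'.finrank_zero.le
  refine ⟨_, hφ.symm.trans hψ, ?_⟩
  have h0 := hφ0 ⟨0, by omega⟩
  have h0' := hψ0 ⟨0, by omega⟩
  simp only [pow_zero, Module.End.one_apply] at h0 h0'
  rw [LinearEquiv.trans_apply, ← h0, φ.symm_apply_apply, h0']

theorem exists_intertwines_one (h : σ.IsStandard n) (h' : σ'.IsStandard n) {y : M} {y' : M'}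
    (hy0 : y ∈ σ.deg 1) (hy : 1 ≤ n → σ.IsHighestWeight (n - 1) y)
    (hy0' : y' ∈ σ'.deg 1) (hy' : 1 ≤ n → σ'.IsHighestWeight (n - 1) y') :
    ∃ φ : σ.deg 1 ≃ₗ[ℂ] σ'.deg 1, (σ.degRep 1).Intertwines (σ'.degRep 1) φ ∧
      φ ⟨y, hy0⟩ = ⟨y', hy0'⟩ := by
  have := h.finite_one
  have := h'.finite_one
  rcases Nat.eq_zero_or_pos n with rfl | hn
  · obtain ⟨φ, hφ⟩ := h.iso_one
    obtain ⟨ψ, hψ⟩ := h'.iso_one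
    have : Subsingleton (σ'.deg 1) := finrank_zero_iff.1 h'.finrank_one
    exact ⟨_, hφ.symm.trans hψ, Subsingleton.elim _ _⟩
  obtain ⟨φ, hφ, hφ0⟩ := (σ.degRep 1).exists_irrep_iso (d := n) (x := ⟨y, hy0⟩)
    (N := n - 1) (by push_cast; ring) (isHighestWeight_degRep.2 (hy hn)) h.finrank_one.le
  obtain ⟨ψ, hψ, hψ0⟩ := (σ'.degRep 1).exists_irrep_iso (d := n) (x := ⟨y', hy0'⟩)
    (N := n - 1) (by push_cast; ring) (isHighestWeight_degRep.2 (hy' hn)) h'.finrank_one.le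
  refine ⟨_, hφ.symm.trans hψ, ?_⟩
  have h0 := hφ0 ⟨0, hn⟩
  have h0' := hψ0 ⟨0, hn⟩
  simp only [pow_zero, Module.End.one_apply] at h0 h0'
  rw [LinearEquiv.trans_apply, ← h0, φ.symm_apply_apply, h0']

/-- Two standard modules are isomorphic: `v₋₂` commutes with `f`, so that it is determined by its
value on a highest weight vector, and it determines `v₀` and `v₂`. -/
theorem iso (h : σ.IsStandard n) (h' : σ'.IsStandard n) : σ.Iso σ' := by
  obtain ⟨x, hx0, hx, hxy, -⟩ := h.exists_generator
  obtain ⟨x', hx0', hx', hxy', -⟩ := h'.exists_generator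
  have hy0 : σ.vm2 x ∈ σ.deg 1 := by simpa using σ.vm2_mem 0 x hx0
  have hy0' : σ'.vm2 x' ∈ σ'.deg 1 := by simpa using σ'.vm2_mem 0 x' hx0'
  obtain ⟨φ, hφ, hφx⟩ := h.exists_intertwines_zero h' hx0 hx hx0' hx'
  obtain ⟨ψ, hψ, hψy⟩ := h.exists_intertwines_one h' hy0 hxy hy0' hxy'
  let Φ : M ≃ₗ[ℂ] M' := (Submodule.prodEquivOfIsCompl _ _ h.isCompl).symm ≪≫ₗ
    (φ.prodCongr ψ) ≪≫ₗ Submodule.prodEquivOfIsCompl _ _ h'.isCompl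
  have hΦ0 : ∀ u (hu : u ∈ σ.deg 0), Φ u = φ ⟨u, hu⟩ := by
    intro u hu
    have := Submodule.prodEquivOfIsCompl_symm_apply_left _ _ h.isCompl ⟨u, hu⟩
    simp only [Φ, LinearEquiv.trans_apply, this]
    simp
  have hΦ1 : ∀ u (hu : u ∈ σ.deg 1), Φ u = ψ ⟨u, hu⟩ := by
    intro u hu
    have := Submodule.prodEquivOfIsCompl_symm_apply_right _ _ h.isCompl ⟨u, hu⟩
    simp only [Φ, LinearEquiv.trans_apply, this]
    simp
  have comm : ∀ (S : End ℂ M) (T : End ℂ M'), (∀ u ∈ σ.deg 0, Φ (S u) = T (Φ u)) →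
      (∀ u ∈ σ.deg 1, Φ (S u) = T (Φ u)) → ∀ u, Φ (S u) = T (Φ u) := by
    intro S T h0 h1 u
    obtain ⟨a, ha, b, hb, rfl⟩ := h.exists_add u
    simp only [map_add, h0 a ha, h1 b hb]
  have he : ∀ u, Φ (σ.e u) = σ'.e (Φ u) := comm _ _
    (fun u hu => by
      rw [hΦ0 _ (σ.e_mem 0 u hu), hΦ0 u hu]; exact congrArg Subtype.val (hφ.1 ⟨u, hu⟩))
    (fun u hu => by
      rw [hΦ1 _ (σ.e_mem 1 u hu), hΦ1 u hu]; exact congrArg Subtype.val (hψ.1 ⟨u, hu⟩))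
  have hf : ∀ u, Φ (σ.f u) = σ'.f (Φ u) := comm _ _
    (fun u hu => by
      rw [hΦ0 _ (σ.f_mem 0 u hu), hΦ0 u hu]; exact congrArg Subtype.val (hφ.2.1 ⟨u, hu⟩))
    (fun u hu => by
      rw [hΦ1 _ (σ.f_mem 1 u hu), hΦ1 u hu]; exact congrArg Subtype.val (hψ.2.1 ⟨u, hu⟩))
  have hh : ∀ u, Φ (σ.h u) = σ'.h (Φ u) := comm _ _
    (fun u hu => by
      rw [hΦ0 _ (σ.h_mem 0 u hu), hΦ0 u hu]; exact congrArg Subtype.val (hφ.2.2 ⟨u, hu⟩))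
    (fun u hu => by
      rw [hΦ1 _ (σ.h_mem 1 u hu), hΦ1 u hu]; exact congrArg Subtype.val (hψ.2.2 ⟨u, hu⟩))
  have hm : ∀ u, Φ (σ.vm2 u) = σ'.vm2 (Φ u) := by
    refine comm _ _ (fun u hu => ?_) (fun u hu => ?_)
    · have := h.finite_zero
      let U : Submodule ℂ M :=
        LinearMap.eqLocus ((Φ : M →ₗ[ℂ] M') ∘ₗ σ.vm2) (σ'.vm2 ∘ₗ (Φ : M →ₗ[ℂ] M'))
      have := (σ.degRep 0).eq_top_of_highestWeight_mem (d := n + 2) (x := ⟨x, hx0⟩)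
        (N := n + 1) (by push_cast; ring) (isHighestWeight_degRep.2 hx) h.finrank_zero.le
        (U.submoduleOf (σ.deg 0)) ?_ ?_
      · exact (this ▸ Submodule.mem_top : (⟨u, hu⟩ : σ.deg 0) ∈ U.submoduleOf (σ.deg 0))
      · change Φ (σ.vm2 x) = σ'.vm2 (Φ x)
        rw [hΦ0 x hx0, hφx, hΦ1 _ hy0, hψy]
      · intro v hv
        change Φ (σ.vm2 (σ.f v)) = σ'.vm2 (Φ (σ.f v))
        change Φ (σ.vm2 v) = σ'.vm2 (Φ v) at hv
        rw [← f_vm2, hf, hf, ← f_vm2, hv]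
    · have h1 : σ.vm2 u = 0 := by
        have := σ.vm2_mem 1 u hu
        rwa [h.deg_eq_bot _ (by norm_num) (by norm_num), Submodule.mem_bot] at this
      have h2 : σ'.vm2 (Φ u) = 0 := by
        have := σ'.vm2_mem 1 (Φ u) (by rw [hΦ1 u hu]; exact (ψ ⟨u, hu⟩).2)
        rwa [h'.deg_eq_bot _ (by norm_num) (by norm_num), Submodule.mem_bot] at this
      rw [h1, h2, map_zero]
  have h0 : ∀ u, Φ (σ.v0 u) = σ'.v0 (Φ u) := by
    intro u
    rw [v0_apply, v0_apply, map_sub, he, hm, hm, he]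
  refine ⟨Φ, ⟨he, hf, hh⟩, fun u => ?_, h0, hm, fun i => ?_⟩
  · rw [v2_apply, v2_apply, map_smul, map_sub, he, h0, h0, he]
  · by_cases hi0 : i = 0
    · subst hi0
      ext v
      simp only [Submodule.mem_map, LinearEquiv.coe_coe]
      constructor
      · rintro ⟨u, hu, rfl⟩
        rw [hΦ0 u hu]; exact (φ _).2
      · intro hv
        exact ⟨φ.symm ⟨v, hv⟩, (φ.symm ⟨v, hv⟩).2, by rw [hΦ0 _ (φ.symm ⟨v, hv⟩).2]; simp⟩
    by_cases hi1 : i = 1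
    · subst hi1
      ext v
      simp only [Submodule.mem_map, LinearEquiv.coe_coe]
      constructor
      · rintro ⟨u, hu, rfl⟩
        rw [hΦ1 u hu]; exact (ψ _).2
      · intro hv
        exact ⟨ψ.symm ⟨v, hv⟩, (ψ.symm ⟨v, hv⟩).2, by rw [hΦ1 _ (ψ.symm ⟨v, hv⟩).2]; simp⟩
    rw [h.deg_eq_bot i hi0 hi1, h'.deg_eq_bot i hi0 hi1, Submodule.map_bot]

end IsStandard

end CurrentRep

/-! ### Words and their gradings -/

/-- Words that encode the enhanced states of the closure of `σ₁ ⋯ σₙ`.  The letter in position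
`p` is `none` if the `p`-th crossing is `1`-resolved, which joins the strands in positions `p` and
`p + 1`; it is `some b` if `p` is the last strand of a circle with label `b`.  The last letter
always is a label, so that it is stored as a `Bool`. -/
def Word : ℕ → Type
  | 0 => Bool
  | n + 1 => Option Bool × Word n

instance instFintypeWord : (n : ℕ) → Fintype (Word n)
  | 0 => inferInstanceAs (Fintype Bool)
  | n + 1 =>
    have := instFintypeWord n
    inferInstanceAs (Fintype (Option Bool × Word n))

theorem sum_word_zero {β : Type*} [AddCommMonoid β] (F : Word 0 → β) :
    ∑ x, F x = F true + F false := Fintype.sum_bool F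

theorem sum_word_succ {β : Type*} [AddCommMonoid β] {n : ℕ} (F : Word (n + 1) → β) :
    ∑ x, F x = ∑ x, F (none, x) + (∑ x, F (some true, x) + ∑ x, F (some false, x)) := by
  refine (Fintype.sum_prod_type _).trans ?_
  rw [Fintype.sum_option, Fintype.sum_bool]

/-- The weight of the label `b` of a circle consisting of an odd (`q = true`) or even
(`q = false`) number of strands. -/
def labelWeight (q b : Bool) : ℤ := if q then signVal b else 0

/-- The sum of all labels. -/
def wordTau : (n : ℕ) → Word n → ℤ
  | 0, b => signVal b
  | n + 1, (none, x) => wordTau n x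
  | n + 1, (some b, x) => signVal b + wordTau n x

/-- The sum of the labels of the circles with an odd number of strands, where the first circle
contains further strands to the left, whose number has parity `p`. -/
def wordWeight : (n : ℕ) → Bool → Word n → ℤ
  | 0, p, b => labelWeight (!p) b
  | n + 1, p, (none, x) => wordWeight n (!p) x
  | n + 1, p, (some b, x) => labelWeight (!p) b + wordWeight n false x

/-- The number of joined crossings. -/
def wordOnes : (n : ℕ) → Word n → ℕ
  | 0, _ => 0
  | n + 1, (none, x) => wordOnes n x + 1
  | n + 1, (some _, x) => wordOnes n x

/-- The words agree except possibly for the first label. -/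
def SameTail : (n : ℕ) → Word n → Word n → Prop
  | 0, _, _ => True
  | n + 1, (none, x), (none, y) => SameTail n x y
  | _ + 1, (some _, x), (some _, y) => x = y
  | _ + 1, (none, _), (some _, _) => False
  | _ + 1, (some _, _), (none, _) => False

/-- The word `y` arises from `x` by joining the circles on the two sides of the `t`-th crossing and
giving some label to the result. -/
def WordEdge : (n : ℕ) → Fin n → Word n → Word n → Prop
  | n + 1, t, (o, x), (o', y) =>
    Fin.cases (o ≠ none ∧ o' = none ∧ SameTail n x y) (fun t' => o = o' ∧ WordEdge n t' x y) t

/-- The sign `-1` to the number of joined crossings before the `t`-th one. -/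
def wordSign : (n : ℕ) → Fin n → Word n → ℂ
  | n + 1, t, (o, x) =>
    Fin.cases 1 (fun t' => (if o = none then -1 else 1) * wordSign n t' x) t

/-! ### Operators on words -/

/-- The part of a chain that consists of the words with first letter `o`. -/
def part {n : ℕ} (o : Option Bool) : (Word (n + 1) → ℂ) →ₗ[ℂ] (Word n → ℂ) :=
  LinearMap.funLeft ℂ ℂ fun x => (o, x)

theorem part_apply {n : ℕ} (o : Option Bool) (z : Word (n + 1) → ℂ) (x : Word n) :
    part o z x = z (o, x) := rfl

theorem ext_part {n : ℕ} {z z' : Word (n + 1) → ℂ} (h0 : part none z = part none z')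
    (h : ∀ b, part (some b) z = part (some b) z') : z = z' := by
  funext ⟨o, x⟩
  rcases o with _ | b
  · exact congrFun h0 x
  · exact congrFun (h b) x

/-- The coefficient of the word with the only letter `d`. -/
def val (d : Bool) : (Word 0 → ℂ) →ₗ[ℂ] ℂ := LinearMap.proj (R := ℂ) (φ := fun _ : Word 0 => ℂ) d

theorem ext_val {z z' : Word 0 → ℂ} (h : ∀ d, val d z = val d z') : z = z' :=
  funext fun d => h d

/-- The operator with prescribed coefficients. -/
def glueVal (F : Bool → ((Word 0 → ℂ) →ₗ[ℂ] ℂ)) : (Word 0 → ℂ) →ₗ[ℂ] (Word 0 → ℂ) :=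
  LinearMap.pi (φ := fun _ : Word 0 => ℂ) F

theorem val_glueVal (F : Bool → ((Word 0 → ℂ) →ₗ[ℂ] ℂ)) (d : Bool) (z : Word 0 → ℂ) :
    val d (glueVal F z) = F d z := rfl

/-- The operator with prescribed parts. -/
def glue {n : ℕ} (F : Option Bool → ((Word (n + 1) → ℂ) →ₗ[ℂ] (Word n → ℂ))) :
    (Word (n + 1) → ℂ) →ₗ[ℂ] (Word (n + 1) → ℂ) :=
  LinearMap.pi fun y : Option Bool × Word n => LinearMap.proj y.2 ∘ₗ F y.1

theorem part_glue {n : ℕ} (F : Option Bool → ((Word (n + 1) → ℂ) →ₗ[ℂ] (Word n → ℂ)))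
    (o : Option Bool) (z : Word (n + 1) → ℂ) : part o (glue F z) = F o z := rfl

/-- Structure constants of a multiplication of labels: `c q b r b' d` is the coefficient of the
label `d` in the product of a label `b` of a circle of parity `q` and a label `b'` of a circle of
parity `r`. -/
abbrev Coeffs := Bool → Bool → Bool → Bool → Bool → ℤ

/-- Multiplication of the first label by the label `b` of a circle of parity `q`, where the first
circle contains further strands, whose number has parity `r`. -/
def mulFirst (c : Coeffs) (q b : Bool) : (n : ℕ) → Bool → (Word n → ℂ) →ₗ[ℂ] (Word n → ℂ)
  | 0, r => glueVal fun d => ∑ b' : Bool, (c q b (!r) b' d : ℂ) • val b'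
  | n + 1, r => glue fun o => match o with
    | none => mulFirst c q b n (!r) ∘ₗ part none
    | some d => ∑ b' : Bool, (c q b (!r) b' d : ℂ) • part (some b')

/-- The differential that joins adjacent circles and multiplies their labels, where the first circle
contains further strands, whose number has parity `p`. -/
def wordDiff (c : Coeffs) : (n : ℕ) → Bool → (Word n → ℂ) →ₗ[ℂ] (Word n → ℂ)
  | 0, _ => 0
  | n + 1, p => glue fun o => match o with
    | none => -(wordDiff c n (!p) ∘ₗ part none) +
        ∑ b : Bool, mulFirst c (!p) b n false ∘ₗ part (some b)
    | some b => wordDiff c n false ∘ₗ part (some b)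

/-- The operator that reverses labels `s` of odd circles, with signs that alternate along the odd
circles; the first circle contains further strands, whose number has parity `p`. -/
def wordFlip (s : Bool) : (n : ℕ) → Bool → (Word n → ℂ) →ₗ[ℂ] (Word n → ℂ)
  | 0, p => glueVal fun d => if p = false ∧ d = !s then val s else 0
  | n + 1, p => glue fun o => match o with
    | none => wordFlip s n (!p) ∘ₗ part none
    | some d => if p then wordFlip s n false ∘ₗ part (some d) else
        (if d = !s then part (some s) else 0) - wordFlip s n false ∘ₗ part (some d)

section parts

variable (c : Coeffs) (n : ℕ) (p q b r s : Bool)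

@[simp] theorem val_mulFirst (z : Word 0 → ℂ) (d : Bool) : val d (mulFirst c q b 0 r z) =
    (c q b (!r) true d : ℂ) * val true z + (c q b (!r) false d : ℂ) * val false z := by
  rw [mulFirst, val_glueVal]
  simp

@[simp] theorem part_none_mulFirst (z : Word (n + 1) → ℂ) :
    part none (mulFirst c q b (n + 1) r z) = mulFirst c q b n (!r) (part none z) := rfl

@[simp] theorem part_some_mulFirst (z : Word (n + 1) → ℂ) (d : Bool) :
    part (some d) (mulFirst c q b (n + 1) r z) =
      (c q b (!r) true d : ℂ) • part (some true) z +
        (c q b (!r) false d : ℂ) • part (some false) z := by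
  rw [mulFirst, part_glue]
  simp

@[simp] theorem wordDiff_zero : wordDiff c 0 p = 0 := rfl

@[simp] theorem part_none_wordDiff (z : Word (n + 1) → ℂ) :
    part none (wordDiff c (n + 1) p z) = -wordDiff c n (!p) (part none z) +
      (mulFirst c (!p) true n false (part (some true) z) +
        mulFirst c (!p) false n false (part (some false) z)) := by
  rw [wordDiff, part_glue]
  simp

@[simp] theorem part_some_wordDiff (z : Word (n + 1) → ℂ) (d : Bool) :
    part (some d) (wordDiff c (n + 1) p z) = wordDiff c n false (part (some d) z) := rfl

@[simp] theorem val_wordFlip (z : Word 0 → ℂ) (d : Bool) :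
    val d (wordFlip s 0 p z) = if p = false ∧ d = !s then val s z else 0 := by
  rw [wordFlip, val_glueVal]
  split_ifs <;> rfl

@[simp] theorem part_none_wordFlip (z : Word (n + 1) → ℂ) :
    part none (wordFlip s (n + 1) p z) = wordFlip s n (!p) (part none z) := rfl

@[simp] theorem part_some_wordFlip_true (z : Word (n + 1) → ℂ) (d : Bool) :
    part (some d) (wordFlip s (n + 1) true z) = wordFlip s n false (part (some d) z) := rfl

@[simp] theorem part_some_wordFlip_false (z : Word (n + 1) → ℂ) (d : Bool) :
    part (some d) (wordFlip s (n + 1) false z) =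
      (if d = !s then part (some s) z else 0) - wordFlip s n false (part (some d) z) := by
  rw [wordFlip, part_glue]
  dsimp only
  rw [if_neg Bool.false_ne_true]
  split_ifs <;> rfl

end parts

/-! ### Algebraic identities between the operators -/

/-- Associativity of a multiplication of labels. -/
def Coeffs.Assoc (c : Coeffs) : Prop :=
  ∀ q b r b' s b'' d : Bool, ∑ a, c q b r b' a * c (q ^^ r) a s b'' d =
    ∑ a, c r b' s b'' a * c q b (r ^^ s) a d

theorem Coeffs.Assoc.mulFirst_mulFirst {c : Coeffs} (hc : c.Assoc) (q b r b' : Bool) (n : ℕ) :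
    ∀ (s : Bool) (z : Word n → ℂ), mulFirst c q b n (r ^^ s) (mulFirst c r b' n s z) =
      (c q b r b' true : ℂ) • mulFirst c (q ^^ r) true n s z +
        (c q b r b' false : ℂ) • mulFirst c (q ^^ r) false n s z := by
  have hc' : ∀ s b'' d : Bool, (c q b r b' true : ℂ) * c (q ^^ r) true s b'' d +
      c q b r b' false * c (q ^^ r) false s b'' d =
      c r b' s b'' true * c q b (r ^^ s) true d + c r b' s b'' false * c q b (r ^^ s) false d := by
    intro s b'' d
    have := hc q b r b' s b'' d
    simp only [Fintype.sum_bool] at this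
    exact_mod_cast this
  induction n with
  | zero =>
    intro s z
    refine ext_val fun d => ?_
    simp only [val_mulFirst, map_add, map_smul, smul_eq_mul]
    have h1 := hc' (!s) true d
    have h2 := hc' (!s) false d
    rw [Bool.xor_not] at h1 h2
    linear_combination -(val true z) * h1 - (val false z) * h2
  | succ n ih =>
    intro s z
    refine ext_part ?_ fun d => ?_
    · simp only [part_none_mulFirst, map_add, map_smul]
      rw [← Bool.xor_not, ih]
    · simp only [part_some_mulFirst, map_add, map_smul]
      have h1 := hc' (!s) true d
      have h2 := hc' (!s) false d
      rw [Bool.xor_not] at h1 h2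
      linear_combination (norm := module) -h1 • (part (some true) z) - h2 • (part (some false) z)

/-- Multiplying the first label commutes with joining later circles. -/
theorem Coeffs.Assoc.wordDiff_mulFirst {c : Coeffs} (hc : c.Assoc) (q b : Bool) (n : ℕ) :
    ∀ (r : Bool) (z : Word n → ℂ), wordDiff c n (q ^^ r) (mulFirst c q b n r z) =
      mulFirst c q b n r (wordDiff c n r z) := by
  induction n with
  | zero => intro r z; simp
  | succ n ih =>
    intro r z
    refine ext_part ?_ fun d => ?_
    · simp only [part_none_mulFirst, part_none_wordDiff, part_some_mulFirst, map_add, map_smul,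
        map_neg]
      have h1 := hc.mulFirst_mulFirst q b (!r) true n false (part (some true) z)
      have h2 := hc.mulFirst_mulFirst q b (!r) false n false (part (some false) z)
      rw [Bool.xor_false] at h1 h2
      rw [h1, h2, ← Bool.xor_not, ih]
      module
    · simp only [part_some_mulFirst, part_some_wordDiff, map_add, map_smul]

theorem Coeffs.Assoc.wordDiff_wordDiff {c : Coeffs} (hc : c.Assoc) (n : ℕ) :
    ∀ (p : Bool) (z : Word n → ℂ), wordDiff c n p (wordDiff c n p z) = 0 := by
  induction n with
  | zero => intro p z; simp
  | succ n ih =>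
    intro p z
    refine ext_part ?_ fun d => ?_
    · simp only [part_none_wordDiff, part_some_wordDiff, map_add, map_neg, map_zero]
      have h1 := hc.wordDiff_mulFirst (!p) true n false (part (some true) z)
      have h2 := hc.wordDiff_mulFirst (!p) false n false (part (some false) z)
      rw [Bool.xor_false] at h1 h2
      rw [h1, h2, ih]
      module
    · simp only [part_some_wordDiff, ih, map_zero]

theorem mulFirst_add (c c' : Coeffs) (q b : Bool) (n : ℕ) :
    ∀ (r : Bool) (z : Word n → ℂ), mulFirst (c + c') q b n r z =
      mulFirst c q b n r z + mulFirst c' q b n r z := by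
  induction n with
  | zero =>
    intro r z
    refine ext_val fun d => ?_
    simp only [val_mulFirst, map_add, Pi.add_apply]
    push_cast
    ring
  | succ n ih =>
    intro r z
    refine ext_part ?_ fun d => ?_
    · simp only [part_none_mulFirst, map_add, ih]
    · simp only [part_some_mulFirst, map_add, Pi.add_apply]
      push_cast
      module

theorem wordDiff_add (c c' : Coeffs) (n : ℕ) :
    ∀ (p : Bool) (z : Word n → ℂ), wordDiff (c + c') n p z =
      wordDiff c n p z + wordDiff c' n p z := by
  induction n with
  | zero => intro p z; simp
  | succ n ih =>
    intro p z
    refine ext_part ?_ fun d => ?_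
    · simp only [part_none_wordDiff, map_add, ih, mulFirst_add]
      abel
    · simp only [part_some_wordDiff, map_add, ih]

theorem wordDiff_anticomm {c c' : Coeffs} (hc : c.Assoc) (hc' : c'.Assoc) (h : (c + c').Assoc)
    (n : ℕ) (p : Bool) (z : Word n → ℂ) :
    wordDiff c n p (wordDiff c' n p z) + wordDiff c' n p (wordDiff c n p z) = 0 := by
  have := h.wordDiff_wordDiff n p z
  simp only [wordDiff_add, map_add, hc.wordDiff_wordDiff, hc'.wordDiff_wordDiff, zero_add,
    add_zero] at this
  rw [← this, add_comm]

/-- The failure of the flip operator to be an (alternating) derivation of a multiplication of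
labels. -/
def Coeffs.defect (c : Coeffs) (s q b r b' d : Bool) : ℤ :=
  (if (q ^^ r) ∧ d = !s then c q b r b' s else 0)
    - (if q then -1 else 1) * (if r ∧ b' = s then c q b r (!s) d else 0)
    - (if q ∧ b = s then c q (!s) r b' d else 0)

/-- The commutator of the flip operator with a multiplication of the first label. -/
def flipMul (c : Coeffs) (s q b : Bool) (n : ℕ) (r : Bool) (z : Word n → ℂ) : Word n → ℂ :=
  wordFlip s n (q ^^ r) (mulFirst c q b n r z)
    - (if q then (-1 : ℂ) else 1) • mulFirst c q b n r (wordFlip s n r z)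
    - if q ∧ b = s then mulFirst c q (!s) n r z else 0

theorem flipMul_zero (c : Coeffs) (s q b r : Bool) (z : Word 0 → ℂ) (d : Bool) :
    val d (flipMul c s q b 0 r z) =
      c.defect s q b (!r) true d * val true z + c.defect s q b (!r) false d * val false z := by
  simp only [flipMul, map_sub, map_smul, smul_eq_mul, val_wordFlip, val_mulFirst, Coeffs.defect,
    apply_ite (val d), map_zero]
  cases q <;> cases r <;> cases s <;> cases b <;> cases d <;> simp <;> ring

theorem part_none_flipMul (c : Coeffs) (s q b r : Bool) (n : ℕ) (z : Word (n + 1) → ℂ) :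
    part none (flipMul c s q b (n + 1) r z) = flipMul c s q b n (!r) (part none z) := by
  simp only [flipMul, map_sub, map_smul, part_none_wordFlip, part_none_mulFirst, Bool.xor_not,
    apply_ite (part none), map_zero]

theorem part_some_flipMul (c : Coeffs) (s q b r : Bool) (n : ℕ) (z : Word (n + 1) → ℂ) (d : Bool) :
    part (some d) (flipMul c s q b (n + 1) r z) =
      (c.defect s q b (!r) true d : ℂ) • part (some true) z +
        (c.defect s q b (!r) false d : ℂ) • part (some false) z := by
  simp only [flipMul, map_sub, map_smul, part_some_mulFirst, apply_ite (part (some d)), map_zero,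
    Coeffs.defect]
  cases q <;> cases r <;> cases s <;> cases b <;> cases d <;>
    simp only [Bool.xor_false, Bool.xor_true, Bool.not_true, Bool.not_false,
      part_some_wordFlip_true, part_some_wordFlip_false, map_add, map_smul, part_some_mulFirst,
      and_true, and_false, if_true, if_false, Bool.false_eq_true, reduceCtorEq] <;> push_cast <;> module

theorem flipMul_add_flipMul {c c' : Coeffs} {s s' : Bool}
    (h : ∀ q b r b' d, c.defect s q b r b' d + c'.defect s' q b r b' d = 0) (q b : Bool) (n : ℕ) :
    ∀ (r : Bool) (z : Word n → ℂ), flipMul c s q b n r z + flipMul c' s' q b n r z = 0 := by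
  have h' : ∀ q b r b' d, (c.defect s q b r b' d : ℂ) + c'.defect s' q b r b' d = 0 := by
    exact_mod_cast h
  induction n with
  | zero =>
    intro r z
    refine ext_val fun d => ?_
    simp only [map_add, flipMul_zero, map_zero]
    linear_combination (val true z) * h' q b (!r) true d + (val false z) * h' q b (!r) false d
  | succ n ih =>
    intro r z
    refine ext_part ?_ fun d => ?_
    · simp only [map_add, part_none_flipMul, ih, map_zero]
    · simp only [map_add, part_some_flipMul, map_zero]
      linear_combination (norm := module) (h' q b (!r) true d) • part (some true) z +
        (h' q b (!r) false d) • part (some false) z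

/-- The commutator of a flip operator with a differential. -/
def flipDiff (c : Coeffs) (s : Bool) (n : ℕ) (p : Bool) (z : Word n → ℂ) : Word n → ℂ :=
  wordFlip s n p (wordDiff c n p z) - wordDiff c n p (wordFlip s n p z)

theorem part_none_flipDiff (c : Coeffs) (s p : Bool) (n : ℕ) (z : Word (n + 1) → ℂ) :
    part none (flipDiff c s (n + 1) p z) = -flipDiff c s n (!p) (part none z) +
      (flipMul c s (!p) true n false (part (some true) z) +
        flipMul c s (!p) false n false (part (some false) z)) := by
  simp only [flipDiff, flipMul, map_sub, part_none_wordFlip, part_none_wordDiff, map_add, map_neg]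
  cases p <;> cases s <;>
    simp only [Bool.xor_false, Bool.not_true, Bool.not_false, part_some_wordFlip_true,
      part_some_wordFlip_false, map_sub, map_zero,
      and_true, and_false, if_true, if_false, Bool.false_eq_true, reduceCtorEq] <;> module

theorem part_some_flipDiff (c : Coeffs) (s p : Bool) (n : ℕ) (z : Word (n + 1) → ℂ) (d : Bool) :
    part (some d) (flipDiff c s (n + 1) p z) =
      (if p then (1 : ℂ) else -1) • flipDiff c s n false (part (some d) z) := by
  simp only [flipDiff, map_sub, part_some_wordDiff]
  cases p <;>
    simp only [part_some_wordFlip_true, part_some_wordFlip_false, part_some_wordDiff, map_sub,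
      apply_ite (wordDiff c n false), map_zero, if_true, if_false, Bool.false_eq_true] <;> module

theorem flipDiff_add_flipDiff {c c' : Coeffs} {s s' : Bool}
    (h : ∀ q b r b' d, c.defect s q b r b' d + c'.defect s' q b r b' d = 0) (n : ℕ) :
    ∀ (p : Bool) (z : Word n → ℂ), flipDiff c s n p z + flipDiff c' s' n p z = 0 := by
  induction n with
  | zero => intro p z; simp [flipDiff]
  | succ n ih =>
    intro p z
    refine ext_part ?_ fun d => ?_
    · simp only [map_add, part_none_flipDiff, map_zero]
      linear_combination (norm := module) -ih (!p) (part none z) +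
        flipMul_add_flipMul h (!p) true n false (part (some true) z) +
        flipMul_add_flipMul h (!p) false n false (part (some false) z)
    · simp only [map_add, part_some_flipDiff, map_zero]
      rw [← smul_add, ih, smul_zero]

theorem flipDiff_eq_zero {c : Coeffs} {s : Bool} (h : ∀ q b r b' d, c.defect s q b r b' d = 0)
    (n : ℕ) (p : Bool) (z : Word n → ℂ) : flipDiff c s n p z = 0 := by
  have := flipDiff_add_flipDiff (c := c) (c' := c) (s := s) (s' := s) (by simp [h]) n p z
  rwa [← two_smul ℂ, smul_eq_zero_iff_right two_ne_zero] at this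

theorem wordFlip_commutator (n : ℕ) : ∀ (p : Bool) (z : Word n → ℂ),
    wordFlip false n p (wordFlip true n p z) - wordFlip true n p (wordFlip false n p z) =
      fun x => (wordWeight n p x : ℂ) * z x := by
  induction n with
  | zero =>
    intro p z
    refine ext_val fun d => ?_
    have h : val d (fun x => (wordWeight 0 p x : ℂ) * z x) = (labelWeight (!p) d : ℂ) * val d z :=
      rfl
    rw [h]
    simp only [map_sub, val_wordFlip]
    cases p <;> cases d <;> simp [labelWeight, signVal]
  | succ n ih =>
    intro p z
    refine ext_part ?_ fun d => ?_
    · simp only [map_sub, part_none_wordFlip, ih]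
      rfl
    · have h : part (some d) (fun x => (wordWeight (n + 1) p x : ℂ) * z x) =
          (labelWeight (!p) d : ℂ) • part (some d) z +
            fun x => (wordWeight n false x : ℂ) * part (some d) z x := by
        funext x
        simp only [part_apply, wordWeight, Pi.add_apply, Pi.smul_apply, smul_eq_mul]
        push_cast
        ring
      rw [h, ← ih]
      cases p <;> cases d <;>
        simp only [map_sub, part_some_wordFlip_true, part_some_wordFlip_false, Bool.not_true,
          Bool.not_false, if_true, if_false, Bool.false_eq_true, reduceCtorEq, labelWeight,
          signVal, map_zero] <;> push_cast <;> module

/-! ### The multiplications of labels -/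

/-- The structure constants of the merge maps that change the sum of the labels by `δτ` and the
weight by `δk`. -/
def mergeCoeffs (δτ δk : ℤ) : Coeffs := fun q b r b' d =>
  if signVal d = signVal b + signVal b' + δτ ∧
    labelWeight (q ^^ r) d = labelWeight q b + labelWeight r b' + δk then 1 else 0

theorem mergeCoeffs_zero_assoc : (mergeCoeffs (-1) 0).Assoc := by
  unfold Coeffs.Assoc; decide

theorem mergeCoeffs_minus_assoc : (mergeCoeffs (-1) (-2)).Assoc := by
  unfold Coeffs.Assoc; decide

theorem mergeCoeffs_lee_assoc : (mergeCoeffs 3 2).Assoc := by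
  unfold Coeffs.Assoc; decide

theorem mergeCoeffs_zero_add_minus_assoc : (mergeCoeffs (-1) 0 + mergeCoeffs (-1) (-2)).Assoc := by
  unfold Coeffs.Assoc; decide

theorem mergeCoeffs_zero_add_lee_assoc : (mergeCoeffs (-1) 0 + mergeCoeffs 3 2).Assoc := by
  unfold Coeffs.Assoc; decide

theorem defect_zero : ∀ s q b r b' d, (mergeCoeffs (-1) 0).defect s q b r b' d = 0 := by
  decide

theorem defect_minus : ∀ q b r b' d, (mergeCoeffs (-1) (-2)).defect true q b r b' d = 0 := by
  decide

theorem defect_lee : ∀ q b r b' d, (mergeCoeffs 3 2).defect false q b r b' d = 0 := by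
  decide

theorem defect_minus_add_lee : ∀ q b r b' d, (mergeCoeffs (-1) (-2)).defect false q b r b' d +
    (mergeCoeffs 3 2).defect true q b r b' d = 0 := by
  decide

/-! ### Matrix entries of the operators on words -/

theorem SameTail.wordOnes_eq {n : ℕ} : ∀ {x y : Word n}, SameTail n x y →
    wordOnes n x = wordOnes n y := by
  induction n with
  | zero => intro x y _; rfl
  | succ n ih =>
    rintro ⟨_ | b, x⟩ ⟨_ | d, y⟩ h
    · exact congrArg (· + 1) (ih h)
    · exact h.elim
    · exact h.elim
    · exact congrArg (wordOnes n) h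

theorem wordEdge_zero_iff {n : ℕ} {o o' : Option Bool} {x y : Word n} :
    WordEdge (n + 1) 0 (o, x) (o', y) ↔ o ≠ none ∧ o' = none ∧ SameTail n x y := Iff.rfl

theorem wordEdge_succ_iff {n : ℕ} {t : Fin n} {o o' : Option Bool} {x y : Word n} :
    WordEdge (n + 1) t.succ (o, x) (o', y) ↔ o = o' ∧ WordEdge n t x y := Iff.rfl

theorem WordEdge.wordOnes_eq {n : ℕ} : ∀ {t : Fin n} {x y : Word n}, WordEdge n t x y →
    wordOnes n y = wordOnes n x + 1 := by
  induction n with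
  | zero => intro t; exact t.elim0
  | succ n ih =>
    rintro t ⟨o, x⟩ ⟨o', y⟩ h
    induction t using Fin.cases with
    | zero =>
      obtain ⟨h1, rfl, h2⟩ := h
      rcases o with _ | b
      · exact absurd rfl h1
      · exact congrArg (· + 1) h2.wordOnes_eq.symm
    | succ t =>
      obtain ⟨rfl, h2⟩ := h
      rcases o with _ | b
      · exact congrArg (· + 1) (ih h2)
      · exact ih h2

open scoped Classical in
theorem mulFirst_apply (δτ δk : ℤ) (q b : Bool) (n : ℕ) : ∀ (r : Bool) (z : Word n → ℂ)
    (y : Word n), mulFirst (mergeCoeffs δτ δk) q b n r z y =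
      ∑ x, (if SameTail n x y ∧ wordTau n y = signVal b + wordTau n x + δτ ∧
        wordWeight n (q ^^ r) y = labelWeight q b + wordWeight n r x + δk then 1 else 0) * z x := by
  induction n with
  | zero =>
    intro r z y
    refine (val_mulFirst _ q b r z y).trans ?_
    rw [sum_word_zero]
    simp only [SameTail, wordTau, wordWeight, mergeCoeffs, true_and, Bool.xor_not]
    push_cast
    rfl
  | succ n ih =>
    rintro r z ⟨_ | d, y⟩
    · change part none (mulFirst _ q b (n + 1) r z) y = _
      rw [part_none_mulFirst, ih, sum_word_succ]
      simp only [SameTail, wordTau, wordWeight, false_and, if_false, zero_mul,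
        Finset.sum_const_zero, add_zero, Bool.xor_not]
      rfl
    · change part (some d) (mulFirst _ q b (n + 1) r z) y = _
      rw [part_some_mulFirst, sum_word_succ]
      have h : ∀ b', ∑ x, (if SameTail (n + 1) (some b', x) (some d, y) ∧
          wordTau (n + 1) (some d, y) = signVal b + wordTau (n + 1) (some b', x) + δτ ∧
          wordWeight (n + 1) (q ^^ r) (some d, y) =
            labelWeight q b + wordWeight (n + 1) r (some b', x) + δk then (1 : ℂ) else 0) *
            z (some b', x) = (mergeCoeffs δτ δk q b (!r) b' d : ℂ) * part (some b') z y := by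
        intro b'
        rw [Finset.sum_eq_single y]
        · simp only [SameTail, wordTau, wordWeight, mergeCoeffs, true_and, Bool.xor_not]
          push_cast
          congr 1
          refine if_congr (and_congr ?_ ?_) rfl rfl <;> constructor <;> intro _ <;> linarith
        · intro x _ hx
          simp [SameTail, hx]
        · simp
      rw [h, h]
      simp only [SameTail, false_and, if_false, zero_mul, Finset.sum_const_zero, zero_add,
        Pi.add_apply, Pi.smul_apply, smul_eq_mul]

open scoped Classical in
theorem wordDiff_apply (δτ δk : ℤ) (n : ℕ) : ∀ (p : Bool) (z : Word n → ℂ) (y : Word n),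
    wordDiff (mergeCoeffs δτ δk) n p z y =
      ∑ x, (∑ t, if WordEdge n t x y ∧ wordTau n y = wordTau n x + δτ ∧
        wordWeight n p y = wordWeight n p x + δk then wordSign n t x else 0) * z x := by
  induction n with
  | zero => intro p z y; simp
  | succ n ih =>
    rintro p z ⟨_ | d, y⟩
    · change part none (wordDiff _ (n + 1) p z) y = _
      rw [part_none_wordDiff, sum_word_succ]
      simp only [Fin.sum_univ_succ, Pi.add_apply, Pi.neg_apply, ih, mulFirst_apply, wordEdge_zero_iff,
        wordEdge_succ_iff, wordSign, Fin.cases_zero, Fin.cases_succ, wordTau, wordWeight, ne_eq, not_true_eq_false,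
        false_and, if_false, zero_add, true_and, if_true, reduceCtorEq, not_false_eq_true,
        Finset.sum_const_zero, add_zero, Bool.xor_false]
      congr 1
      rw [← Finset.sum_neg_distrib]
      refine Finset.sum_congr rfl fun x _ => ?_
      rw [← neg_mul, ← Finset.sum_neg_distrib]
      congr 1
      refine Finset.sum_congr rfl fun t _ => ?_
      rw [neg_one_mul, apply_ite Neg.neg, neg_zero]
    · change part (some d) (wordDiff _ (n + 1) p z) y = _
      rw [part_some_wordDiff, sum_word_succ]
      have h : ∀ b, ∑ x, (∑ t, if WordEdge (n + 1) t (some b, x) (some d, y) ∧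
          wordTau (n + 1) (some d, y) = wordTau (n + 1) (some b, x) + δτ ∧
          wordWeight (n + 1) p (some d, y) = wordWeight (n + 1) p (some b, x) + δk
          then wordSign (n + 1) t (some b, x) else 0) * z (some b, x) =
          if b = d then wordDiff (mergeCoeffs δτ δk) n false (part (some d) z) y else 0 := by
        intro b
        by_cases hb : b = d
        · subst hb
          simp only [Fin.sum_univ_succ, ih, wordEdge_zero_iff, wordEdge_succ_iff, wordSign, Fin.cases_zero, Fin.cases_succ,
            wordTau, wordWeight, reduceCtorEq, false_and, and_false, if_false, if_true, zero_add,
            true_and, one_mul, add_assoc, add_right_inj]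
          rfl
        · simp [Fin.sum_univ_succ, wordEdge_zero_iff, wordEdge_succ_iff, hb]
      rw [h, h]
      have h0 : ∑ x, (∑ t, if WordEdge (n + 1) t (none, x) (some d, y) ∧
          wordTau (n + 1) (some d, y) = wordTau (n + 1) (none, x) + δτ ∧
          wordWeight (n + 1) p (some d, y) = wordWeight (n + 1) p (none, x) + δk
          then wordSign (n + 1) t (none, x) else 0) * z (none, x) = 0 := by
        simp [Fin.sum_univ_succ, wordEdge_zero_iff, wordEdge_succ_iff]
      rw [h0]
      cases d <;> simp

/-- The parity of the number of strands of the circle to be continued, after the letter `o`. -/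
def nextParity (p : Bool) (o : Option Bool) : Bool := if o = none then !p else false

/-- The word `y` arises from `x` by reversing the label `s` of the odd circle whose last strand is
in position `q`. -/
def WordFlip (s : Bool) : (n : ℕ) → Bool → Fin (n + 1) → Word n → Word n → Prop
  | 0, p, _, x, y => p = false ∧ x = s ∧ y = !s
  | n + 1, p, q, (o, x), (o', y) => Fin.cases (p = false ∧ o = some s ∧ o' = some (!s) ∧ x = y)
      (fun q' => o = o' ∧ WordFlip s n (nextParity p o) q' x y) q

theorem wordFlip_zero_iff {s p : Bool} {n : ℕ} {o o' : Option Bool} {x y : Word n} :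
    WordFlip s (n + 1) p 0 (o, x) (o', y) ↔
      p = false ∧ o = some s ∧ o' = some (!s) ∧ x = y := Iff.rfl

theorem wordFlip_succ_iff {s p : Bool} {n : ℕ} {q : Fin (n + 1)} {o o' : Option Bool}
    {x y : Word n} : WordFlip s (n + 1) p q.succ (o, x) (o', y) ↔
      o = o' ∧ WordFlip s n (nextParity p o) q x y := Iff.rfl

/-- The sign `-1` to the number of odd circles whose last strand is before the position `q`. -/
def flipSign : (n : ℕ) → Bool → Fin (n + 1) → Word n → ℂ
  | 0, _, _, _ => 1
  | n + 1, p, q, (o, x) => Fin.cases 1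
      (fun q' => (if p = false ∧ o ≠ none then -1 else 1) * flipSign n (nextParity p o) q' x) q

open scoped Classical in
theorem wordFlip_apply (s : Bool) (n : ℕ) : ∀ (p : Bool) (z : Word n → ℂ) (y : Word n),
    wordFlip s n p z y =
      ∑ x, (∑ q, if WordFlip s n p q x y then flipSign n p q x else 0) * z x := by
  induction n with
  | zero =>
    intro p z y
    have h : ∀ d : Bool, val d (wordFlip s 0 p z) =
        ∑ x, (∑ q, if WordFlip s 0 p q x d then flipSign 0 p q x else 0) * z x := by
      intro d
      have key : ∀ x : Bool, (∑ q, if WordFlip s 0 p q x d then flipSign 0 p q x else 0) =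
          if p = false ∧ x = s ∧ d = !s then 1 else 0 := by
        intro x
        rw [Fin.sum_univ_one]
        exact if_congr Iff.rfl rfl rfl
      rw [val_wordFlip, sum_word_zero, key, key]
      change (if p = false ∧ d = !s then z s else 0) = _
      cases s <;> cases d <;> cases p <;> simp
    exact h y
  | succ n ih =>
    rintro p z ⟨_ | d, y⟩
    · change part none (wordFlip s (n + 1) p z) y = _
      rw [part_none_wordFlip, sum_word_succ]
      simp only [Fin.sum_univ_succ (n := n + 1), ih, wordFlip_zero_iff, wordFlip_succ_iff, flipSign, Fin.cases_zero, Fin.cases_succ,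
        reduceCtorEq, and_false, false_and, if_false, zero_add, true_and, one_mul, ne_eq,
        not_true_eq_false, Finset.sum_const_zero, zero_mul, add_zero, nextParity, if_true]
      rfl
    · change part (some d) (wordFlip s (n + 1) p z) y = _
      rw [sum_word_succ]
      have h0 : ∑ x, (∑ q, if WordFlip s (n + 1) p q (none, x) (some d, y) then
          flipSign (n + 1) p q (none, x) else 0) * z (none, x) = 0 := by
        simp [Fin.sum_univ_succ, wordFlip_zero_iff, wordFlip_succ_iff]
      have h : ∀ b, ∑ x, (∑ q, if WordFlip s (n + 1) p q (some b, x) (some d, y) then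
          flipSign (n + 1) p q (some b, x) else 0) * z (some b, x) =
          (if p = false ∧ b = s ∧ d = !s then part (some b) z y else 0) +
          if b = d then (if p = false then -1 else 1) * wordFlip s n false (part (some d) z) y
            else 0 := by
        intro b
        simp only [Fin.sum_univ_succ (n := n + 1), wordFlip_zero_iff, wordFlip_succ_iff, flipSign,
          Fin.cases_zero, Fin.cases_succ, add_mul,
          Finset.sum_add_distrib, Option.some.injEq, nextParity, reduceCtorEq, if_false, ne_eq,
          not_false_eq_true, and_true]
        congr 1
        · by_cases hp : p = false ∧ b = s ∧ d = !s
          · rw [if_pos hp, Finset.sum_eq_single y]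
            · obtain ⟨rfl, rfl, rfl⟩ := hp
              simp [part_apply]
            · intro x _ hx
              simp [hx]
            · simp
          · rw [if_neg hp]
            refine Finset.sum_eq_zero fun x _ => ?_
            rw [if_neg (fun h => hp ⟨h.1, h.2.1, h.2.2.1⟩), zero_mul]
        · by_cases hb : b = d
          · subst hb
            simp only [true_and, if_true, ih, Finset.mul_sum]
            refine Finset.sum_congr rfl fun x _ => ?_
            rw [← mul_assoc, Finset.mul_sum]
            congr 1
            refine Finset.sum_congr rfl fun q _ => ?_
            rw [mul_ite, mul_zero]
          · simp [hb]
      rw [h0, h, h]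
      cases p
      · rw [part_some_wordFlip_false]
        cases s <;> cases d <;> simp
        all_goals ring
      · rw [part_some_wordFlip_true]
        cases s <;> cases d <;> simp

/-! ### Bihomogeneous chains of words -/

/-- The chain is supported on words with `i` joined crossings for which the labels of the even
circles add up to `j - i`. -/
def IsHomog (n : ℕ) (p : Bool) (i : ℕ) (j : ℤ) (z : Word n → ℂ) : Prop :=
  ∀ x, z x ≠ 0 → wordOnes n x = i ∧ wordTau n x + wordOnes n x - wordWeight n p x = j

theorem exists_of_wordDiff_ne_zero {δτ δk : ℤ} {n : ℕ} {p : Bool} {z : Word n → ℂ} {y : Word n}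
    (h : wordDiff (mergeCoeffs δτ δk) n p z y ≠ 0) : ∃ x, z x ≠ 0 ∧
      wordOnes n y = wordOnes n x + 1 ∧ wordTau n y = wordTau n x + δτ ∧
      wordWeight n p y = wordWeight n p x + δk := by
  classical
  rw [wordDiff_apply] at h
  obtain ⟨x, -, hx⟩ := Finset.exists_ne_zero_of_sum_ne_zero h
  obtain ⟨t, -, ht⟩ := Finset.exists_ne_zero_of_sum_ne_zero (left_ne_zero_of_mul hx)
  have h1 := (ne_eq _ _ ▸ ht : ¬_)
  by_cases hc : WordEdge n t x y ∧ wordTau n y = wordTau n x + δτ ∧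
        wordWeight n p y = wordWeight n p x + δk
  · exact ⟨x, right_ne_zero_of_mul hx, hc.1.wordOnes_eq, hc.2⟩
  · rw [if_neg hc] at ht
    exact absurd rfl ht

theorem IsHomog.wordDiff {δτ δk : ℤ} {n : ℕ} {p : Bool} {i : ℕ} {j : ℤ} {z : Word n → ℂ}
    (hz : IsHomog n p i j z) :
    IsHomog n p (i + 1) (j + 1 + δτ - δk) (wordDiff (mergeCoeffs δτ δk) n p z) := by
  intro y hy
  obtain ⟨x, hx, h1, h2, h3⟩ := exists_of_wordDiff_ne_zero hy
  obtain ⟨h4, h5⟩ := hz x hx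
  refine ⟨by omega, ?_⟩
  rw [h2, h3, h1]
  push_cast
  linarith

theorem IsHomog.sub {n : ℕ} {p : Bool} {i : ℕ} {j : ℤ} {z z' : Word n → ℂ}
    (hz : IsHomog n p i j z) (hz' : IsHomog n p i j z') : IsHomog n p i j (z - z') := by
  intro x hx
  by_cases h : z x = 0
  · refine hz' x fun h' => hx ?_
    simp [h, h']
  · exact hz x h

theorem IsHomog.part_some {n : ℕ} {i : ℕ} {j : ℤ} {z : Word (n + 1) → ℂ}
    (hz : IsHomog (n + 1) false i j z) (b : Bool) : IsHomog n false i j (part (some b) z) := by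
  intro x hx
  obtain ⟨h1, h2⟩ := hz (some b, x) hx
  refine ⟨h1, ?_⟩
  simp only [wordTau, wordOnes, wordWeight, labelWeight, Bool.not_false, if_true] at h2
  linarith

theorem IsHomog.part_none {n : ℕ} {i : ℕ} {j : ℤ} {z : Word (n + 1) → ℂ} {p : Bool}
    (hz : IsHomog (n + 1) p (i + 1) j z) : IsHomog n (!p) i (j - 1) (part none z) := by
  intro x hx
  obtain ⟨h1, h2⟩ := hz (none, x) hx
  simp only [wordTau, wordOnes, wordWeight] at h1 h2
  refine ⟨by omega, ?_⟩
  push_cast at h2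
  linarith

theorem IsHomog.part_some_true {n : ℕ} {i : ℕ} {j : ℤ} {z : Word (n + 1) → ℂ}
    (hz : IsHomog (n + 1) true i j z) (b : Bool) :
    IsHomog n false i (j - signVal b) (part (some b) z) := by
  intro x hx
  obtain ⟨h1, h2⟩ := hz (some b, x) hx
  refine ⟨h1, ?_⟩
  simp only [wordTau, wordOnes, wordWeight, labelWeight, Bool.not_true, if_false,
    Bool.false_eq_true] at h2
  linarith

theorem wordTau_eq_wordWeight {n : ℕ} : ∀ {x : Word n}, wordOnes n x = 0 →
    wordTau n x = wordWeight n false x := by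
  induction n with
  | zero => intro x _; rfl
  | succ n ih =>
    rintro ⟨_ | b, x⟩ h
    · exact absurd h (Nat.succ_ne_zero _)
    · exact congrArg (signVal b + ·) (ih h)

theorem IsHomog.eq_zero_of_degree_zero {n : ℕ} {j : ℤ} (hj : j ≠ 0) {z : Word n → ℂ}
    (hz : IsHomog n false 0 j z) : z = 0 := by
  funext x
  by_contra hx
  obtain ⟨h1, h2⟩ := hz x hx
  rw [wordTau_eq_wordWeight h1, h1] at h2
  apply hj
  rw [← h2]
  simp

theorem IsHomog.eq_zero_of_word_zero {i : ℕ} {j : ℤ} {p : Bool} {z : Word 0 → ℂ}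
    (hz : IsHomog 0 p (i + 1) j z) : z = 0 := by
  funext x
  by_contra hx
  exact absurd (hz x hx).1 (Nat.succ_ne_zero i).symm

theorem IsHomog.part_none_eq_zero {n : ℕ} {j : ℤ} {p : Bool} {z : Word (n + 1) → ℂ}
    (hz : IsHomog (n + 1) p 0 j z) : part none z = 0 := by
  funext x
  by_contra hx
  exact absurd (hz (none, x) hx).1 (Nat.succ_ne_zero _)

/-! ### Exactness of the complex of words -/

/-- The `k`-preserving differential on words. -/
abbrev wordDiffZero (n : ℕ) (p : Bool) : (Word n → ℂ) →ₗ[ℂ] (Word n → ℂ) :=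
  wordDiff (mergeCoeffs (-1) 0) n p

theorem wordDiffZero_wordDiffZero (n : ℕ) (p : Bool) (z : Word n → ℂ) :
    wordDiffZero n p (wordDiffZero n p z) = 0 :=
  mergeCoeffs_zero_assoc.wordDiff_wordDiff n p z

theorem IsHomog.wordDiffZero {n : ℕ} {p : Bool} {i : ℕ} {j : ℤ} {z : Word n → ℂ}
    (hz : IsHomog n p i j z) : IsHomog n p (i + 1) j (wordDiffZero n p z) := by
  have := hz.wordDiff (δτ := -1) (δk := 0)
  rwa [show j + 1 + -1 - 0 = j by ring] at this

/-- A bihomogeneous boundary is the boundary of a bihomogeneous chain. -/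
theorem IsHomog.exists_homog {n : ℕ} {p : Bool} {i : ℕ} {j : ℤ} {y : Word n → ℂ}
    (hy : IsHomog n p (i + 1) j (AnnularKhovanov.wordDiffZero n p y)) :
    ∃ y', IsHomog n p i j y' ∧
      AnnularKhovanov.wordDiffZero n p y' = AnnularKhovanov.wordDiffZero n p y := by
  classical
  let y' : Word n → ℂ := fun x =>
    if wordOnes n x = i ∧ wordTau n x + wordOnes n x - wordWeight n p x = j then y x else 0
  have hy' : IsHomog n p i j y' := by
    intro x hx
    by_contra h
    exact hx (if_neg h)
  refine ⟨y', hy', ?_⟩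
  funext w
  by_cases hw : wordOnes n w = i + 1 ∧ wordTau n w + wordOnes n w - wordWeight n p w = j
  · rw [← sub_eq_zero, ← Pi.sub_apply, ← map_sub]
    by_contra h
    obtain ⟨x, hx, h1, h2, h3⟩ := exists_of_wordDiff_ne_zero h
    apply hx
    have : wordOnes n x = i ∧ wordTau n x + wordOnes n x - wordWeight n p x = j := by
      refine ⟨by omega, ?_⟩
      rw [← hw.2, h2, h3, h1]
      push_cast
      ring
    rw [Pi.sub_apply, sub_eq_zero]
    exact if_pos this
  · rw [not_imp_comm.1 (hy w) hw, not_imp_comm.1 (hy'.wordDiffZero w) hw]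

/-- The chain with prescribed parts. -/
def ofParts {n : ℕ} (F : Option Bool → Word n → ℂ) : Word (n + 1) → ℂ :=
  fun x : Option Bool × Word n => F x.1 x.2

@[simp] theorem part_ofParts {n : ℕ} (F : Option Bool → Word n → ℂ) (o : Option Bool) :
    part o (ofParts F) = F o := rfl

/-- Prefixing the letter `b` to all words. -/
def consLabel {n : ℕ} (b : Bool) (z : Word n → ℂ) : Word (n + 1) → ℂ :=
  ofParts fun o => if o = some b then z else 0

theorem IsHomog.consLabel {n : ℕ} {i : ℕ} {j : ℤ} {z : Word n → ℂ} (hz : IsHomog n false i j z)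
    (b : Bool) : IsHomog (n + 1) false i j (consLabel b z) := by
  rintro ⟨o, x⟩ hx
  have ho : o = some b := by
    by_contra h
    exact hx (by simp [AnnularKhovanov.consLabel, ofParts, h])
  subst ho
  have hx' : z x ≠ 0 := by simpa [AnnularKhovanov.consLabel, ofParts] using hx
  obtain ⟨h1, h2⟩ := hz x hx'
  refine ⟨h1, ?_⟩
  simp only [wordTau, wordOnes, wordWeight, labelWeight, Bool.not_false, if_true]
  linarith

/-- A trivial circle labelled `+` is a unit. -/
theorem mulFirst_one (n : ℕ) : ∀ (r : Bool) (z : Word n → ℂ),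
    mulFirst (mergeCoeffs (-1) 0) false true n r z = z := by
  have h : ∀ r b d, mergeCoeffs (-1) 0 false true r b d = if b = d then 1 else 0 := by decide
  induction n with
  | zero =>
    intro r z
    refine ext_val fun d => ?_
    rw [val_mulFirst, h, h]
    cases d <;> simp
  | succ n ih =>
    intro r z
    refine ext_part ?_ fun d => ?_
    · rw [part_none_mulFirst, ih]
    · rw [part_some_mulFirst, h, h]
      cases d <;> simp

theorem part_label_wordDiffZero {n : ℕ} (z : Word (n + 2) → ℂ) (d : Bool) :
    part (some d) (part none (wordDiffZero (n + 2) false z)) =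
      -wordDiffZero n false (part (some d) (part none z)) +
        if d then 0 else part (some false) (part (some true) z) +
          part (some true) (part (some false) z) := by
  have h : ∀ b b', mergeCoeffs (-1) 0 true b true b' d =
    if d = false ∧ b ≠ b' then 1 else 0 := by revert d; decide
  rw [part_none_wordDiff]
  simp only [Bool.not_false, map_add, map_neg, part_some_wordDiff, part_some_mulFirst, h]
  cases d <;> simp

theorem part_none_none_wordDiffZero {n : ℕ} (z : Word (n + 2) → ℂ) :
    part none (part none (wordDiffZero (n + 2) false z)) =
      wordDiffZero n false (part none (part none z)) - part (some true) (part none z) -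
        mulFirst (mergeCoeffs (-1) 0) false false n false (part (some false) (part none z)) +
        (mulFirst (mergeCoeffs (-1) 0) true true n true (part none (part (some true) z)) +
        mulFirst (mergeCoeffs (-1) 0) true false n true (part none (part (some false) z))) := by
  rw [part_none_wordDiff]
  simp only [Bool.not_false, Bool.not_true, map_add, map_neg, part_none_wordDiff,
    part_none_mulFirst, mulFirst_one]
  abel

/-- The subcomplex of the chains without words starting with `-` is exact in the bidegrees
different from `(0, 0)` and `(1, 2)`.  By induction, the part starting with `+` of a cycle is a
boundary, since up to a boundary it lies in the subcomplex for shorter words; what remains are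
words starting with a joined crossing, which are handled by means of the unit `w₊`. -/
theorem exists_wordDiffZero_of_part_eq_zero (n : ℕ) : ∀ (i : ℕ) (j : ℤ), ¬(i = 0 ∧ j = 2) →
    ∀ z : Word (n + 1) → ℂ, IsHomog (n + 1) false (i + 1) j z → part (some false) z = 0 →
      wordDiffZero (n + 1) false z = 0 →
      ∃ y, part (some false) y = 0 ∧ wordDiffZero (n + 1) false y = z := by
  induction n with
  | zero =>
    intro i j hij z hz hz0 hdz
    have hz1 : part (some true) z = 0 := (hz.part_some true).eq_zero_of_word_zero
    have hz2 : val true (part none z) = 0 := by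
      by_contra h
      obtain ⟨h1, h2⟩ := hz.part_none true h
      apply hij
      simp only [wordTau, wordOnes, wordWeight, labelWeight, signVal] at h1 h2
      refine ⟨h1.symm, ?_⟩
      simp at h2
      linarith
    have hc : mergeCoeffs (-1) 0 true true true false false = 1 ∧
        mergeCoeffs (-1) 0 true true true true false = 0 ∧
        mergeCoeffs (-1) 0 true true true false true = 0 ∧
        mergeCoeffs (-1) 0 true true true true true = 0 := by decide
    -- the word `w₊` has bidegree `(1, 2)`, and `w₋` is the product of `v₊` and `v₋`
    refine ⟨consLabel true (part none z), rfl, ext_part (ext_val fun d => ?_) fun d => ?_⟩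
    · rw [part_none_wordDiff]
      simp only [map_add, map_neg, val_mulFirst, consLabel, part_ofParts]
      cases d <;> simp [hc, hz2]
    · rw [part_some_wordDiff]
      cases d <;> simp [hz0, hz1]
  | succ n ih =>
    intro i j hij z hz hz0 hdz
    have h1 : wordDiffZero (n + 1) false (part (some true) z) = 0 := by
      have := congrArg (part (some true)) hdz
      rwa [part_some_wordDiff, map_zero] at this
    have h2 : part (some false) (part (some true) z) =
        wordDiffZero n false (part (some false) (part none z)) := by
      have := congrArg (fun w => part (some false) (part none w)) hdz
      simp only [part_label_wordDiffZero, hz0, map_zero, add_zero] at this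
      rw [neg_add_eq_zero] at this
      exact this.symm
    let s := consLabel false (part (some false) (part none z))
    have hs : IsHomog (n + 1) false i j s := by
      have := (hz.part_none.part_some_true false).consLabel false
      rwa [show j - 1 - signVal false = j by simp [signVal]] at this
    obtain ⟨x, hx0, hx⟩ := ih i j hij (part (some true) z - wordDiffZero (n + 1) false s)
      ((hz.part_some true).sub hs.wordDiffZero)
      (by rw [map_sub, part_some_wordDiff, h2]; simp [s, consLabel])
      (by rw [map_sub, h1, wordDiffZero_wordDiffZero, sub_zero])
    have hs0 : part (some false) (x + s) = part (some false) (part none z) := by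
      rw [map_add, hx0, zero_add]; simp [s, consLabel]
    let y : Word (n + 2) → ℂ := ofParts fun o => match o with
      | none => consLabel true (-part none (part none z) +
          mulFirst (mergeCoeffs (-1) 0) true true n true (part none (x + s)))
      | some b => if b then x + s else 0
    have hy1 : part (some true) y = x + s := rfl
    have hy0 : part (some false) y = 0 := rfl
    have hyn : part none y = consLabel true (-part none (part none z) +
          mulFirst (mergeCoeffs (-1) 0) true true n true (part none (x + s))) := rfl
    refine ⟨y, hy0, ?_⟩
    -- all parts of the cycle `v` vanish, the part of the words starting with a circle `w₊` that
    -- consists of two strands because `w₊` is a unit and `v` is a cycle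
    set v := z - wordDiffZero (n + 2) false y with hv
    have hdv : wordDiffZero (n + 2) false v = 0 := by
      rw [hv, map_sub, hdz, wordDiffZero_wordDiffZero, sub_zero]
    have hv1 : part (some true) v = 0 := by
      rw [hv, map_sub, part_some_wordDiff, hy1, map_add, hx]
      abel
    have hv0 : part (some false) v = 0 := by
      rw [hv, map_sub, part_some_wordDiff, hy0, map_zero, hz0, sub_zero]
    have hvn0 : part (some false) (part none v) = 0 := by
      rw [hv, map_sub, map_sub, part_label_wordDiffZero, hy1, hs0, hy0, hyn]
      simp [consLabel]
    have hvnn : part none (part none v) = 0 := by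
      rw [hv, map_sub, map_sub, part_none_none_wordDiffZero, hy1, hy0, hyn]
      simp only [consLabel, part_ofParts, if_true, reduceCtorEq, if_false, map_zero,
        Option.some.injEq, Bool.false_eq_true]
      abel
    have hvn1 : part (some true) (part none v) = 0 := by
      have := congrArg (fun w => part none (part none w)) hdv
      simp only [part_none_none_wordDiffZero, hv1, hv0, hvn0, hvnn, map_zero] at this
      simpa using this
    have hv' : v = 0 := by
      refine ext_part (ext_part (by rw [hvnn]; simp) fun b => ?_) fun b => ?_
      · cases b
        · rw [hvn0]; simp
        · rw [hvn1]; simp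
      · cases b
        · rw [hv0]; simp
        · rw [hv1]; simp
    exact (sub_eq_zero.1 hv').symm

/-- The complex of words is exact in the bidegrees different from `(0, 0)` and `(1, 2)`. -/
theorem exists_wordDiffZero_eq (n : ℕ) : ∀ (i : ℕ) (j : ℤ), ¬(i = 0 ∧ j = 2) →
    ∀ z : Word n → ℂ, IsHomog n false (i + 1) j z → wordDiffZero n false z = 0 →
      ∃ y, wordDiffZero n false y = z := by
  induction n with
  | zero =>
    intro i j _ z hz _
    exact ⟨0, by rw [map_zero, hz.eq_zero_of_word_zero]⟩
  | succ n ih =>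
    intro i j hij z hz hdz
    obtain ⟨x, hx⟩ := ih i j hij (part (some false) z) (hz.part_some false) (by
      have := congrArg (part (some false)) hdz
      rwa [part_some_wordDiff, map_zero] at this)
    obtain ⟨x', hx', hxx'⟩ := IsHomog.exists_homog (hx ▸ hz.part_some false)
    rw [hx] at hxx'
    obtain ⟨y, -, hy⟩ := exists_wordDiffZero_of_part_eq_zero n i j hij
      (z - wordDiffZero (n + 1) false (consLabel false x'))
      (hz.sub (hx'.consLabel false).wordDiffZero)
      (by rw [map_sub, part_some_wordDiff]; simp [consLabel, hxx'])
      (by rw [map_sub, hdz, wordDiffZero_wordDiffZero, sub_zero])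
    exact ⟨y + consLabel false x', by rw [map_add, hy]; abel⟩

/-! ### Cycles in the remaining bidegrees -/

/-- The word `-⋯-+⋯+` with `a` letters `-`. -/
def sortedWord : (n : ℕ) → ℕ → Word n
  | 0, 0 => true
  | 0, _ + 1 => false
  | n + 1, 0 => (some true, sortedWord n 0)
  | n + 1, a + 1 => (some false, sortedWord n a)

/-- The word `-⋯-+⋯+` with `a` letters `-`, followed by a circle that consists of two strands and
is labelled `+`. -/
def sortedWordPair : (n : ℕ) → ℕ → Word (n + 1)
  | 0, _ => (none, true)
  | n + 1, 0 => (some true, sortedWordPair n 0)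
  | n + 1, a + 1 => (some false, sortedWordPair n a)

/-- A cycle of degree `0` is determined by its part starting with `-` and its value at `+⋯+`. -/
theorem eq_zero_of_sortedWord_zero (n : ℕ) (j : ℤ) : ∀ z : Word (n + 1) → ℂ,
    IsHomog (n + 1) false 0 j z → part (some false) z = 0 → wordDiffZero (n + 1) false z = 0 →
      z (sortedWord (n + 1) 0) = 0 → z = 0 := by
  induction n with
  | zero =>
    intro z hz hz0 hdz hs
    have hzn := hz.part_none_eq_zero
    have hc : mergeCoeffs (-1) 0 true true true false false = 1 ∧
        mergeCoeffs (-1) 0 true true true true false = 0 := by decide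
    have h := congrArg (fun w => val false (part none w)) hdz
    simp [part_none_wordDiff, hz0, hzn, hc] at h
    refine ext_part (by rw [hzn]; simp) fun b => ?_
    cases b
    · rw [hz0]; simp
    · refine ext_val fun d => ?_
      cases d
      · rw [h]; simp
      · exact hs
  | succ n ih =>
    intro z hz hz0 hdz hs
    have hzn := hz.part_none_eq_zero
    have h := congrArg (fun w => part (some false) (part none w)) hdz
    simp only [part_label_wordDiffZero, hz0, hzn, map_zero, neg_zero, zero_add, add_zero,
      Bool.false_eq_true, if_false] at h
    have h1 := ih (part (some true) z) (hz.part_some true) h (by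
      have := congrArg (part (some true)) hdz
      rwa [part_some_wordDiff, map_zero] at this) hs
    refine ext_part (by rw [hzn]; simp) fun b => ?_
    cases b
    · rw [hz0]; simp
    · rw [h1]; simp

/-- A cycle of degree `0` changes sign when adjacent labels `+` and `-` are swapped, so that it is
determined by its values at the words `-⋯-+⋯+`. -/
theorem eq_zero_of_sortedWord (n : ℕ) (j : ℤ) : ∀ z : Word n → ℂ,
    IsHomog n false 0 j z → wordDiffZero n false z = 0 →
      (∀ a < n + 2, z (sortedWord n a) = 0) → z = 0 := by
  induction n with
  | zero =>
    intro z _ _ hs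
    refine ext_val fun d => ?_
    cases d
    · exact hs 1 (by norm_num)
    · exact hs 0 (by norm_num)
  | succ n ih =>
    intro z hz hdz hs
    have h0 := ih (part (some false) z) (hz.part_some false) (by
      have := congrArg (part (some false)) hdz
      rwa [part_some_wordDiff, map_zero] at this) (fun a ha => hs (a + 1) (by omega))
    exact eq_zero_of_sortedWord_zero n j z hz h0 hdz (hs 0 (by omega))

/-- A cycle of bidegree `(1, 2)` is determined by its part starting with `-` and its value at the
word `+⋯+` followed by a trivial circle labelled `+`. -/
theorem eq_zero_of_sortedWordPair_zero (n : ℕ) : ∀ z : Word (n + 1) → ℂ,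
    IsHomog (n + 1) false 1 2 z → part (some false) z = 0 → wordDiffZero (n + 1) false z = 0 →
      z (sortedWordPair n 0) = 0 → z = 0 := by
  induction n with
  | zero =>
    intro z hz hz0 hdz hs
    have hz1 : part (some true) z = 0 := (hz.part_some true).eq_zero_of_word_zero
    refine ext_part (ext_val fun d => ?_) fun b => ?_
    · cases d
      · by_contra h
        obtain ⟨h1, h2⟩ := hz.part_none false h
        simp [wordTau, wordOnes, wordWeight, labelWeight, signVal] at h2
      · exact hs
    · cases b
      · rw [hz0]; simp
      · rw [hz1]; simp
  | succ n ih =>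
    intro z hz hz0 hdz hs
    have hz00 : part (some false) (part none z) = 0 :=
      (hz.part_none.part_some_true false).eq_zero_of_degree_zero (by simp [signVal])
    have hznn : part none (part none z) = 0 := hz.part_none.part_none_eq_zero
    have h := congrArg (fun w => part (some false) (part none w)) hdz
    simp only [part_label_wordDiffZero, hz0, hz00, map_zero, neg_zero, zero_add, add_zero,
      Bool.false_eq_true, if_false] at h
    have h1 := ih (part (some true) z) (hz.part_some true) h (by
      have := congrArg (part (some true)) hdz
      rwa [part_some_wordDiff, map_zero] at this) hs
    have h2 := congrArg (fun w => part none (part none w)) hdz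
    simp only [part_none_none_wordDiffZero, hz0, h1, hz00, hznn, map_zero, zero_sub, sub_zero,
      add_zero, neg_eq_zero] at h2
    refine ext_part (ext_part (by rw [hznn]; simp) fun b => ?_) fun b => ?_
    · cases b
      · rw [hz00]; simp
      · rw [h2]; simp
    · cases b
      · rw [hz0]; simp
      · rw [h1]; simp

/-- In a cycle of bidegree `(1, 2)` the position of the trivial circle can be moved, so that the
cycle is determined by its values at the words `-⋯-+⋯+` followed by a trivial circle. -/
theorem eq_zero_of_sortedWordPair (n : ℕ) : ∀ z : Word (n + 1) → ℂ,
    IsHomog (n + 1) false 1 2 z → wordDiffZero (n + 1) false z = 0 →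
      (∀ a < n + 1, z (sortedWordPair n a) = 0) → z = 0 := by
  induction n with
  | zero =>
    intro z hz hdz hs
    exact eq_zero_of_sortedWordPair_zero 0 z hz (hz.part_some false).eq_zero_of_word_zero hdz
      (hs 0 (by norm_num))
  | succ n ih =>
    intro z hz hdz hs
    have h0 := ih (part (some false) z) (hz.part_some false) (by
      have := congrArg (part (some false)) hdz
      rwa [part_some_wordDiff, map_zero] at this) (fun a ha => hs (a + 1) (by omega))
    exact eq_zero_of_sortedWordPair_zero (n + 1) z hz h0 hdz (hs 0 (by omega))

/-! ### Circles of the resolutions of the closure of `σ₁ ⋯ σₙ` -/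

/-- All crossings between the positions `p` and `q` are `1`-resolved. -/
def Joined {n : ℕ} (a : Fin n → Bool) (p q : Fin (n + 1)) : Prop :=
  ∀ u : Fin n, (p.1 ≤ u.1 ∧ u.1 < q.1) ∨ (q.1 ≤ u.1 ∧ u.1 < p.1) → a u = true

/-- The position `p` is the last one on its circle. -/
def IsEnd {n : ℕ} (a : Fin n → Bool) (p : Fin (n + 1)) : Prop :=
  ∀ u : Fin n, u.1 = p.1 → a u = false

section joined

variable {n : ℕ} {a : Fin n → Bool} {p q r : Fin (n + 1)}

theorem Joined.refl (a : Fin n → Bool) (p : Fin (n + 1)) : Joined a p p :=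
  fun u hu => by omega

theorem Joined.symm (h : Joined a p q) : Joined a q p := fun u hu => h u hu.symm

theorem Joined.trans (h : Joined a p q) (h' : Joined a q r) : Joined a p r := by
  intro u hu
  by_cases h1 : (p.1 ≤ u.1 ∧ u.1 < q.1) ∨ (q.1 ≤ u.1 ∧ u.1 < p.1)
  · exact h u h1
  · exact h' u (by omega)

theorem Joined.eq_of_isEnd (h : Joined a p q) (hp : IsEnd a p) (hq : IsEnd a q) : p = q := by
  by_contra hne
  have hne' : p.1 ≠ q.1 := fun h => hne (Fin.ext h)
  rcases Nat.lt_or_gt_of_ne hne' with hlt | hlt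
  · have h1 := h ⟨p.1, by omega⟩ (by simp; omega)
    rw [hp _ rfl] at h1
    exact absurd h1 (by simp)
  · have h1 := h ⟨q.1, by omega⟩ (by simp; omega)
    rw [hq _ rfl] at h1
    exact absurd h1 (by simp)

theorem exists_isEnd (a : Fin n → Bool) (p : Fin (n + 1)) :
    ∃ q, IsEnd a q ∧ Joined a p q := by
  induction p using Fin.reverseInduction with
  | last => exact ⟨Fin.last n, fun u hu => by have := u.2; simp at hu; omega, Joined.refl a _⟩
  | cast u ih =>
    by_cases hu : a u = true
    · obtain ⟨q, hq, hj⟩ := ih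
      refine ⟨q, hq, Joined.trans (fun v hv => ?_) hj⟩
      have : v = u := Fin.ext (by simp at hv; omega)
      rwa [this]
    · refine ⟨_, fun v hv => ?_, Joined.refl a _⟩
      have : v = u := Fin.ext (by simpa using hv)
      rw [this]
      simpa using hu

end joined

section circles

variable {n : ℕ} (a : Vertex n)

theorem joined_of_arc {P Q : Point n n} (h : Arc (stabWord n) a P Q) : Joined a P.2 Q.2 := by
  rcases h with p | ⟨t, p, _, _⟩ | ⟨t, p, _⟩ | ⟨t, ht⟩ | ⟨t, ht⟩
  · exact Joined.refl a _
  · exact Joined.refl a _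
  · exact Joined.refl a _
  all_goals
    intro u hu
    have : u = t := Fin.ext (by simp [stabWord] at hu; omega)
    rw [this, ht]
    rfl

theorem mk_step {t : Fin n} {p : Fin (n + 1)} (h : (p.1 ≠ t.1 ∧ p.1 ≠ t.1 + 1) ∨ a t = false) :
    (Quot.mk (Arc (stabWord n) a) (t.castSucc, p)) = Quot.mk _ (t.succ, p) := by
  rcases h with h | h
  · refine Quot.sound (Arc.away t p ?_ ?_)
    · intro h'; exact h.1 (by rw [h']; rfl)
    · intro h'; exact h.2 (by rw [h']; rfl)
  · refine Quot.sound (Arc.straight t p ?_)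
    rw [h]; simp [stabWord]

/-- All points in the same position lie on the same circle. -/
theorem mk_level (p : Fin (n + 1)) : ∀ l : Fin (n + 1),
    Quot.mk (Arc (stabWord n) a) (l, p) = Quot.mk _ (0, p) := by
  -- above the crossing with the next position, a strand closes up around the annulus
  have above : ∀ p l : Fin (n + 1), p.1 < l.1 →
      Quot.mk (Arc (stabWord n) a) (l, p) = Quot.mk _ (0, p) := by
    intro p l
    induction l using Fin.reverseInduction with
    | last => exact fun _ => Quot.sound (Arc.close p)
    | cast u ih =>
      intro h
      simp only [Fin.val_castSucc] at h
      rw [mk_step (t := u) a (Or.inl (by omega))]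
      exact ih (by simp; omega)
  -- below the crossing with the previous position, a strand runs straight to level `0`
  have below : ∀ p l : Fin (n + 1), l.1 < p.1 →
      Quot.mk (Arc (stabWord n) a) (l, p) = Quot.mk _ (0, p) := by
    intro p l
    induction l using Fin.induction with
    | zero => exact fun _ => rfl
    | succ u ih =>
      intro h
      simp only [Fin.val_succ] at h
      rw [← mk_step (t := u) a (Or.inl (by omega))]
      exact ih (by simp; omega)
  induction p using Fin.induction with
  | zero =>
    intro l
    rcases Nat.eq_zero_or_pos l.1 with h | h
    · rw [show l = 0 from Fin.ext h]
    · exact above 0 l h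
  | succ v ih =>
    intro l
    rcases lt_trichotomy l.1 v.succ.1 with h | h | h
    · exact below _ _ h
    · rw [show l = v.succ from Fin.ext h]
      by_cases hv : a v = true
      · have h1 : Quot.mk (Arc (stabWord n) a) (v.succ, v.castSucc) =
            Quot.mk _ (v.succ, v.succ) := Quot.sound (Arc.turnAbove (w := stabWord n) v hv)
        have h2 : Quot.mk (Arc (stabWord n) a) (v.castSucc, v.castSucc) =
            Quot.mk _ (v.castSucc, v.succ) := Quot.sound (Arc.turnBelow (w := stabWord n) v hv)
        rw [← h1, ih, ← ih v.castSucc, h2]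
        exact below _ _ (by simp)
      · rw [← mk_step (t := v) a (Or.inr (by simpa using hv))]
        exact below _ _ (by simp)
    · exact above _ _ h

theorem mk_castSucc_eq_succ {u : Fin n} (hu : a u = true) :
    Quot.mk (Arc (stabWord n) a) (0, u.castSucc) = Quot.mk _ (0, u.succ) := by
  have h : Quot.mk (Arc (stabWord n) a) (u.castSucc, u.castSucc) =
    Quot.mk _ (u.castSucc, u.succ) := Quot.sound (Arc.turnBelow (w := stabWord n) u hu)
  rw [← mk_level a _ u.castSucc, h, mk_level]

theorem mk_eq_mk_iff {P Q : Point n n} :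
    Quot.mk (Arc (stabWord n) a) P = Quot.mk _ Q ↔ Joined a P.2 Q.2 := by
  constructor
  · intro h
    have h' := Quot.eqvGen_exact h
    clear h
    induction h' with
    | rel P Q h => exact joined_of_arc a h
    | refl P => exact Joined.refl a _
    | symm P Q h ih => exact ih.symm
    | trans P Q R h h' ih ih' => exact ih.trans ih'
  · have key : ∀ q p : Fin (n + 1), p.1 ≤ q.1 → Joined a p q →
        Quot.mk (Arc (stabWord n) a) (0, p) = Quot.mk _ (0, q) := by
      intro q
      induction q using Fin.induction with
      | zero =>
        intro p hp _
        rw [show p = 0 from Fin.ext (by simpa using hp)]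
      | succ u ih =>
        intro p hp hj
        by_cases hpu : p = u.succ
        · rw [hpu]
        · have hpu' : p.1 < u.1 + 1 := by
            have h1 : p.1 ≠ u.succ.1 := fun h => hpu (Fin.ext h)
            simp at h1 hp
            omega
          rw [← mk_castSucc_eq_succ a (hj u (by simp; omega))]
          refine ih p (by simp; omega) fun v hv => hj v ?_
          simp at hv ⊢
          omega
    intro h
    obtain ⟨l, p⟩ := P
    obtain ⟨m, q⟩ := Q
    rw [mk_level a p l, mk_level a q m]
    rcases le_total p.1 q.1 with hpq | hpq
    · exact key q p hpq h
    · exact (key p q hpq h.symm).symm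

theorem exists_mk_eq (C : Circle (stabWord n) a) :
    ∃ p, IsEnd a p ∧ Quot.mk (Arc (stabWord n) a) (0, p) = C := by
  induction C using Quot.inductionOn with
  | h P =>
    obtain ⟨q, hq, hj⟩ := exists_isEnd a P.2
    exact ⟨q, hq, (mk_eq_mk_iff a).2 hj.symm⟩

open scoped Classical in
/-- Circles correspond to their last positions. -/
theorem sum_circle {β : Type*} [AddCommMonoid β] (F : Circle (stabWord n) a → β) :
    ∑ C, F C = ∑ p, if IsEnd a p then F (Quot.mk _ (0, p)) else 0 := by
  rw [← Finset.sum_filter]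
  symm
  refine Finset.sum_bij (fun p _ => Quot.mk _ (0, p)) (fun _ _ => Finset.mem_univ _) ?_ ?_
    (fun _ _ => rfl)
  · intro p hp q hq h
    exact ((mk_eq_mk_iff a).1 h).eq_of_isEnd (Finset.mem_filter.1 hp).2 (Finset.mem_filter.1 hq).2
  · intro C _
    obtain ⟨p, hp, hC⟩ := exists_mk_eq a C
    exact ⟨p, Finset.mem_filter.2 ⟨Finset.mem_univ _, hp⟩, hC⟩

end circles

/-! ### Recursion over the positions -/

section recursion

variable {n : ℕ} (a : Fin (n + 1) → Bool)

theorem isEnd_zero : IsEnd a 0 ↔ a 0 = false := by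
  constructor
  · intro h; exact h 0 rfl
  · intro h u hu
    rw [show u = 0 from Fin.ext (by simpa using hu), h]

theorem isEnd_succ (p : Fin (n + 1)) : IsEnd a p.succ ↔ IsEnd (fun i => a i.succ) p := by
  constructor
  · intro h u hu
    exact h u.succ (by simp [hu])
  · intro h u
    induction u using Fin.cases with
    | zero => intro hu; simp at hu
    | succ u => intro hu; exact h u (by simpa using hu)

theorem joined_succ_succ (p q : Fin (n + 1)) :
    Joined a p.succ q.succ ↔ Joined (fun i => a i.succ) p q := by
  constructor
  · intro h u hu
    exact h u.succ (by simp; omega)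
  · intro h u
    induction u using Fin.cases with
    | zero => intro hu; simp at hu
    | succ u => intro hu; exact h u (by simp at hu; omega)

theorem joined_zero_succ (q : Fin (n + 1)) :
    Joined a 0 q.succ ↔ a 0 = true ∧ Joined (fun i => a i.succ) 0 q := by
  constructor
  · intro h
    exact ⟨h 0 (by simp), fun u hu => h u.succ (by simp at hu ⊢; omega)⟩
  · rintro ⟨h0, h⟩ u
    induction u using Fin.cases with
    | zero => intro _; exact h0
    | succ u => intro hu; exact h u (by simp at hu ⊢; omega)

theorem eq_iff_tail_eq {a a' : Fin (n + 1) → Bool} :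
    a = a' ↔ a 0 = a' 0 ∧ (fun i : Fin n => a i.succ) = fun i => a' i.succ := by
  rw [funext_iff, Fin.forall_fin_succ, funext_iff]

end recursion

/-- The parity of the number of positions up to `p` on the circle through the position `p`, where
the first circle contains further strands, whose number has parity `π`. -/
def strandParity : (n : ℕ) → (Fin n → Bool) → Bool → Fin (n + 1) → Bool
  | 0, _, π, _ => !π
  | n + 1, a, π, p => Fin.cases (!π)
      (fun p' => strandParity n (fun i => a i.succ) (if a 0 then !π else false) p') p

open scoped Classical in
theorem strandParity_iff (n : ℕ) : ∀ (a : Fin n → Bool) (π : Bool) (p : Fin (n + 1)),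
    strandParity n a π p = true ↔ Odd ((∑ q : Fin (n + 1), if q.1 ≤ p.1 ∧ Joined a q p then 1 else 0)
      + if π = true ∧ Joined a 0 p then 1 else 0) := by
  induction n with
  | zero =>
    intro a π p
    have hp : p = 0 := Fin.fin_one_eq_zero p
    subst hp
    have h : (∑ q : Fin (0 + 1), if q.1 ≤ (0 : Fin (0 + 1)).1 ∧ Joined a q 0 then 1 else 0) = 1 := by
      rw [Fin.sum_univ_one]
      exact if_pos ⟨le_rfl, Joined.refl a 0⟩
    rw [h]
    cases π <;> simp [strandParity, Joined.refl]
  | succ n ih =>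
    intro a π p
    induction p using Fin.cases with
    | zero =>
      have h : (∑ q : Fin (n + 1 + 1), if q.1 ≤ (0 : Fin (n + 1 + 1)).1 ∧ Joined a q 0
          then 1 else 0) = 1 := by
        rw [Fin.sum_univ_succ, if_pos ⟨le_rfl, Joined.refl a 0⟩]
        simp
      rw [h]
      cases π <;> simp [strandParity, Joined.refl]
    | succ p =>
      simp only [strandParity, Fin.cases_succ, ih, Fin.sum_univ_succ (n := n + 1),
        joined_succ_succ, joined_zero_succ, Fin.val_succ, add_le_add_iff_right, Fin.val_zero,
        zero_le, true_and]
      by_cases h0 : a 0 = true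
      · by_cases hj : Joined (fun i => a i.succ) 0 p
        · cases π <;> simp only [h0, hj, if_true, Bool.not_true, Bool.not_false,
            and_self, Bool.false_eq_true, if_false, false_and, add_zero]
          · rw [add_comm]
          · rw [add_comm 1, add_assoc, Nat.odd_add]
            simp
        · simp [hj]
      · simp [h0]

theorem isNontrivial_iff {n : ℕ} (a : Vertex n) {p : Fin (n + 1)} (hp : IsEnd a p) :
    IsNontrivial (stabWord n) a (Quot.mk _ (0, p)) ↔ strandParity n a false p = true := by
  classical
  rw [strandParity_iff, IsNontrivial]
  have h : (hits (stabWord n) a (Quot.mk _ (0, p))).ncard =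
      ∑ q : Fin (n + 1), if q.1 ≤ p.1 ∧ Joined a q p then 1 else 0 := by
    rw [Set.ncard_eq_toFinset_card', ← Finset.card_filter]
    congr 1
    ext q
    rw [Set.mem_toFinset, Finset.mem_filter, and_iff_right (Finset.mem_univ q)]
    change Quot.mk _ (0, q) = Quot.mk _ (0, p) ↔ _
    rw [mk_eq_mk_iff]
    refine ⟨fun h => ⟨?_, h⟩, fun h => h.2⟩
    by_contra hlt
    have := h ⟨p.1, by omega⟩ (by simp; omega)
    rw [hp _ rfl] at this
    simp at this
  rw [h]
  simp

/-- The nontrivial circles inside a given one are those with a smaller last position. -/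
theorem inside_iff {n : ℕ} (a : Vertex n) {p q : Fin (n + 1)} (hp : IsEnd a p) (hq : IsEnd a q) :
    (∃ r ∈ hits (stabWord n) a (Quot.mk _ (0, p)), ∀ t ∈ hits (stabWord n) a (Quot.mk _ (0, q)),
      r < t) ↔ p < q := by
  simp only [hits, Set.mem_ofPred_eq, mk_eq_mk_iff]
  constructor
  · rintro ⟨r, hr, h⟩
    have h1 := h q (Joined.refl a q)
    by_contra hpq
    rcases (not_lt.1 hpq).lt_or_eq with hlt | heq
    · have := hr ⟨q.1, by omega⟩ (Or.inl ⟨h1.le, hlt⟩)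
      rw [hq _ rfl] at this
      simp at this
    · subst heq
      exact lt_irrefl _ (h r hr)
  · intro hpq
    refine ⟨p, Joined.refl a p, fun t ht => ?_⟩
    by_contra hlt
    have := ht ⟨p.1, by omega⟩ (Or.inl ⟨not_lt.1 hlt, hpq⟩)
    rw [hp _ rfl] at this
    simp at this

open scoped Classical in
theorem numInside_eq {n : ℕ} (a : Vertex n) {q : Fin (n + 1)} (hq : IsEnd a q) :
    numInside (stabWord n) a (Quot.mk _ (0, q)) =
      ∑ p, if IsEnd a p ∧ p < q ∧ strandParity n a false p = true then 1 else 0 := by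
  rw [numInside, Set.ncard_eq_toFinset_card', Finset.card_eq_sum_ones]
  simp only [Set.toFinset_ofPred]
  rw [Finset.sum_filter, sum_circle]
  refine Finset.sum_congr rfl fun p _ => ?_
  by_cases hp : IsEnd a p
  · rw [if_pos hp]
    refine if_congr ?_ rfl rfl
    rw [isNontrivial_iff a hp, inside_iff a hp hq]
    tauto
  · rw [if_neg hp, if_neg fun h => hp h.1]

/-! ### Words of enhanced states -/

/-- The word of a resolution and a labelling of the positions. -/
def wordOf : (n : ℕ) → (Fin n → Bool) → (Fin (n + 1) → Bool) → Word n
  | 0, _, g => g 0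
  | n + 1, a, g => (if a 0 = true then none else some (g 0),
      wordOf n (fun i => a i.succ) (fun i => g i.succ))

open scoped Classical in
theorem wordTau_wordOf (n : ℕ) : ∀ (a : Fin n → Bool) (g : Fin (n + 1) → Bool),
    wordTau n (wordOf n a g) = ∑ p, if IsEnd a p then signVal (g p) else 0 := by
  induction n with
  | zero =>
    intro a g
    have : IsEnd a 0 := fun u => u.elim0
    simp [wordOf, wordTau, this]
  | succ n ih =>
    intro a g
    simp only [Fin.sum_univ_succ (n := n + 1), isEnd_zero, isEnd_succ, ← ih]
    by_cases h : a 0 = true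
    · simp [wordOf, wordTau, h]
    · simp [wordOf, wordTau, h]

open scoped Classical in
theorem wordWeight_wordOf (n : ℕ) : ∀ (π : Bool) (a : Fin n → Bool) (g : Fin (n + 1) → Bool),
    wordWeight n π (wordOf n a g) =
      ∑ p, if IsEnd a p ∧ strandParity n a π p = true then signVal (g p) else 0 := by
  induction n with
  | zero =>
    intro π a g
    have : IsEnd a 0 := fun u => u.elim0
    cases π <;> simp [wordOf, wordWeight, labelWeight, strandParity, this]
  | succ n ih =>
    intro π a g
    simp only [Fin.sum_univ_succ (n := n + 1), isEnd_zero, isEnd_succ, strandParity,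
      Fin.cases_zero, Fin.cases_succ, ← ih]
    by_cases h : a 0 = true
    · simp [wordOf, wordWeight, h]
    · cases π <;> simp [wordOf, wordWeight, labelWeight, h]

theorem wordOnes_wordOf (n : ℕ) : ∀ (a : Fin n → Bool) (g : Fin (n + 1) → Bool),
    wordOnes n (wordOf n a g) = ∑ t, if a t = true then 1 else 0 := by
  induction n with
  | zero => intro a g; rfl
  | succ n ih =>
    intro a g
    rw [Fin.sum_univ_succ, ← ih _ (fun i => g i.succ)]
    by_cases h : a 0 = true
    · simp [wordOf, wordOnes, h, add_comm]
    · simp [wordOf, wordOnes, h]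

theorem wordSign_wordOf (n : ℕ) : ∀ (t : Fin n) (a : Fin n → Bool) (g : Fin (n + 1) → Bool),
    wordSign n t (wordOf n a g) = (-1) ^ (∑ u, if u < t ∧ a u = true then 1 else 0) := by
  induction n with
  | zero => intro t; exact t.elim0
  | succ n ih =>
    intro t a g
    induction t using Fin.cases with
    | zero => simp [wordOf, wordSign]
    | succ t =>
      rw [Fin.sum_univ_succ]
      simp only [Fin.succ_lt_succ_iff, wordOf, wordSign, Fin.cases_succ, ih]
      by_cases h : a 0 = true
      · simp [h, pow_add]
      · simp [h]

open scoped Classical in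
theorem flipSign_wordOf (n : ℕ) : ∀ (π : Bool) (q : Fin (n + 1)) (a : Fin n → Bool)
    (g : Fin (n + 1) → Bool), flipSign n π q (wordOf n a g) =
      (-1) ^ (∑ p, if IsEnd a p ∧ p < q ∧ strandParity n a π p = true then 1 else 0) := by
  induction n with
  | zero =>
    intro π q a g
    have : q = 0 := Fin.fin_one_eq_zero q
    subst this
    simp [flipSign]
  | succ n ih =>
    intro π q a g
    induction q using Fin.cases with
    | zero => simp [wordOf, flipSign]
    | succ q =>
      simp only [Fin.sum_univ_succ (n := n + 1), isEnd_zero, isEnd_succ, strandParity,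
        Fin.cases_zero, Fin.cases_succ, Fin.succ_lt_succ_iff, wordOf, flipSign, ih, nextParity]
      by_cases h : a 0 = true
      · simp [h]
      · cases π <;> simp [h, pow_add]

theorem wordOf_eq_iff (n : ℕ) : ∀ (a a' : Fin n → Bool) (g g' : Fin (n + 1) → Bool),
    wordOf n a g = wordOf n a' g' ↔ a = a' ∧ ∀ p, IsEnd a p → g p = g' p := by
  induction n with
  | zero =>
    intro a a' g g'
    have : IsEnd a 0 := fun u => u.elim0
    constructor
    · intro h
      refine ⟨Subsingleton.elim _ _, fun p _ => ?_⟩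
      rw [Fin.fin_one_eq_zero p]
      exact h
    · intro h
      exact h.2 0 this
  | succ n ih =>
    intro a a' g g'
    have h1 : wordOf (n + 1) a g = wordOf (n + 1) a' g' ↔
        ((if a 0 = true then none else some (g 0)) = if a' 0 = true then none else some (g' 0)) ∧
        wordOf n (fun i => a i.succ) (fun i => g i.succ) =
          wordOf n (fun i => a' i.succ) (fun i => g' i.succ) := Prod.ext_iff
    rw [h1, ih, Fin.forall_fin_succ (n := n + 1)]
    simp only [isEnd_zero, isEnd_succ]
    rw [eq_iff_tail_eq]
    cases h : a 0 <;> cases h' : a' 0 <;> simp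
    all_goals tauto

theorem sameTail_wordOf (n : ℕ) : ∀ (a a' : Fin n → Bool) (g g' : Fin (n + 1) → Bool),
    SameTail n (wordOf n a g) (wordOf n a' g') ↔
      a = a' ∧ ∀ p, IsEnd a p → ¬ Joined a 0 p → g p = g' p := by
  induction n with
  | zero =>
    intro a a' g g'
    refine iff_of_true trivial ⟨Subsingleton.elim _ _, fun p _ h => ?_⟩
    rw [Fin.fin_one_eq_zero p] at h
    exact absurd (Joined.refl a 0) h
  | succ n ih =>
    intro a a' g g'
    rw [eq_iff_tail_eq, Fin.forall_fin_succ]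
    simp only [isEnd_succ, joined_zero_succ, Joined.refl, wordOf]
    cases h : a 0 <;> cases h' : a' 0 <;>
      simp [SameTail, ih, wordOf_eq_iff]

theorem wordEdge_wordOf (n : ℕ) : ∀ (t : Fin n) (a a' : Fin n → Bool) (g g' : Fin (n + 1) → Bool),
    WordEdge n t (wordOf n a g) (wordOf n a' g') ↔ a t = false ∧ a' = Function.update a t true ∧
      ∀ p, IsEnd a p → p ≠ t.castSucc → ¬ Joined a t.succ p → g p = g' p := by
  induction n with
  | zero => intro t; exact t.elim0
  | succ n ih =>
    intro t a a' g g'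
    rw [Fin.forall_fin_succ]
    simp only [isEnd_zero, isEnd_succ, joined_succ_succ]
    induction t using Fin.cases with
    | zero =>
      have h2 : a' = Function.update a 0 true ↔
          a' 0 = true ∧ (fun i : Fin n => a i.succ) = fun i => a' i.succ := by
        rw [funext_iff, Fin.forall_fin_succ, funext_iff]
        simp only [Function.update_self, Function.update_of_ne (Fin.succ_ne_zero _)]
        exact and_congr_right fun _ => forall_congr' fun _ => eq_comm
      rw [h2, wordOf, wordOf, wordEdge_zero_iff, sameTail_wordOf]
      cases h : a 0 <;> cases h' : a' 0 <;> simp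
    | succ t =>
      have h2 : a' = Function.update a t.succ true ↔
          a 0 = a' 0 ∧ (fun i : Fin n => a' i.succ) = Function.update (fun i => a i.succ) t true := by
        rw [funext_iff, Fin.forall_fin_succ, funext_iff]
        simp [Function.update_apply, eq_comm]
      have h3 : a 0 = false → ¬ Joined a t.succ.succ 0 := by
        intro h h'
        have := ((joined_zero_succ a _).1 h'.symm).1
        rw [h] at this
        simp at this
      have h5 : ∀ p : Fin (n + 1), p.succ ≠ t.succ.castSucc ↔ p ≠ t.castSucc := by
        intro p
        rw [Fin.castSucc_succ, Ne, Fin.succ_inj]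
      simp only [h2, h5, wordOf]
      rw [wordEdge_succ_iff, ih]
      cases h : a 0 <;> cases h' : a' 0 <;> simp [h3, h, (Fin.succ_ne_zero _).symm]
      tauto

theorem wordFlip_wordOf (s : Bool) (n : ℕ) : ∀ (π : Bool) (q : Fin (n + 1)) (a a' : Fin n → Bool)
    (g g' : Fin (n + 1) → Bool), WordFlip s n π q (wordOf n a g) (wordOf n a' g') ↔
      a = a' ∧ IsEnd a q ∧ strandParity n a π q = true ∧ g q = s ∧ g' q = (!s) ∧
        ∀ p, IsEnd a p → p ≠ q → g p = g' p := by
  induction n with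
  | zero =>
    intro π q a a' g g'
    have h1 : a = a' := Subsingleton.elim _ _
    have h2 : q = 0 := Fin.fin_one_eq_zero q
    have h3 : IsEnd a 0 := fun u => u.elim0
    have h4 : ∀ p : Fin 1, p = 0 := Fin.fin_one_eq_zero
    subst h2
    simp only [WordFlip, wordOf, h1, h1 ▸ h3, strandParity, true_and]
    refine ⟨fun h => ⟨by simp [h.1], h.2.1, h.2.2, fun p _ hp => absurd (h4 p) hp⟩,
      fun h => ⟨by simpa using h.1, h.2.1, h.2.2.1⟩⟩
  | succ n ih =>
    intro π q a a' g g'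
    rw [Fin.forall_fin_succ, eq_iff_tail_eq]
    induction q using Fin.cases with
    | zero =>
      simp only [isEnd_zero, isEnd_succ, strandParity, Fin.cases_zero, wordOf]
      rw [wordFlip_zero_iff, wordOf_eq_iff]
      cases h : a 0 <;> cases h' : a' 0 <;> simp [Fin.succ_ne_zero]
      tauto
    | succ q =>
      simp only [isEnd_zero, isEnd_succ, strandParity, Fin.cases_succ, wordOf]
      rw [wordFlip_succ_iff, ih]
      have h5 : (0 : Fin (n + 2)) ≠ q.succ := (Fin.succ_ne_zero q).symm
      cases h : a 0 <;> cases h' : a' 0 <;> simp [h5, nextParity]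
      tauto

/-! ### The complex of the closure of `σ₁ ⋯ σₙ` as a complex of words -/

section bridge

variable {n : ℕ}

/-- The label of the circle through the position `p`. -/
def labelAt (x : State (stabWord n)) (p : Fin (n + 1)) : Bool := x.2 (Quot.mk _ (0, p))

/-- The word of an enhanced state. -/
def toWord (x : State (stabWord n)) : Word n := wordOf n x.1 (labelAt x)

theorem tau_eq (x : State (stabWord n)) : tau (stabWord n) x = wordTau n (toWord x) := by
  rw [toWord, wordTau_wordOf, tau, sum_circle]
  rfl

theorem kDeg_eq (x : State (stabWord n)) :
    kDeg (stabWord n) x = wordWeight n false (toWord x) := by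
  classical
  rw [toWord, wordWeight_wordOf, kDeg, sum_circle]
  refine Finset.sum_congr rfl fun p _ => ?_
  by_cases hp : IsEnd x.1 p
  · rw [if_pos hp]
    exact if_congr (by rw [isNontrivial_iff x.1 hp, and_iff_right hp]) rfl rfl
  · rw [if_neg hp, if_neg fun h => hp h.1]

theorem numOnes_eq (x : State (stabWord n)) :
    numOnes (stabWord n) x = wordOnes n (toWord x) := by
  rw [toWord, wordOnes_wordOf, numOnes, Set.ncard_eq_toFinset_card', Finset.card_eq_sum_ones,
    ← Finset.sum_filter]
  congr 1
  ext t
  rw [Set.mem_toFinset, Finset.mem_filter, and_iff_right (Finset.mem_univ t)]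
  rfl

theorem numNeg_stabWord (n : ℕ) : numNeg (stabWord n) = 0 := by
  simp [numNeg, stabWord]

theorem numPos_stabWord (n : ℕ) : numPos (stabWord n) = n := by
  simp [numPos, stabWord, Set.ncard_univ]

theorem iDeg_eq (x : State (stabWord n)) : iDeg (stabWord n) x = wordOnes n (toWord x) := by
  rw [iDeg, numOnes_eq, numNeg_stabWord]
  simp

theorem jDeg'_eq (x : State (stabWord n)) : jDeg' (stabWord n) x =
    wordTau n (toWord x) + wordOnes n (toWord x) - wordWeight n false (toWord x) + n := by
  rw [jDeg', jDeg, tau_eq, numOnes_eq, numNeg_stabWord, numPos_stabWord, kDeg_eq]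
  push_cast
  ring

theorem edgeSign_eq (t : Fin n) (x : State (stabWord n)) :
    edgeSign t x.1 = wordSign n t (toWord x) := by
  rw [toWord, wordSign_wordOf, edgeSign, Set.ncard_eq_toFinset_card', Finset.card_eq_sum_ones,
    ← Finset.sum_filter]
  congr 2
  ext u
  rw [Set.mem_toFinset, Finset.mem_filter, and_iff_right (Finset.mem_univ u)]
  rfl

theorem label_mk (x : State (stabWord n)) (P : Point n n) :
    x.2 (Quot.mk _ P) = labelAt x P.2 := by
  rw [labelAt, (mk_eq_mk_iff x.1 (P := P) (Q := (0, P.2))).2 (Joined.refl _ _)]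

theorem labelAt_eq (x : State (stabWord n)) {p q : Fin (n + 1)} (h : Joined x.1 p q) :
    labelAt x p = labelAt x q := by
  rw [labelAt, (mk_eq_mk_iff x.1 (P := (0, p)) (Q := (0, q))).2 h, labelAt]

/-- All edges of the cube are merges: the circles on the two sides of a `0`-resolved crossing are
different. -/
theorem isEdge_iff (t : Fin n) (x y : State (stabWord n)) :
    IsEdge (stabWord n) t x y ↔ WordEdge n t (toWord x) (toWord y) := by
  rw [toWord, toWord, wordEdge_wordOf, IsEdge]
  refine and_congr_right fun ht => and_congr_right fun hy => ?_
  have hend : IsEnd x.1 t.castSucc := fun u hu => by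
    rw [show u = t from Fin.ext (by simpa using hu), ht]
  have hmono : ∀ p q, Joined x.1 p q → Joined y.1 p q := by
    intro p q h u hu
    rw [hy, Function.update_apply]
    split_ifs
    · rfl
    · exact h u hu
  have hcorner : ∀ P : Point n n,
      (∀ Q, IsCorner (stabWord n) t Q → Quot.mk (Arc (stabWord n) x.1) Q ≠ Quot.mk _ P) ↔
        ¬ Joined x.1 t.castSucc P.2 ∧ ¬ Joined x.1 t.succ P.2 := by
    intro P
    simp only [Ne, mk_eq_mk_iff]
    constructor
    · intro h
      exact ⟨h (t.castSucc, t.castSucc) ⟨Or.inl rfl, Or.inl rfl⟩,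
        h (t.castSucc, t.succ) ⟨Or.inl rfl, Or.inr rfl⟩⟩
    · rintro ⟨h1, h2⟩ ⟨l, q⟩ ⟨-, hq⟩
      rcases hq with hq | hq
      · have : q = t.castSucc := hq
        rw [this]; exact h1
      · have : q = t.succ := hq
        rw [this]; exact h2
  simp only [hcorner, label_mk]
  constructor
  · intro h p hp hpt hj
    exact (h (0, p) ⟨fun h' => hpt (h'.eq_of_isEnd hend hp).symm, hj⟩).symm
  · rintro h ⟨l, p⟩ ⟨h1, h2⟩
    obtain ⟨q, hq, hj⟩ := exists_isEnd x.1 p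
    change labelAt y p = labelAt x p
    rw [labelAt_eq y (hmono _ _ hj), labelAt_eq x hj]
    refine (h q hq ?_ fun h' => h2 (h'.trans hj.symm)).symm
    rintro rfl
    exact h1 hj.symm

theorem toWord_injective : Function.Injective (toWord (n := n)) := by
  rintro ⟨a, l⟩ ⟨a', l'⟩ h
  rw [toWord, toWord, wordOf_eq_iff] at h
  obtain ⟨h1, h2⟩ := h
  change a = a' at h1
  subst h1
  congr 1
  funext C
  obtain ⟨p, hp, rfl⟩ := exists_mk_eq a C
  exact h2 p hp

/-- The resolution of a word. -/
def wordVertex : (n : ℕ) → Word n → Fin n → Bool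
  | 0, _, t => t.elim0
  | n + 1, (o, x), t => Fin.cases o.isNone (wordVertex n x) t

/-- The labels of the last positions on the circles of a word; the other values are irrelevant. -/
def wordLabel : (n : ℕ) → Word n → Fin (n + 1) → Bool
  | 0, b, _ => b
  | n + 1, (o, x), p => Fin.cases (o.getD true) (wordLabel n x) p

theorem wordOf_wordVertex (n : ℕ) : ∀ W : Word n, wordOf n (wordVertex n W) (wordLabel n W) = W := by
  induction n with
  | zero => intro W; rfl
  | succ n ih =>
    rintro ⟨o, W⟩
    refine Prod.ext ?_ (ih W)
    rcases o with _ | b <;> rfl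

theorem toWord_surjective : Function.Surjective (toWord (n := n)) := by
  intro W
  choose e he hC using exists_mk_eq (wordVertex n W)
  refine ⟨⟨wordVertex n W, fun C => wordLabel n W (e C)⟩, ?_⟩
  refine Eq.trans ?_ (wordOf_wordVertex n W)
  rw [toWord, wordOf_eq_iff]
  refine ⟨rfl, fun p hp => ?_⟩
  change wordLabel n W (e (Quot.mk _ (0, p))) = _
  exact congrArg (wordLabel n W)
    (((mk_eq_mk_iff _).1 (hC (Quot.mk _ (0, p)))).eq_of_isEnd (he _) hp)

/-- Enhanced states correspond to words. -/
def wordEquiv (n : ℕ) : State (stabWord n) ≃ Word n :=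
  Equiv.ofBijective toWord ⟨toWord_injective, toWord_surjective⟩

/-- The chain space in terms of words. -/
def chainEquiv (n : ℕ) : Chain (stabWord n) ≃ₗ[ℂ] (Word n → ℂ) :=
  LinearEquiv.funCongrLeft ℂ ℂ (wordEquiv n).symm

theorem chainEquiv_toWord (z : Chain (stabWord n)) (x : State (stabWord n)) :
    chainEquiv n z (toWord x) = z x :=
  congrArg z ((wordEquiv n).symm_apply_apply x)

theorem chainEquiv_eq_iff (z : Chain (stabWord n)) (W : Word n → ℂ) :
    chainEquiv n z = W ↔ ∀ x, z x = W (toWord x) := by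
  constructor
  · rintro rfl x
    rw [chainEquiv_toWord]
  · intro h
    funext w
    obtain ⟨x, rfl⟩ := toWord_surjective w
    rw [chainEquiv_toWord, h]

theorem chainEquiv_cubeMap (δτ δk : ℤ) (z : Chain (stabWord n)) :
    chainEquiv n (cubeMap (stabWord n) δτ δk z) =
      wordDiff (mergeCoeffs δτ δk) n false (chainEquiv n z) := by
  classical
  rw [chainEquiv_eq_iff]
  intro y
  rw [wordDiff_apply, ← (wordEquiv n).sum_comp]
  simp only [cubeMap, Matrix.mulVecLin_apply, Matrix.mulVec, dotProduct, Matrix.of_apply]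
  refine Finset.sum_congr rfl fun x _ => ?_
  change _ = _ * chainEquiv n z (toWord x)
  rw [chainEquiv_toWord]
  congr 1
  refine Finset.sum_congr rfl fun t _ => ?_
  rw [edgeSign_eq]
  refine if_congr ?_ rfl rfl
  rw [isEdge_iff, tau_eq, tau_eq, kDeg_eq, kDeg_eq]
  rfl

open scoped Classical in
theorem eq_flip_iff {s : Bool} {x y : State (stabWord n)} {q : Fin (n + 1)}
    (hq : IsEnd x.1 q) :
    (IsNontrivial (stabWord n) x.1 (Quot.mk _ (0, q)) ∧ x.2 (Quot.mk _ (0, q)) = s ∧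
      y = ⟨x.1, Function.update x.2 (Quot.mk _ (0, q)) (!s)⟩) ↔
      WordFlip s n false q (toWord x) (toWord y) := by
  rw [isNontrivial_iff x.1 hq, ← toWord_injective.eq_iff]
  simp only [toWord]
  rw [wordFlip_wordOf, eq_comm (a := wordOf n y.1 _), wordOf_eq_iff]
  have hl : ∀ p, labelAt (n := n) ⟨x.1, Function.update x.2 (Quot.mk _ (0, q)) (!s)⟩ p =
      if Joined x.1 p q then !s else labelAt x p := by
    intro p
    by_cases h : Joined x.1 p q
    · rw [if_pos h, labelAt]
      change Function.update x.2 _ _ (Quot.mk _ (0, p)) = _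
      rw [(mk_eq_mk_iff x.1 (P := (0, p)) (Q := (0, q))).2 h, Function.update_self]
    · rw [if_neg h, labelAt]
      exact Function.update_of_ne (fun h' => h ((mk_eq_mk_iff x.1).1 h')) _ _
  simp only [hl]
  constructor
  · rintro ⟨h1, h2, h3, h4⟩
    refine ⟨h3, hq, h1, h2, ?_, fun p hp hpq => ?_⟩
    · rw [← h4 q hq, if_pos (Joined.refl _ _)]
    · rw [← h4 p hp, if_neg fun h => hpq (h.eq_of_isEnd hp hq)]
  · rintro ⟨h1, h2, h3, h4, h5, h6⟩
    refine ⟨h3, h4, h1, fun p hp => ?_⟩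
    by_cases hpq : p = q
    · subst hpq
      rw [if_pos (Joined.refl _ _), h5]
    · rw [if_neg fun h => hpq (h.eq_of_isEnd hp hq), h6 p hp hpq]

theorem chainEquiv_flipMap (s : Bool) (z : Chain (stabWord n)) :
    chainEquiv n (flipMap (stabWord n) s z) = wordFlip s n false (chainEquiv n z) := by
  classical
  rw [chainEquiv_eq_iff]
  intro y
  rw [wordFlip_apply, ← (wordEquiv n).sum_comp]
  simp only [flipMap, Matrix.mulVecLin_apply, Matrix.mulVec, dotProduct, Matrix.of_apply]
  refine Finset.sum_congr rfl fun x _ => ?_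
  change _ = (∑ q, if WordFlip s n false q (toWord x) (toWord y) then
    flipSign n false q (toWord x) else 0) * chainEquiv n z (toWord x)
  rw [chainEquiv_toWord, sum_circle]
  congr 1
  refine Finset.sum_congr rfl fun q _ => ?_
  by_cases hq : IsEnd x.1 q
  · rw [if_pos hq, toWord, flipSign_wordOf, eps, numInside_eq x.1 hq, ← toWord]
    exact if_congr (eq_flip_iff hq) rfl rfl
  · rw [if_neg hq, if_neg]
    intro h
    rw [toWord, toWord, wordFlip_wordOf] at h
    exact hq h.2.1

theorem chainH_apply (z : Chain (stabWord n)) (x : State (stabWord n)) :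
    chainH (stabWord n) z x = (kDeg (stabWord n) x : ℂ) * z x := rfl

theorem chainEquiv_chainH (z : Chain (stabWord n)) : chainEquiv n (chainH (stabWord n) z) =
    fun W => (wordWeight n false W : ℂ) * chainEquiv n z W := by
  rw [chainEquiv_eq_iff]
  intro x
  rw [chainH_apply, kDeg_eq, chainEquiv_toWord]

end bridge

/-! ### Operators on homology -/

section homology

variable {s N : ℕ} {w : BraidWord s N}

theorem homClass_surjective (w : BraidWord s N) : Function.Surjective (homClass w) :=
  Submodule.mkQ_surjective _

theorem homClass_eq_zero {z : Cycles w} :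
    homClass w z = 0 ↔ z.1 ∈ LinearMap.range (partialZero w) :=
  Submodule.Quotient.mk_eq_zero _

theorem mem_classesOn {S : Set (State w)} {ξ : SKh w} :
    ξ ∈ classesOn w S ↔ ∃ z : Cycles w, z.1 ∈ chainsOn w S ∧ homClass w z = ξ :=
  Submodule.mem_map

/-- The operator on homology induced by a chain operator. -/
def inducedOp (T : Chain w →ₗ[ℂ] Chain w) (hk : ∀ z ∈ Cycles w, T z ∈ Cycles w)
    (hr : ∀ y, T (partialZero w y) ∈ LinearMap.range (partialZero w)) : End ℂ (SKh w) :=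
  Submodule.mapQ _ _ (T.restrict hk) (by
    rintro ⟨z, hz⟩ ⟨y, hy⟩
    change partialZero w y = z at hy
    subst hy
    exact hr y)

theorem induces_inducedOp {T : Chain w →ₗ[ℂ] Chain w} {hk : ∀ z ∈ Cycles w, T z ∈ Cycles w}
    {hr : ∀ y, T (partialZero w y) ∈ LinearMap.range (partialZero w)} :
    Induces w T (inducedOp T hk hr) := fun z => ⟨hk z z.2, rfl⟩

theorem inducedOp_mem {T : Chain w →ₗ[ℂ] Chain w} {hk : ∀ z ∈ Cycles w, T z ∈ Cycles w}
    {hr : ∀ y, T (partialZero w y) ∈ LinearMap.range (partialZero w)} {S S' : Set (State w)}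
    (h : ∀ z ∈ chainsOn w S, T z ∈ chainsOn w S') :
    ∀ ξ ∈ classesOn w S, inducedOp T hk hr ξ ∈ classesOn w S' := by
  intro ξ hξ
  obtain ⟨z, hz, rfl⟩ := mem_classesOn.1 hξ
  exact mem_classesOn.2 ⟨_, h z hz, rfl⟩

theorem exists_of_cubeMap_ne_zero {δτ δk : ℤ} {z : Chain w} {y : State w}
    (h : cubeMap w δτ δk z y ≠ 0) : ∃ x, z x ≠ 0 ∧ (∃ t, IsEdge w t x y) ∧
      tau w y = tau w x + δτ ∧ kDeg w y = kDeg w x + δk := by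
  classical
  simp only [cubeMap, Matrix.mulVecLin_apply, Matrix.mulVec, dotProduct, Matrix.of_apply] at h
  obtain ⟨x, -, hx⟩ := Finset.exists_ne_zero_of_sum_ne_zero h
  obtain ⟨t, -, ht⟩ := Finset.exists_ne_zero_of_sum_ne_zero (left_ne_zero_of_mul hx)
  by_cases hc : IsEdge w t x y ∧ tau w y = tau w x + δτ ∧ kDeg w y = kDeg w x + δk
  · exact ⟨x, right_ne_zero_of_mul hx, ⟨t, hc.1⟩, hc.2⟩
  · exact absurd (if_neg hc) ht

/-- A cube map that changes the weight by `δk` has weight `δk`. -/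
theorem chainH_cubeMap (δτ δk : ℤ) (z : Chain w) : chainH w (cubeMap w δτ δk z) =
    cubeMap w δτ δk (chainH w z) + (δk : ℂ) • cubeMap w δτ δk z := by
  classical
  funext y
  change (kDeg w y : ℂ) * cubeMap w δτ δk z y =
    cubeMap w δτ δk (chainH w z) y + (δk : ℂ) * cubeMap w δτ δk z y
  simp only [cubeMap, Matrix.mulVecLin_apply, Matrix.mulVec, dotProduct, Matrix.of_apply,
    Finset.mul_sum, ← Finset.sum_add_distrib]
  refine Finset.sum_congr rfl fun x _ => ?_
  change _ = _ * ((kDeg w x : ℂ) * z x) + _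
  simp only [Finset.sum_mul, Finset.mul_sum, ← Finset.sum_add_distrib]
  refine Finset.sum_congr rfl fun t _ => ?_
  split_ifs with h
  · rw [h.2.2]
    push_cast
    ring
  · simp

end homology

section stab

variable {n : ℕ}

theorem partialZero_partialZero (z : Chain (stabWord n)) :
    partialZero (stabWord n) (partialZero (stabWord n) z) = 0 := by
  apply (chainEquiv n).injective
  simp only [partialZero, chainEquiv_cubeMap, map_zero]
  exact mergeCoeffs_zero_assoc.wordDiff_wordDiff _ _ _

theorem partialMinus_partialZero (z : Chain (stabWord n)) :
    partialMinus (stabWord n) (partialZero (stabWord n) z) =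
      -partialZero (stabWord n) (partialMinus (stabWord n) z) := by
  rw [eq_neg_iff_add_eq_zero, add_comm]
  apply (chainEquiv n).injective
  simp only [partialZero, partialMinus, map_add, chainEquiv_cubeMap, map_zero]
  exact wordDiff_anticomm mergeCoeffs_zero_assoc mergeCoeffs_minus_assoc
    mergeCoeffs_zero_add_minus_assoc _ _ _

theorem partialLeePlus_partialZero (z : Chain (stabWord n)) :
    partialLeePlus (stabWord n) (partialZero (stabWord n) z) =
      -partialZero (stabWord n) (partialLeePlus (stabWord n) z) := by
  rw [eq_neg_iff_add_eq_zero, add_comm]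
  apply (chainEquiv n).injective
  simp only [partialZero, partialLeePlus, map_add, chainEquiv_cubeMap, map_zero]
  exact wordDiff_anticomm mergeCoeffs_zero_assoc mergeCoeffs_lee_assoc
    mergeCoeffs_zero_add_lee_assoc _ _ _

theorem flipMap_partialZero (b : Bool) (z : Chain (stabWord n)) :
    flipMap (stabWord n) b (partialZero (stabWord n) z) =
      partialZero (stabWord n) (flipMap (stabWord n) b z) := by
  rw [← sub_eq_zero]
  apply (chainEquiv n).injective
  simp only [partialZero, map_sub, chainEquiv_cubeMap, chainEquiv_flipMap, map_zero]
  exact flipDiff_eq_zero (defect_zero b) n false _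

theorem chainF_partialMinus (z : Chain (stabWord n)) :
    chainF (stabWord n) (partialMinus (stabWord n) z) =
      partialMinus (stabWord n) (chainF (stabWord n) z) := by
  rw [← sub_eq_zero]
  apply (chainEquiv n).injective
  simp only [partialMinus, chainF, map_sub, chainEquiv_cubeMap, chainEquiv_flipMap, map_zero]
  exact flipDiff_eq_zero defect_minus n false _

theorem chainE_partialLeePlus (z : Chain (stabWord n)) :
    chainE (stabWord n) (partialLeePlus (stabWord n) z) =
      partialLeePlus (stabWord n) (chainE (stabWord n) z) := by
  rw [← sub_eq_zero]
  apply (chainEquiv n).injective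
  simp only [partialLeePlus, chainE, map_sub, chainEquiv_cubeMap, chainEquiv_flipMap, map_zero]
  exact flipDiff_eq_zero defect_lee n false _

theorem chainE_partialMinus_add (z : Chain (stabWord n)) :
    (chainE (stabWord n) (partialMinus (stabWord n) z) -
      partialMinus (stabWord n) (chainE (stabWord n) z)) +
    (chainF (stabWord n) (partialLeePlus (stabWord n) z) -
      partialLeePlus (stabWord n) (chainF (stabWord n) z)) = 0 := by
  apply (chainEquiv n).injective
  simp only [partialMinus, partialLeePlus, chainE, chainF, map_sub, map_add, chainEquiv_cubeMap,
    chainEquiv_flipMap, map_zero]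
  exact flipDiff_add_flipDiff defect_minus_add_lee n false _

theorem chainE_chainF (z : Chain (stabWord n)) :
    chainE (stabWord n) (chainF (stabWord n) z) - chainF (stabWord n) (chainE (stabWord n) z) =
      chainH (stabWord n) z := by
  apply (chainEquiv n).injective
  simp only [chainE, chainF, map_sub, chainEquiv_flipMap, chainEquiv_chainH]
  exact wordFlip_commutator n false _

theorem WordFlip.gradings {b : Bool} {n : ℕ} : ∀ {p : Bool} {q : Fin (n + 1)} {x y : Word n},
    WordFlip b n p q x y → wordOnes n y = wordOnes n x ∧
      wordTau n y = wordTau n x - 2 * signVal b ∧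
      wordWeight n p y = wordWeight n p x - 2 * signVal b := by
  have hb : signVal (!b) = signVal b - 2 * signVal b := by cases b <;> simp [signVal]
  induction n with
  | zero =>
    rintro p q x y ⟨rfl, rfl, rfl⟩
    exact ⟨rfl, hb, hb⟩
  | succ n ih =>
    rintro p q ⟨o, x⟩ ⟨o', y⟩ h
    induction q using Fin.cases with
    | zero =>
      obtain ⟨rfl, rfl, rfl, rfl⟩ := h
      simp only [wordOnes, wordTau, wordWeight, labelWeight, Bool.not_false, if_true, hb, true_and]
      constructor <;> ring
    | succ q =>
      obtain ⟨rfl, h⟩ := h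
      obtain ⟨h1, h2, h3⟩ := ih h
      rcases o with _ | d
      · exact ⟨congrArg (· + 1) h1, h2, h3⟩
      · simp only [nextParity, reduceCtorEq, if_false] at h3
        simp only [wordOnes, wordTau, wordWeight, h1, h2, h3, true_and]
        constructor <;> ring

theorem exists_of_flipMap_ne_zero {b : Bool} {z : Chain (stabWord n)} {y : State (stabWord n)}
    (h : flipMap (stabWord n) b z y ≠ 0) : ∃ x, z x ≠ 0 ∧
      iDeg (stabWord n) y = iDeg (stabWord n) x ∧
      tau (stabWord n) y = tau (stabWord n) x - 2 * signVal b ∧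
      kDeg (stabWord n) y = kDeg (stabWord n) x - 2 * signVal b := by
  classical
  rw [← chainEquiv_toWord (flipMap _ b z) y, chainEquiv_flipMap, wordFlip_apply] at h
  obtain ⟨W, -, hW⟩ := Finset.exists_ne_zero_of_sum_ne_zero h
  obtain ⟨x, rfl⟩ := toWord_surjective W
  obtain ⟨q, -, hq⟩ := Finset.exists_ne_zero_of_sum_ne_zero (left_ne_zero_of_mul hW)
  have hz := right_ne_zero_of_mul hW
  rw [chainEquiv_toWord] at hz
  by_cases hc : WordFlip b n false q (toWord x) (toWord y)
  · obtain ⟨h1, h2, h3⟩ := hc.gradings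
    refine ⟨x, hz, ?_, ?_, ?_⟩
    · rw [iDeg_eq, iDeg_eq, h1]
    · rw [tau_eq, tau_eq, h2]
    · rw [kDeg_eq, kDeg_eq, h3]
  · exact absurd (if_neg hc) hq

theorem chainH_flipMap (b : Bool) (z : Chain (stabWord n)) :
    chainH (stabWord n) (flipMap (stabWord n) b z) =
      flipMap (stabWord n) b (chainH (stabWord n) z) -
        (2 * (signVal b : ℂ)) • flipMap (stabWord n) b z := by
  classical
  apply (chainEquiv n).injective
  simp only [map_sub, map_smul, chainEquiv_chainH, chainEquiv_flipMap]
  funext W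
  simp only [Pi.sub_apply, Pi.smul_apply, smul_eq_mul, wordFlip_apply, Finset.mul_sum,
    ← Finset.sum_sub_distrib, Finset.sum_mul]
  refine Finset.sum_congr rfl fun x _ => Finset.sum_congr rfl fun q _ => ?_
  split_ifs with h
  · rw [h.gradings.2.2]
    push_cast
    ring
  · simp

theorem chainH_partialZero (z : Chain (stabWord n)) :
    chainH (stabWord n) (partialZero (stabWord n) z) =
      partialZero (stabWord n) (chainH (stabWord n) z) := by
  rw [partialZero, chainH_cubeMap]
  simp

theorem IsEdge.iDeg_eq {t : Fin n} {x y : State (stabWord n)} (h : IsEdge (stabWord n) t x y) :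
    iDeg (stabWord n) y = iDeg (stabWord n) x + 1 := by
  rw [AnnularKhovanov.iDeg_eq, AnnularKhovanov.iDeg_eq, ((isEdge_iff t x y).1 h).wordOnes_eq]
  push_cast
  rfl

theorem jDeg'_eq_tau (x : State (stabWord n)) : jDeg' (stabWord n) x =
    tau (stabWord n) x + iDeg (stabWord n) x - kDeg (stabWord n) x + n := by
  rw [jDeg'_eq, tau_eq, iDeg_eq, kDeg_eq]

/-! ### The bidegrees that carry homology -/

/-- The states of homological degree `i` and `j'`-degree `j`. -/
def bidegree (n : ℕ) (i j : ℤ) : Set (State (stabWord n)) :=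
  {x | iDeg (stabWord n) x = i ∧ jDeg' (stabWord n) x = j}

/-- The two bidegrees in which the homology is concentrated. -/
def IsCritical (n : ℕ) (i j : ℤ) : Prop := (i = 0 ∧ j = n) ∨ (i = 1 ∧ j = n + 2)

theorem cubeMap_mem_chainsOn {δτ δk i j : ℤ} {z : Chain (stabWord n)}
    (hz : z ∈ chainsOn (stabWord n) (bidegree n i j)) :
    cubeMap (stabWord n) δτ δk z ∈
      chainsOn (stabWord n) (bidegree n (i + 1) (j + 1 + δτ - δk)) := by
  intro y hy
  by_contra h
  obtain ⟨x, hx, ⟨t, ht⟩, h1, h2⟩ := exists_of_cubeMap_ne_zero h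
  have hxS : x ∈ bidegree n i j := by
    by_contra h'
    exact hx (hz x h')
  obtain ⟨h3, h4⟩ := hxS
  refine hy ⟨by rw [ht.iDeg_eq, h3], ?_⟩
  rw [jDeg'_eq_tau] at h4 ⊢
  rw [h1, h2, ht.iDeg_eq]
  linarith

theorem isHomog_chainEquiv {i : ℕ} {j : ℤ} {z : Chain (stabWord n)}
    (hz : z ∈ chainsOn (stabWord n) (bidegree n i j)) :
    IsHomog n false i (j - n) (chainEquiv n z) := by
  intro W hW
  obtain ⟨x, rfl⟩ := toWord_surjective W
  rw [chainEquiv_toWord] at hW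
  have hxS : x ∈ bidegree n i j := by
    by_contra h'
    exact hW (hz x h')
  obtain ⟨h1, h2⟩ := hxS
  rw [iDeg_eq] at h1
  rw [jDeg'_eq] at h2
  exact ⟨by exact_mod_cast h1, by linarith⟩

theorem eq_zero_of_mem_chainsOn_neg {i j : ℤ} (hi : i < 0) {z : Chain (stabWord n)}
    (hz : z ∈ chainsOn (stabWord n) (bidegree n i j)) : z = 0 := by
  funext x
  refine hz x fun h => ?_
  have := h.1
  rw [iDeg_eq] at this
  omega

theorem eq_zero_of_mem_chainsOn_zero {j : ℤ} (hj : j ≠ n) {z : Chain (stabWord n)}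
    (hz : z ∈ chainsOn (stabWord n) (bidegree n 0 j)) : z = 0 := by
  have := (isHomog_chainEquiv (i := 0) hz).eq_zero_of_degree_zero (by
    intro h; exact hj (by linarith))
  exact (chainEquiv n).map_eq_zero_iff.1 this

theorem mem_range_of_not_isCritical {i j : ℤ} (hij : ¬ IsCritical n i j)
    {z : Chain (stabWord n)} (hz : z ∈ chainsOn (stabWord n) (bidegree n i j))
    (hc : z ∈ Cycles (stabWord n)) : z ∈ LinearMap.range (partialZero (stabWord n)) := by
  rcases lt_or_ge i 0 with hi | hi
  · rw [eq_zero_of_mem_chainsOn_neg hi hz]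
    exact zero_mem _
  obtain ⟨m, rfl⟩ := Int.eq_ofNat_of_zero_le hi
  rcases m with _ | m
  · rw [eq_zero_of_mem_chainsOn_zero (fun h => hij (Or.inl ⟨rfl, h⟩)) hz]
    exact zero_mem _
  have hdz : wordDiffZero n false (chainEquiv n z) = 0 := by
    rw [← chainEquiv_cubeMap, (chainEquiv n).map_eq_zero_iff]
    exact hc
  obtain ⟨y, hy⟩ := exists_wordDiffZero_eq n m (j - n) (fun h => hij (Or.inr
    ⟨by rw [h.1]; rfl, by linarith [h.2]⟩)) _ (isHomog_chainEquiv hz) hdz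
  refine ⟨(chainEquiv n).symm y, (chainEquiv n).injective ?_⟩
  rw [partialZero, chainEquiv_cubeMap, LinearEquiv.apply_symm_apply, hy]

open scoped Classical in
/-- The part of a chain on a set of states. -/
def restrictTo (S : Set (State (stabWord n))) : Chain (stabWord n) →ₗ[ℂ] Chain (stabWord n) where
  toFun z x := if x ∈ S then z x else 0
  map_add' z z' := by funext x; by_cases h : x ∈ S <;> simp [h]
  map_smul' c z := by funext x; by_cases h : x ∈ S <;> simp [h]

theorem restrictTo_of_mem {S : Set (State (stabWord n))} {x : State (stabWord n)} (hx : x ∈ S)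
    (z : Chain (stabWord n)) : restrictTo S z x = z x := if_pos hx

theorem restrictTo_of_notMem {S : Set (State (stabWord n))} {x : State (stabWord n)} (hx : x ∉ S)
    (z : Chain (stabWord n)) : restrictTo S z x = 0 := if_neg hx

theorem restrictTo_mem (S : Set (State (stabWord n))) (z : Chain (stabWord n)) :
    restrictTo S z ∈ chainsOn (stabWord n) S := fun _ hx => restrictTo_of_notMem hx z

theorem restrictTo_eq_self {S : Set (State (stabWord n))} {z : Chain (stabWord n)}
    (hz : z ∈ chainsOn (stabWord n) S) : restrictTo S z = z := by
  funext x
  by_cases hx : x ∈ S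
  · exact restrictTo_of_mem hx z
  · rw [restrictTo_of_notMem hx, hz x hx]

theorem partialZero_mem_chainsOn {i j : ℤ} {z : Chain (stabWord n)}
    (hz : z ∈ chainsOn (stabWord n) (bidegree n i j)) :
    partialZero (stabWord n) z ∈ chainsOn (stabWord n) (bidegree n (i + 1) j) := by
  have := cubeMap_mem_chainsOn (δτ := -1) (δk := 0) hz
  rwa [show j + 1 + -1 - 0 = j by ring] at this

theorem partialZero_restrictTo (i j : ℤ) (z : Chain (stabWord n)) :
    partialZero (stabWord n) (restrictTo (bidegree n i j) z) =
      restrictTo (bidegree n (i + 1) j) (partialZero (stabWord n) z) := by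
  funext y
  by_cases hy : y ∈ bidegree n (i + 1) j
  · rw [restrictTo_of_mem hy, ← sub_eq_zero, ← Pi.sub_apply, ← map_sub]
    by_contra h
    obtain ⟨x, hx, ⟨t, ht⟩, h1, h2⟩ := exists_of_cubeMap_ne_zero h
    apply hx
    have hxS : x ∈ bidegree n i j := by
      obtain ⟨h3, h4⟩ := hy
      rw [ht.iDeg_eq] at h3
      refine ⟨by linarith, ?_⟩
      rw [jDeg'_eq_tau, h1, h2, ht.iDeg_eq] at h4
      rw [jDeg'_eq_tau]
      linarith
    rw [Pi.sub_apply, restrictTo_of_mem hxS, sub_self]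
  · rw [restrictTo_of_notMem hy]
    exact partialZero_mem_chainsOn (restrictTo_mem _ _) y hy

theorem restrictTo_mem_cycles (i j : ℤ) {z : Chain (stabWord n)} (hz : z ∈ Cycles (stabWord n)) :
    restrictTo (bidegree n i j) z ∈ Cycles (stabWord n) := by
  rw [LinearMap.mem_ker, partialZero_restrictTo, LinearMap.mem_ker.1 hz, map_zero]

theorem sum_restrictTo (z : Chain (stabWord n)) : ∃ V : Finset (ℤ × ℤ),
    z = ∑ v ∈ V, restrictTo (bidegree n v.1 v.2) z := by
  classical
  refine ⟨Finset.univ.image fun x => (iDeg (stabWord n) x, jDeg' (stabWord n) x), ?_⟩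
  funext x
  rw [Finset.sum_apply, Finset.sum_eq_single (iDeg (stabWord n) x, jDeg' (stabWord n) x)]
  · exact (restrictTo_of_mem (show x ∈ bidegree n _ _ from ⟨rfl, rfl⟩) z).symm
  · intro v _ hv
    refine restrictTo_of_notMem (fun h => hv ?_) z
    exact Prod.ext h.1.symm h.2.symm
  · intro h
    exact absurd (Finset.mem_image_of_mem _ (Finset.mem_univ x)) h

/-- A cycle is homologous to the sum of its parts in the critical bidegrees. -/
theorem sub_restrictTo_mem_range {z : Chain (stabWord n)} (hz : z ∈ Cycles (stabWord n)) :
    z - restrictTo (bidegree n 0 n) z - restrictTo (bidegree n 1 (n + 2)) z ∈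
      LinearMap.range (partialZero (stabWord n)) := by
  set R := z - restrictTo (bidegree n 0 n) z - restrictTo (bidegree n 1 (n + 2)) z with hR
  have hRc : R ∈ Cycles (stabWord n) :=
    sub_mem (sub_mem hz (restrictTo_mem_cycles _ _ hz)) (restrictTo_mem_cycles _ _ hz)
  obtain ⟨V, hV⟩ := sum_restrictTo R
  rw [hV]
  refine Submodule.sum_mem _ fun v _ => ?_
  by_cases hv : IsCritical n v.1 v.2
  · have : restrictTo (bidegree n v.1 v.2) R = 0 := by
      funext x
      by_cases hx : x ∈ bidegree n v.1 v.2
      · rw [restrictTo_of_mem hx, hR, Pi.sub_apply, Pi.sub_apply]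
        obtain ⟨v1, v2⟩ := v
        rcases hv with ⟨rfl, rfl⟩ | ⟨rfl, rfl⟩
        · rw [restrictTo_of_mem hx, restrictTo_of_notMem (fun h => by
            have h1 := hx.1.symm.trans h.1
            simp at h1)]
          simp
        · rw [restrictTo_of_mem hx, restrictTo_of_notMem (S := bidegree n 0 n) (fun h => by
            have h1 := hx.1.symm.trans h.1
            simp at h1)]
          simp
      · rw [restrictTo_of_notMem hx]; rfl
    rw [this]
    exact zero_mem _
  · exact mem_range_of_not_isCritical hv (restrictTo_mem _ _) (restrictTo_mem_cycles _ _ hRc)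

/-- There are no nonzero boundaries in the critical bidegrees, since there are no chains in the
bidegrees `(-1, n)` and `(0, n + 2)`. -/
theorem eq_zero_of_mem_range {i j : ℤ} (hij : IsCritical n i j) {z : Chain (stabWord n)}
    (hz : z ∈ chainsOn (stabWord n) (bidegree n i j))
    (hr : z ∈ LinearMap.range (partialZero (stabWord n))) : z = 0 := by
  obtain ⟨y, rfl⟩ := hr
  have h1 := partialZero_restrictTo (i - 1) j y
  rw [sub_add_cancel, restrictTo_eq_self hz] at h1
  rw [← h1]
  have h2 := restrictTo_mem (bidegree n (i - 1) j) y
  rcases hij with ⟨rfl, rfl⟩ | ⟨rfl, rfl⟩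
  · rw [eq_zero_of_mem_chainsOn_neg (by norm_num) h2, map_zero]
  · rw [eq_zero_of_mem_chainsOn_zero (by simp) h2, map_zero]

theorem homClass_eq_of_sub_mem {z z' : Cycles (stabWord n)}
    (h : z.1 - z'.1 ∈ LinearMap.range (partialZero (stabWord n))) :
    homClass (stabWord n) z = homClass (stabWord n) z' := by
  rw [← sub_eq_zero, ← map_sub, homClass_eq_zero]
  exact h

theorem SKhDeg_eq_of_isCritical {i j : ℤ} (hij : IsCritical n i j) :
    SKhDeg (stabWord n) i = classesOn (stabWord n) (bidegree n i j) := by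
  ext ξ
  rw [SKhDeg, mem_classesOn, mem_classesOn]
  constructor
  · rintro ⟨z, hz, rfl⟩
    refine ⟨⟨_, restrictTo_mem_cycles i j z.2⟩, restrictTo_mem _ _,
      (homClass_eq_of_sub_mem ?_).symm⟩
    have h := sub_restrictTo_mem_range z.2
    have h0 : ∀ i' j', i ≠ i' → restrictTo (bidegree n i' j') z.1 = 0 := by
      intro i' j' hi
      funext x
      by_cases hx : x ∈ bidegree n i' j'
      · rw [restrictTo_of_mem hx]
        exact hz x fun h' => hi (h'.symm.trans hx.1)
      · exact restrictTo_of_notMem hx _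
    rcases hij with ⟨rfl, rfl⟩ | ⟨rfl, rfl⟩
    · rwa [h0 1 _ (by norm_num), sub_zero] at h
    · rwa [h0 0 _ (by norm_num), sub_zero] at h
  · rintro ⟨z, hz, rfl⟩
    exact ⟨z, fun x hx => hz x fun h => hx h.1, rfl⟩

theorem exists_homClass_add (ξ : SKh (stabWord n)) : ∃ ξ₀ ∈ SKhDeg (stabWord n) 0,
    ∃ ξ₁ ∈ SKhDeg (stabWord n) 1, ξ = ξ₀ + ξ₁ := by
  obtain ⟨z, rfl⟩ := homClass_surjective _ ξ
  refine ⟨homClass _ ⟨_, restrictTo_mem_cycles 0 n z.2⟩,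
    mem_classesOn.2 ⟨_, fun x hx => restrictTo_of_notMem (fun h => hx h.1) _, rfl⟩,
    homClass _ ⟨_, restrictTo_mem_cycles 1 (n + 2) z.2⟩,
    mem_classesOn.2 ⟨_, fun x hx => restrictTo_of_notMem (fun h => hx h.1) _, rfl⟩, ?_⟩
  rw [← map_add]
  refine homClass_eq_of_sub_mem ?_
  have := sub_restrictTo_mem_range z.2
  rwa [sub_sub] at this

theorem SKhDeg_eq_bot {i : ℤ} (h0 : i ≠ 0) (h1 : i ≠ 1) : SKhDeg (stabWord n) i = ⊥ := by
  rw [eq_bot_iff]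
  intro ξ hξ
  obtain ⟨z, hz, rfl⟩ := mem_classesOn.1 hξ
  rw [Submodule.mem_bot, homClass_eq_zero]
  have h := sub_restrictTo_mem_range z.2
  have hr : ∀ i' j', i ≠ i' → restrictTo (bidegree n i' j') z.1 = 0 := by
    intro i' j' hi
    funext x
    by_cases hx : x ∈ bidegree n i' j'
    · rw [restrictTo_of_mem hx]
      exact hz x fun h' => hi (h'.symm.trans hx.1)
    · exact restrictTo_of_notMem hx _
  rwa [hr 0 _ h0, hr 1 _ h1, sub_zero, sub_zero] at h

end stab

/-! ### The action of `sl₂(∧)` -/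

section action

variable {n : ℕ}

theorem isInternal_SKhDeg (n : ℕ) : DirectSum.IsInternal (SKhDeg (stabWord n)) := by
  have hdisj : Disjoint (SKhDeg (stabWord n) 0) (SKhDeg (stabWord n) 1) := by
    rw [Submodule.disjoint_def]
    intro ξ h0 h1
    rw [SKhDeg_eq_of_isCritical (Or.inl ⟨rfl, rfl⟩)] at h0
    rw [SKhDeg_eq_of_isCritical (Or.inr ⟨rfl, rfl⟩)] at h1
    obtain ⟨z, hz, rfl⟩ := mem_classesOn.1 h0
    obtain ⟨z', hz', hzz'⟩ := mem_classesOn.1 h1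
    rw [← sub_eq_zero, ← map_sub, homClass_eq_zero] at hzz'
    obtain ⟨y, hy⟩ := hzz'
    have h := partialZero_restrictTo 0 (n + 2) y
    have hz0 : restrictTo (bidegree n (0 + 1) (n + 2)) z.1 = 0 := by
      funext x
      by_cases hx : x ∈ bidegree n (0 + 1) (n + 2)
      · rw [restrictTo_of_mem hx]
        refine hz x fun h' => ?_
        have := h'.1.symm.trans hx.1
        norm_num at this
      · exact restrictTo_of_notMem hx _
    rw [hy, Submodule.coe_sub, map_sub, hz0, zero_add, restrictTo_eq_self hz', sub_zero,
      eq_zero_of_mem_chainsOn_zero (by simp) (restrictTo_mem _ y), map_zero] at h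
    have h' : z' = 0 := Subtype.ext h.symm
    rw [h', zero_sub] at hy
    rw [homClass_eq_zero]
    exact ⟨-y, by rw [map_neg, hy]; simp⟩
  rw [DirectSum.isInternal_submodule_iff_iSupIndep_and_iSup_eq_top]
  constructor
  · intro i
    by_cases h0 : i = 0
    · subst h0
      refine hdisj.mono_right (iSup₂_le fun j hj => ?_)
      by_cases h1 : j = 1
      · rw [h1]
      · rw [SKhDeg_eq_bot hj h1]; exact bot_le
    by_cases h1 : i = 1
    · subst h1
      refine hdisj.symm.mono_right (iSup₂_le fun j hj => ?_)
      by_cases h0 : j = 0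
      · rw [h0]
      · rw [SKhDeg_eq_bot h0 hj]; exact bot_le
    rw [SKhDeg_eq_bot h0 h1]
    exact disjoint_bot_left
  · rw [eq_top_iff]
    intro ξ _
    obtain ⟨ξ₀, h0, ξ₁, h1, rfl⟩ := exists_homClass_add ξ
    exact add_mem (Submodule.mem_iSup_of_mem 0 h0) (Submodule.mem_iSup_of_mem 1 h1)

/-- The operator on homology induced by a chain operator that commutes with the differential up to
a sign. -/
def skhOp (T : Chain (stabWord n) →ₗ[ℂ] Chain (stabWord n)) (ε : ℤˣ)
    (h : ∀ z, T (partialZero (stabWord n) z) = ε • partialZero (stabWord n) (T z)) :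
    End ℂ (SKh (stabWord n)) :=
  inducedOp T
    (fun z hz => by
      have := h z
      rw [LinearMap.mem_ker.1 hz, map_zero] at this
      exact (smul_eq_zero_iff_eq ε).1 this.symm)
    (fun y => by
      rw [h y]
      rcases Int.units_eq_one_or ε with rfl | rfl
      · exact ⟨T y, by simp⟩
      · exact ⟨-T y, by simp⟩)

theorem skhOp_mem {T : Chain (stabWord n) →ₗ[ℂ] Chain (stabWord n)} {ε : ℤˣ}
    {h : ∀ z, T (partialZero (stabWord n) z) = ε • partialZero (stabWord n) (T z)}
    {S S' : Set (State (stabWord n))}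
    (hS : ∀ z ∈ chainsOn (stabWord n) S, T z ∈ chainsOn (stabWord n) S') :
    ∀ ξ ∈ classesOn (stabWord n) S, skhOp T ε h ξ ∈ classesOn (stabWord n) S' := by
  unfold skhOp
  exact inducedOp_mem hS

theorem induces_skhOp {T : Chain (stabWord n) →ₗ[ℂ] Chain (stabWord n)} {ε : ℤˣ}
    {h : ∀ z, T (partialZero (stabWord n) z) = ε • partialZero (stabWord n) (T z)} :
    Induces (stabWord n) T (skhOp T ε h) := by
  unfold skhOp
  exact induces_inducedOp

/-- The operator `e` on homology. -/
def skhE (n : ℕ) : End ℂ (SKh (stabWord n)) :=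
  skhOp (chainE _) 1 fun z => by rw [one_smul]; exact flipMap_partialZero _ z

/-- The operator `f` on homology. -/
def skhF (n : ℕ) : End ℂ (SKh (stabWord n)) :=
  skhOp (chainF _) 1 fun z => by rw [one_smul]; exact flipMap_partialZero _ z

/-- The operator `h` on homology. -/
def skhH (n : ℕ) : End ℂ (SKh (stabWord n)) :=
  skhOp (chainH _) 1 fun z => by rw [one_smul]; exact chainH_partialZero z

/-- The operator `v₂` on homology. -/
def skhTwo (n : ℕ) : End ℂ (SKh (stabWord n)) :=
  skhOp (partialLeePlus _) (-1) fun z => by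
    rw [Units.neg_smul, one_smul]; exact partialLeePlus_partialZero z

/-- The operator `v₋₂` on homology. -/
def skhNegTwo (n : ℕ) : End ℂ (SKh (stabWord n)) :=
  skhOp (partialMinus _) (-1) fun z => by
    rw [Units.neg_smul, one_smul]; exact partialMinus_partialZero z

/-- Relations between induced operators can be checked on cycles. -/
theorem ext_homClass {S T : End ℂ (SKh (stabWord n))}
    (h : ∀ z, S (homClass _ z) = T (homClass _ z)) : S = T := by
  refine LinearMap.ext fun ξ => ?_
  obtain ⟨z, rfl⟩ := homClass_surjective _ ξ
  exact h z

theorem homClass_congr {z z' : Cycles (stabWord n)} (h : z.1 = z'.1) :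
    homClass (stabWord n) z = homClass (stabWord n) z' := congrArg _ (Subtype.ext h)

theorem lie_skhE_skhF : ⁅skhE n, skhF n⁆ = skhH n :=
  ext_homClass fun z => homClass_congr (chainE_chainF z.1)

theorem lie_skhE_skhTwo : ⁅skhE n, skhTwo n⁆ = 0 :=
  ext_homClass fun z => (homClass_congr (z' := 0)
    (sub_eq_zero.2 (chainE_partialLeePlus z.1))).trans (map_zero _)

theorem lie_skhF_skhNegTwo : ⁅skhF n, skhNegTwo n⁆ = 0 :=
  ext_homClass fun z => (homClass_congr (z' := 0)
    (sub_eq_zero.2 (chainF_partialMinus z.1))).trans (map_zero _)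

theorem lie_skhE_skhNegTwo_add : ⁅skhE n, skhNegTwo n⁆ + ⁅skhF n, skhTwo n⁆ = 0 :=
  ext_homClass fun z => (homClass_congr (z' := 0)
    (chainE_partialMinus_add z.1)).trans (map_zero _)

theorem lie_skhH_skhE : ⁅skhH n, skhE n⁆ = 2 • skhE n :=
  ext_homClass fun z => by
    refine (homClass_congr (z' := 2 • ⟨chainE _ z.1, _⟩) ?_).trans (map_nsmul _ _ _)
    change chainH _ (chainE _ z.1) - chainE _ (chainH _ z.1) = 2 • chainE _ z.1
    rw [chainE, chainH_flipMap, sub_sub_cancel_left, ← neg_smul, ← Nat.cast_smul_eq_nsmul ℂ]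
    congr 1
    simp [signVal]

theorem lie_skhH_skhF : ⁅skhH n, skhF n⁆ = -(2 • skhF n) :=
  ext_homClass fun z => by
    refine (homClass_congr (z' := -(2 • ⟨chainF _ z.1, _⟩)) ?_).trans
      ((map_neg _ _).trans (congrArg _ (map_nsmul _ _ _)))
    change chainH _ (chainF _ z.1) - chainF _ (chainH _ z.1) = -(2 • chainF _ z.1)
    rw [chainF, chainH_flipMap, sub_sub_cancel_left, ← Nat.cast_smul_eq_nsmul ℂ]
    congr 2
    simp [signVal]

theorem lie_skhH_skhTwo : ⁅skhH n, skhTwo n⁆ = 2 • skhTwo n :=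
  ext_homClass fun z => by
    refine (homClass_congr (z' := 2 • ⟨partialLeePlus _ z.1, _⟩) ?_).trans (map_nsmul _ _ _)
    change chainH _ (partialLeePlus _ z.1) - partialLeePlus _ (chainH _ z.1) =
      2 • partialLeePlus _ z.1
    rw [partialLeePlus, chainH_cubeMap, add_sub_cancel_left, ← Nat.cast_smul_eq_nsmul ℂ]
    congr 1

theorem lie_skhH_skhNegTwo : ⁅skhH n, skhNegTwo n⁆ = -(2 • skhNegTwo n) :=
  ext_homClass fun z => by
    refine (homClass_congr (z' := -(2 • ⟨partialMinus _ z.1, _⟩)) ?_).trans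
      ((map_neg _ _).trans (congrArg _ (map_nsmul _ _ _)))
    change chainH _ (partialMinus _ z.1) - partialMinus _ (chainH _ z.1) =
      -(2 • partialMinus _ z.1)
    rw [partialMinus, chainH_cubeMap, add_sub_cancel_left, ← Nat.cast_smul_eq_nsmul ℂ, ← neg_smul]
    congr 1
    push_cast
    ring

theorem flipMap_mem_SKhDeg {b : Bool} {i : ℤ} {z : Chain (stabWord n)}
    (hz : z ∈ chainsOn (stabWord n) {x | iDeg (stabWord n) x = i}) :
    flipMap (stabWord n) b z ∈ chainsOn (stabWord n) {x | iDeg (stabWord n) x = i} := by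
  intro y hy
  by_contra h
  obtain ⟨x, hx, h1, -⟩ := exists_of_flipMap_ne_zero h
  refine hx (hz x fun h' => hy ?_)
  exact h1.trans h'

theorem cubeMap_mem_SKhDeg {δτ δk i : ℤ} {z : Chain (stabWord n)}
    (hz : z ∈ chainsOn (stabWord n) {x | iDeg (stabWord n) x = i}) :
    cubeMap (stabWord n) δτ δk z ∈ chainsOn (stabWord n) {x | iDeg (stabWord n) x = i + 1} := by
  intro y hy
  by_contra h
  obtain ⟨x, hx, ⟨t, ht⟩, -⟩ := exists_of_cubeMap_ne_zero h
  refine hx (hz x fun h' => hy ?_)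
  exact ht.iDeg_eq.trans (congrArg (· + 1) h')

theorem skhE_mem (i : ℤ) : ∀ ξ ∈ SKhDeg (stabWord n) i, skhE n ξ ∈ SKhDeg (stabWord n) i :=
  skhOp_mem fun _ => flipMap_mem_SKhDeg

theorem skhF_mem (i : ℤ) : ∀ ξ ∈ SKhDeg (stabWord n) i, skhF n ξ ∈ SKhDeg (stabWord n) i :=
  skhOp_mem fun _ => flipMap_mem_SKhDeg

theorem skhH_mem (i : ℤ) : ∀ ξ ∈ SKhDeg (stabWord n) i, skhH n ξ ∈ SKhDeg (stabWord n) i :=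
  skhOp_mem fun z hz x hx => by rw [chainH_apply, hz x hx, mul_zero]

theorem skhTwo_mem (i : ℤ) :
    ∀ ξ ∈ SKhDeg (stabWord n) i, skhTwo n ξ ∈ SKhDeg (stabWord n) (i + 1) :=
  skhOp_mem fun _ => cubeMap_mem_SKhDeg

theorem skhNegTwo_mem (i : ℤ) :
    ∀ ξ ∈ SKhDeg (stabWord n) i, skhNegTwo n ξ ∈ SKhDeg (stabWord n) (i + 1) :=
  skhOp_mem fun _ => cubeMap_mem_SKhDeg

theorem lie_skhE_skhNegTwo_mem (i : ℤ) (ξ : SKh (stabWord n)) (hξ : ξ ∈ SKhDeg (stabWord n) i) :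
    ⁅skhE n, skhNegTwo n⁆ ξ ∈ SKhDeg (stabWord n) (i + 1) :=
  sub_mem (skhE_mem _ _ (skhNegTwo_mem _ _ hξ)) (skhNegTwo_mem _ _ (skhE_mem _ _ hξ))

/-- Products of operators of degree `1` vanish, since the homology lives in two adjacent
degrees. -/
theorem mul_eq_zero_of_degree_one {S T : End ℂ (SKh (stabWord n))}
    (hS : ∀ i, ∀ ξ ∈ SKhDeg (stabWord n) i, S ξ ∈ SKhDeg (stabWord n) (i + 1))
    (hT : ∀ i, ∀ ξ ∈ SKhDeg (stabWord n) i, T ξ ∈ SKhDeg (stabWord n) (i + 1)) : S * T = 0 := by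
  refine LinearMap.ext fun ξ => ?_
  obtain ⟨ξ₀, h0, ξ₁, h1, rfl⟩ := exists_homClass_add ξ
  have h2 := hS _ _ (hT _ _ h0)
  have h3 := hS _ _ (hT _ _ h1)
  rw [SKhDeg_eq_bot (by norm_num) (by norm_num), Submodule.mem_bot] at h2 h3
  simp only [Module.End.mul_apply, map_add, h2, h3, add_zero, LinearMap.zero_apply]

theorem anti_eq_zero {S T : End ℂ (SKh (stabWord n))}
    (hS : ∀ i, ∀ ξ ∈ SKhDeg (stabWord n) i, S ξ ∈ SKhDeg (stabWord n) (i + 1))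
    (hT : ∀ i, ∀ ξ ∈ SKhDeg (stabWord n) i, T ξ ∈ SKhDeg (stabWord n) (i + 1)) :
    S * T + T * S = 0 := by
  rw [mul_eq_zero_of_degree_one hS hT, mul_eq_zero_of_degree_one hT hS, add_zero]

theorem lie_lie_eq {R : Type*} [Ring R] (a b c : R) : ⁅a, ⁅b, c⁆⁆ = ⁅⁅a, b⁆, c⁆ + ⁅b, ⁅a, c⁆⁆ := by
  simp only [Ring.lie_def]
  noncomm_ring

theorem lie_neg_eq {R : Type*} [Ring R] (a b : R) : ⁅a, -b⁆ = -⁅a, b⁆ := by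
  simp only [Ring.lie_def]
  noncomm_ring

theorem neg_lie_eq {R : Type*} [Ring R] (a b : R) : ⁅-a, b⁆ = -⁅a, b⁆ := by
  simp only [Ring.lie_def]
  noncomm_ring

theorem lie_two_smul {R : Type*} [Ring R] (a b : R) : ⁅a, 2 • b⁆ = 2 • ⁅a, b⁆ := by
  simp only [Ring.lie_def]
  noncomm_ring

theorem two_smul_lie {R : Type*} [Ring R] (a b : R) : ⁅2 • a, b⁆ = 2 • ⁅a, b⁆ := by
  simp only [Ring.lie_def]
  noncomm_ring

/-- The action of `sl₂(∧)` on the homology. -/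
def annularRep (n : ℕ) : CurrentRep (SKh (stabWord n)) where
  e := skhE n
  f := skhF n
  h := skhH n
  v2 := skhTwo n
  v0 := ⁅skhE n, skhNegTwo n⁆
  vm2 := skhNegTwo n
  lie_e_f := lie_skhE_skhF
  lie_h_e := lie_skhH_skhE
  lie_h_f := lie_skhH_skhF
  lie_e_v2 := lie_skhE_skhTwo
  lie_e_v0 := by
    have h : ⁅skhE n, ⁅skhF n, skhTwo n⁆⁆ = 2 • skhTwo n := by
      rw [lie_lie_eq, lie_skhE_skhF, lie_skhE_skhTwo, lie_skhH_skhTwo]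
      simp [Ring.lie_def]
    rw [eq_neg_of_add_eq_zero_left lie_skhE_skhNegTwo_add, lie_neg_eq, h]
  lie_e_vm2 := rfl
  lie_f_v2 := eq_neg_of_add_eq_zero_right lie_skhE_skhNegTwo_add
  lie_f_v0 := by
    have h : ⁅skhF n, skhE n⁆ = -skhH n := by
      rw [← lie_skhE_skhF]
      simp only [Ring.lie_def, neg_sub]
    rw [lie_lie_eq, lie_skhF_skhNegTwo, h, neg_lie_eq, lie_skhH_skhNegTwo]
    simp [Ring.lie_def]
  lie_f_vm2 := lie_skhF_skhNegTwo
  lie_h_v2 := lie_skhH_skhTwo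
  lie_h_v0 := by
    rw [lie_lie_eq, lie_skhH_skhE, lie_skhH_skhNegTwo, lie_neg_eq, two_smul_lie, lie_two_smul,
      add_neg_cancel]
  lie_h_vm2 := lie_skhH_skhNegTwo
  anti_v2_v2 := anti_eq_zero skhTwo_mem skhTwo_mem
  anti_v0_v0 := anti_eq_zero lie_skhE_skhNegTwo_mem lie_skhE_skhNegTwo_mem
  anti_vm2_vm2 := anti_eq_zero skhNegTwo_mem skhNegTwo_mem
  anti_v2_v0 := anti_eq_zero skhTwo_mem lie_skhE_skhNegTwo_mem
  anti_v2_vm2 := anti_eq_zero skhTwo_mem skhNegTwo_mem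
  anti_v0_vm2 := anti_eq_zero lie_skhE_skhNegTwo_mem skhNegTwo_mem
  deg := SKhDeg (stabWord n)
  isInternal := isInternal_SKhDeg n
  e_mem := skhE_mem
  f_mem := skhF_mem
  h_mem := skhH_mem
  v2_mem := skhTwo_mem
  v0_mem := lie_skhE_skhNegTwo_mem
  vm2_mem := skhNegTwo_mem

theorem isAnnularAction_annularRep (n : ℕ) : IsAnnularAction (stabWord n) (annularRep n) where
  deg_eq := rfl
  e_induced := by
    change Induces _ _ (skhE n)
    unfold skhE
    exact induces_skhOp
  f_induced := by
    change Induces _ _ (skhF n)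
    unfold skhF
    exact induces_skhOp
  h_induced := by
    change Induces _ _ (skhH n)
    unfold skhH
    exact induces_skhOp
  v2_induced := by
    change Induces _ _ (skhTwo n)
    unfold skhTwo
    exact induces_skhOp
  vm2_induced := by
    change Induces _ _ (skhNegTwo n)
    unfold skhNegTwo
    exact induces_skhOp

end action

/-! ### Highest weight vectors and dimensions -/

section dimension

variable {n : ℕ}

theorem finrank_classesOn_le {s N : ℕ} {w : BraidWord s N} (S : Set (State w)) (m : ℕ)
    (x : Fin m → State w) (h : ∀ z ∈ Cycles w, z ∈ chainsOn w S → (∀ a, z (x a) = 0) → z = 0) :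
    finrank ℂ (classesOn w S) ≤ m := by
  refine (Submodule.finrank_map_le _ _).trans ?_
  let ev : (chainsOn w S).submoduleOf (Cycles w) →ₗ[ℂ] (Fin m → ℂ) :=
    { toFun := fun z a => z.1.1 (x a)
      map_add' := fun _ _ => rfl
      map_smul' := fun _ _ => rfl }
  have hinj : Function.Injective ev := by
    intro z z' hz
    refine Subtype.ext (Subtype.ext (sub_eq_zero.1
      (h (z.1.1 - z'.1.1) (sub_mem z.1.2 z'.1.2) (sub_mem z.2 z'.2) fun a => ?_)))
    exact sub_eq_zero.2 (congrFun hz a)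
  simpa using LinearMap.finrank_le_finrank_of_injective hinj

theorem finrank_SKhDeg_zero_le (n : ℕ) : finrank ℂ (SKhDeg (stabWord n) 0) ≤ n + 2 := by
  rw [SKhDeg_eq_of_isCritical (Or.inl ⟨rfl, rfl⟩)]
  refine finrank_classesOn_le _ _ (fun a => (wordEquiv n).symm (sortedWord n a)) ?_
  intro z hz hzS h
  rw [← (chainEquiv n).map_eq_zero_iff]
  refine eq_zero_of_sortedWord n _ _ (isHomog_chainEquiv (i := 0) hzS) ?_ fun a ha => h ⟨a, ha⟩
  rw [← chainEquiv_cubeMap, (chainEquiv n).map_eq_zero_iff]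
  exact hz

theorem finrank_SKhDeg_one_le (n : ℕ) : finrank ℂ (SKhDeg (stabWord n) 1) ≤ n := by
  rw [SKhDeg_eq_of_isCritical (Or.inr ⟨rfl, rfl⟩)]
  rcases n with _ | n
  · refine finrank_classesOn_le _ _ (fun a => a.elim0) ?_
    intro z _ hzS _
    rw [← (chainEquiv 0).map_eq_zero_iff]
    exact (isHomog_chainEquiv (i := 1) hzS).eq_zero_of_word_zero
  · refine finrank_classesOn_le _ _
      (fun a => (wordEquiv (n + 1)).symm (sortedWordPair n a)) ?_
    intro z hz hzS h
    rw [← (chainEquiv (n + 1)).map_eq_zero_iff]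
    have := isHomog_chainEquiv (i := 1) hzS
    rw [add_sub_cancel_left] at this
    refine eq_zero_of_sortedWordPair n _ this ?_ fun a ha => h ⟨a, ha⟩
    rw [← chainEquiv_cubeMap, (chainEquiv (n + 1)).map_eq_zero_iff]
    exact hz

/-- The chain `+⋯+`. -/
def topWordChain : (n : ℕ) → Word n → ℂ
  | 0 => fun b : Bool => if b then 1 else 0
  | n + 1 => consLabel true (topWordChain n)

theorem part_none_topWordChain (n : ℕ) : part none (topWordChain (n + 1)) = 0 := rfl

theorem part_false_topWordChain (n : ℕ) : part (some false) (topWordChain (n + 1)) = 0 := rfl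

theorem part_true_topWordChain (n : ℕ) :
    part (some true) (topWordChain (n + 1)) = topWordChain n := rfl

theorem topWordChain_sortedWord (n : ℕ) : topWordChain n (sortedWord n 0) = 1 := by
  induction n with
  | zero => rfl
  | succ n ih => exact ih

theorem topWordChain_gradings (n : ℕ) : ∀ x, topWordChain n x ≠ 0 →
    wordOnes n x = 0 ∧ wordTau n x = n + 1 ∧ wordWeight n false x = n + 1 := by
  induction n with
  | zero =>
    intro x hx
    have : x = true := by
      by_contra h
      exact hx (if_neg h)
    subst this
    simp [wordOnes, wordTau, wordWeight, labelWeight, signVal]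
  | succ n ih =>
    rintro ⟨_ | b, x⟩ hx
    · exact absurd rfl hx
    · cases b
      · exact absurd rfl hx
      · obtain ⟨h1, h2, h3⟩ := ih x hx
        refine ⟨h1, ?_, ?_⟩
        · simp only [wordTau, h2, signVal]; push_cast; ring
        · simp only [wordWeight, h3, signVal, labelWeight, Bool.not_false, if_true]; push_cast; ring

theorem mulFirst_topWordChain (c : Coeffs) (h : c true true true true true = 0)
    (h' : c true true true true false = 0) (n : ℕ) :
    mulFirst c true true n false (topWordChain n) = 0 := by
  rcases n with _ | n
  · refine ext_val fun d => ?_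
    have h0 : val false (topWordChain 0) = 0 := rfl
    rw [val_mulFirst, h0]
    cases d <;> simp [h, h']
  · refine ext_part ?_ fun d => ?_
    · rw [part_none_mulFirst, part_none_topWordChain, map_zero, map_zero]
    · rw [part_some_mulFirst, part_false_topWordChain]
      cases d <;> simp [h, h']

theorem wordDiffZero_topWordChain (n : ℕ) : wordDiffZero n false (topWordChain n) = 0 := by
  induction n with
  | zero => rfl
  | succ n ih =>
    refine ext_part ?_ fun d => ?_
    · rw [part_none_wordDiff, part_none_topWordChain, part_false_topWordChain,
        part_true_topWordChain, Bool.not_false, mulFirst_topWordChain _ (by decide) (by decide)]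
      simp
    · rw [part_some_wordDiff]
      cases d
      · rw [part_false_topWordChain, map_zero, map_zero]
      · rw [part_true_topWordChain, ih, map_zero]

theorem wordFlip_topWordChain (n : ℕ) : wordFlip false n false (topWordChain n) = 0 := by
  induction n with
  | zero =>
    refine ext_val fun d => ?_
    have h0 : val false (topWordChain 0) = 0 := rfl
    rw [val_wordFlip, h0]
    simp
  | succ n ih =>
    refine ext_part ?_ fun d => ?_
    · rw [part_none_wordFlip, part_none_topWordChain, map_zero, map_zero]
    · rw [part_some_wordFlip_false, part_false_topWordChain]
      cases d
      · rw [part_false_topWordChain]; simp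
      · rw [part_true_topWordChain, ih]; simp

/-- The coefficient of `∂₋(+⋯+)` at the word `w₊ + ⋯ +` is `1`. -/
theorem wordDiff_minus_topWordChain (n : ℕ) :
    wordDiff (mergeCoeffs (-1) (-2)) (n + 1) false (topWordChain (n + 1)) (none, sortedWord n 0) =
      1 := by
  have hc : mergeCoeffs (-1) (-2) true true true true true = 1 := by decide
  change part none (wordDiff _ _ _ (topWordChain (n + 1))) (sortedWord n 0) = 1
  rw [part_none_wordDiff, part_none_topWordChain, part_false_topWordChain,
    part_true_topWordChain]
  simp only [map_zero, neg_zero, zero_add, add_zero, Bool.not_false]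
  rcases n with _ | n
  · refine (val_mulFirst _ true true false _ true).trans ?_
    have h0 : val false (topWordChain 0) = 0 := rfl
    have h1 : val true (topWordChain 0) = 1 := rfl
    rw [h0, h1, Bool.not_false, hc]
    simp
  · change part (some true) (mulFirst _ true true (n + 1) false _) (sortedWord n 0) = 1
    rw [part_some_mulFirst, part_false_topWordChain, part_true_topWordChain, Bool.not_false, hc]
    simp [topWordChain_sortedWord]

theorem wordTau_le (n : ℕ) : ∀ x : Word n, wordTau n x ≤ n + 1 := by
  have h : ∀ b, signVal b ≤ 1 := by decide
  induction n with
  | zero => intro x; simpa [wordTau] using h x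
  | succ n ih =>
    rintro ⟨_ | b, x⟩
    · exact (ih x).trans (by push_cast; linarith)
    · have h1 := ih x
      have h2 := h b
      simp only [wordTau]
      push_cast
      linarith

/-- The state with all circles nontrivial and labelled `+`, as a chain. -/
def topChain (n : ℕ) : Chain (stabWord n) := (chainEquiv n).symm (topWordChain n)

theorem chainEquiv_topChain (n : ℕ) : chainEquiv n (topChain n) = topWordChain n :=
  LinearEquiv.apply_symm_apply _ _

theorem topChain_gradings {x : State (stabWord n)} (hx : topChain n x ≠ 0) :
    iDeg (stabWord n) x = 0 ∧ tau (stabWord n) x = n + 1 ∧ kDeg (stabWord n) x = n + 1 := by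
  rw [← chainEquiv_toWord (topChain n) x, chainEquiv_topChain] at hx
  obtain ⟨h1, h2, h3⟩ := topWordChain_gradings n _ hx
  rw [iDeg_eq, tau_eq, kDeg_eq, h1, h2, h3]
  simp

theorem topChain_mem_cycles (n : ℕ) : topChain n ∈ Cycles (stabWord n) := by
  rw [LinearMap.mem_ker, ← (chainEquiv n).map_eq_zero_iff, partialZero, chainEquiv_cubeMap,
    chainEquiv_topChain]
  exact wordDiffZero_topWordChain n

theorem topChain_mem_chainsOn (n : ℕ) :
    topChain n ∈ chainsOn (stabWord n) (bidegree n 0 n) := by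
  intro x hx
  by_contra h
  obtain ⟨h1, h2, h3⟩ := topChain_gradings h
  exact hx ⟨h1, by rw [jDeg'_eq_tau, h1, h2, h3]; ring⟩

theorem topChain_ne_zero (n : ℕ) : topChain n ≠ 0 := by
  intro h
  have h1 := topWordChain_sortedWord n
  rw [← chainEquiv_topChain, h, map_zero] at h1
  simp at h1

theorem chainE_topChain (n : ℕ) : chainE (stabWord n) (topChain n) = 0 := by
  rw [← (chainEquiv n).map_eq_zero_iff, chainE, chainEquiv_flipMap, chainEquiv_topChain,
    wordFlip_topWordChain]

theorem chainH_topChain (n : ℕ) :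
    chainH (stabWord n) (topChain n) = (((n + 1 : ℤ)) : ℂ) • topChain n := by
  funext x
  rw [chainH_apply, Pi.smul_apply, smul_eq_mul]
  by_cases hx : topChain n x = 0
  · rw [hx, mul_zero, mul_zero]
  · rw [(topChain_gradings hx).2.2]

theorem partialMinus_topChain_mem_chainsOn (n : ℕ) : partialMinus (stabWord n) (topChain n) ∈
    chainsOn (stabWord n) (bidegree n 1 (n + 2)) := by
  have := cubeMap_mem_chainsOn (δτ := -1) (δk := -2) (topChain_mem_chainsOn n)
  rwa [show (n : ℤ) + 1 + -1 - -2 = n + 2 by ring] at this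

theorem partialMinus_topChain_ne_zero (hn : 1 ≤ n) :
    partialMinus (stabWord n) (topChain n) ≠ 0 := by
  obtain ⟨n, rfl⟩ := Nat.exists_eq_add_of_le' hn
  intro h
  have h1 := wordDiff_minus_topWordChain n
  rw [← chainEquiv_topChain, ← chainEquiv_cubeMap] at h1
  change chainEquiv (n + 1) (partialMinus (stabWord (n + 1)) (topChain (n + 1))) _ = 1 at h1
  rw [h, map_zero] at h1
  exact zero_ne_one h1

/-- The states in `e ∂₋(+⋯+)` would have labels that add up to `n + 2`, but there are at most
`n + 1` circles. -/
theorem chainE_partialMinus_topChain (n : ℕ) :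
    chainE (stabWord n) (partialMinus (stabWord n) (topChain n)) = 0 := by
  funext y
  by_contra h
  obtain ⟨x, hx, -, h1, -⟩ := exists_of_flipMap_ne_zero h
  obtain ⟨x', hx', -, h2, -⟩ := exists_of_cubeMap_ne_zero hx
  rw [h2, (topChain_gradings hx').2.1, tau_eq] at h1
  have := wordTau_le n (toWord y)
  have h3 : signVal false = -1 := rfl
  rw [h3] at h1
  linarith

theorem homClass_ne_zero {i j : ℤ} (hij : IsCritical n i j) {z : Cycles (stabWord n)}
    (hz : z.1 ∈ chainsOn (stabWord n) (bidegree n i j)) (h0 : z.1 ≠ 0) :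
    homClass (stabWord n) z ≠ 0 :=
  fun h => h0 (eq_zero_of_mem_range hij hz (homClass_eq_zero.1 h))

/-- The homology class of the chain `+⋯+`. -/
def topClass (n : ℕ) : SKh (stabWord n) := homClass _ ⟨topChain n, topChain_mem_cycles n⟩

theorem topClass_mem (n : ℕ) : topClass n ∈ (annularRep n).deg 0 := by
  change _ ∈ SKhDeg (stabWord n) 0
  rw [SKhDeg_eq_of_isCritical (Or.inl ⟨rfl, rfl⟩)]
  exact mem_classesOn.2 ⟨_, topChain_mem_chainsOn n, rfl⟩

theorem isHighestWeight_topClass (n : ℕ) : (annularRep n).IsHighestWeight (n + 1) (topClass n) := by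
  refine ⟨homClass_ne_zero (Or.inl ⟨rfl, rfl⟩) (topChain_mem_chainsOn n) (topChain_ne_zero n),
    ?_, ?_⟩
  · exact (homClass_congr (z' := 0) (chainE_topChain n)).trans (map_zero _)
  · exact (homClass_congr (z' := (((n + 1 : ℤ)) : ℂ) • ⟨_, topChain_mem_cycles n⟩)
      (chainH_topChain n)).trans (map_smul _ _ _)

theorem isHighestWeight_vm2_topClass (hn : 1 ≤ n) :
    (annularRep n).IsHighestWeight (n - 1) ((annularRep n).vm2 (topClass n)) := by
  refine ⟨homClass_ne_zero (Or.inr ⟨rfl, rfl⟩) (partialMinus_topChain_mem_chainsOn n)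
    (partialMinus_topChain_ne_zero hn), ?_, ?_⟩
  · exact (homClass_congr (z' := 0) (chainE_partialMinus_topChain n)).trans (map_zero _)
  · have h := LinearMap.congr_fun (annularRep n).lie_h_vm2 (topClass n)
    simp only [Ring.lie_def, LinearMap.sub_apply, Module.End.mul_apply, LinearMap.neg_apply,
      LinearMap.smul_apply] at h
    rw [(isHighestWeight_topClass n).2.2, map_smul, sub_eq_iff_eq_add] at h
    rw [h]
    push_cast
    module

/-- The irreducible representation in a critical bidegree `(i, j)` is placed in `j'`-degree `j`:
the eigenspaces of `h` are the pieces of homogeneous `k`-degree. -/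
theorem bigradedIso_of_intertwines {i j : ℤ} (hij : IsCritical n i j) {d : ℕ}
    {φ : (Fin d → ℂ) ≃ₗ[ℂ] (annularRep n).deg i}
    (hφ : (irrep d).Intertwines ((annularRep n).degRep i) φ) :
    (irrep d).BigradedIso (irrepGrading d j) ((annularRep n).degRep i)
      (SKhBigrading (stabWord n) (annularRep n) i) := by
  refine ⟨φ, hφ, fun j' k => ?_⟩
  unfold irrepGrading SKhBigrading
  split_ifs with hj
  · subst hj
    ext ⟨ξ, hξ⟩
    have h1 : (⟨ξ, hξ⟩ : (annularRep n).deg i) ∈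
        (End.eigenspace (irrep d).h (k : ℂ)).map (φ : (Fin d → ℂ) →ₗ[ℂ] _) ↔
        skhH n ξ = (k : ℂ) • ξ := by
      rw [Submodule.mem_map_equiv, End.mem_eigenspace_iff, ← hφ.symm.2.2, ← map_smul,
        φ.symm.injective.eq_iff, Subtype.ext_iff]
      rfl
    rw [h1]
    change _ ↔ ξ ∈ SKhPiece (stabWord n) i j' k
    have hξ' : ξ ∈ SKhDeg (stabWord n) i := hξ
    rw [SKhDeg_eq_of_isCritical hij] at hξ'
    rw [SKhPiece, mem_classesOn]
    constructor
    · intro h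
      obtain ⟨z, hz, rfl⟩ := mem_classesOn.1 hξ'
      refine ⟨z, ?_, rfl⟩
      have h2 : homClass (stabWord n)
          (⟨chainH _ z.1, (isAnnularAction_annularRep n).h_induced z |>.1⟩ - (k : ℂ) • z) = 0 := by
        rw [map_sub, map_smul, ← h, sub_eq_zero]
        rfl
      have h3 := eq_zero_of_mem_range hij (z := chainH _ z.1 - (k : ℂ) • z.1) (fun x hx => by
        rw [Pi.sub_apply, chainH_apply, Pi.smul_apply, hz x hx]
        simp) (homClass_eq_zero.1 h2)
      intro x hx
      by_contra hzx
      refine hx ?_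
      have hxS : x ∈ bidegree n i j' := by
        by_contra h'
        exact hzx (hz x h')
      refine ⟨hxS.1, hxS.2, ?_⟩
      have h4 := congrFun h3 x
      rw [Pi.sub_apply, chainH_apply, Pi.smul_apply, smul_eq_mul, ← sub_mul, Pi.zero_apply,
        mul_eq_zero, or_iff_left hzx, sub_eq_zero] at h4
      exact_mod_cast h4
    · rintro ⟨z, hz, rfl⟩
      refine (homClass_congr (z' := (k : ℂ) • z) ?_).trans (map_smul _ _ _)
      funext x
      change chainH (stabWord n) z.1 x = (k : ℂ) * z.1 x
      rw [chainH_apply]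
      by_cases hx : z.1 x = 0
      · rw [hx, mul_zero, mul_zero]
      · have : kDeg (stabWord n) x = k := by
          by_contra h
          exact hx (hz x fun h' => h h'.2.2)
        rw [this]
  · rw [Submodule.map_bot, eq_comm, eq_bot_iff]
    rintro ⟨ξ, hξ⟩ h
    change ξ ∈ SKhPiece (stabWord n) i j' k at h
    obtain ⟨z, hz, rfl⟩ := mem_classesOn.1 h
    have h0 : homClass (stabWord n) z = 0 := by
      rw [homClass_eq_zero]
      refine mem_range_of_not_isCritical (i := i) (j := j') ?_
        (fun x hx => hz x fun h' => hx ⟨h'.1, h'.2.1⟩) z.2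
      unfold IsCritical at hij ⊢
      omega
    exact Subtype.ext h0

theorem exists_intertwines_deg_zero (n : ℕ) : ∃ φ : (Fin (n + 2) → ℂ) ≃ₗ[ℂ] (annularRep n).deg 0,
    (irrep (n + 2)).Intertwines ((annularRep n).degRep 0) φ := by
  obtain ⟨φ, hφ, -⟩ := ((annularRep n).degRep 0).exists_irrep_iso (d := n + 2) (N := n + 1)
    (x := ⟨_, topClass_mem n⟩) (by push_cast; ring)
    (CurrentRep.isHighestWeight_degRep.2 (isHighestWeight_topClass n)) (finrank_SKhDeg_zero_le n)
  exact ⟨φ, hφ⟩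

theorem exists_intertwines_deg_one (n : ℕ) : ∃ φ : (Fin n → ℂ) ≃ₗ[ℂ] (annularRep n).deg 1,
    (irrep n).Intertwines ((annularRep n).degRep 1) φ := by
  rcases Nat.eq_zero_or_pos n with rfl | hn
  · have h0 : finrank ℂ ((annularRep 0).deg 1) = 0 := Nat.le_zero.1 (finrank_SKhDeg_one_le 0)
    have : Subsingleton ((annularRep 0).deg 1) := finrank_zero_iff.1 h0
    exact ⟨LinearEquiv.ofFinrankEq _ _ (by simp [h0]), fun _ => Subsingleton.elim _ _,
      fun _ => Subsingleton.elim _ _, fun _ => Subsingleton.elim _ _⟩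
  · obtain ⟨φ, hφ, -⟩ := ((annularRep n).degRep 1).exists_irrep_iso (d := n) (N := n - 1)
      (x := ⟨_, by simpa using (annularRep n).vm2_mem 0 _ (topClass_mem n)⟩) (by push_cast; ring)
      (CurrentRep.isHighestWeight_degRep.2 (isHighestWeight_vm2_topClass hn))
      (finrank_SKhDeg_one_le n)
    exact ⟨φ, hφ⟩

theorem isStandard_annularRep (n : ℕ) : (annularRep n).IsStandard n where
  iso_zero := exists_intertwines_deg_zero n
  iso_one := exists_intertwines_deg_one n
  deg_eq_bot _ := SKhDeg_eq_bot
  exists_highestWeight hn :=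
    ⟨_, topClass_mem n, isHighestWeight_topClass n, isHighestWeight_vm2_topClass hn⟩

end dimension

end AnnularKhovanov

end

theorem proposition9p2 (n : ℕ) :
    -- the sutured annular complex is a complex
    partialZero (stabWord n) ∘ₗ partialZero (stabWord n) = 0 ∧
    -- the action of `sl₂(∧)` on `SKh`
    ∃ ρ : CurrentRep (SKh (stabWord n)), IsAnnularAction (stabWord n) ρ ∧
      -- the decomposition as bigraded representation of `sl₂`
      (irrep (n + 2)).BigradedIso (irrepGrading (n + 2) n)
        (ρ.degRep 0) (SKhBigrading (stabWord n) ρ 0) ∧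
      (irrep n).BigradedIso (irrepGrading n (n + 2))
        (ρ.degRep 1) (SKhBigrading (stabWord n) ρ 1) ∧
      (∀ i : ℤ, i ≠ 0 → i ≠ 1 → SKhDeg (stabWord n) i = ⊥) ∧
      -- indecomposability
      ρ.IsIndecomposable ∧
      -- `v₋₂` takes highest weight vectors to highest weight vectors
      (1 ≤ n → ∀ x ∈ ρ.deg 0, ρ.IsHighestWeight (n + 1) x →
        ρ.vm2 x ∈ ρ.deg 1 ∧ ρ.IsHighestWeight (n - 1) (ρ.vm2 x)) ∧
      -- these facts determine the graded `sl₂(∧)`-module up to isomorphism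
      ∀ (M : Type*) [AddCommGroup M] [Module ℂ M] (σ : CurrentRep M),
        (irrep (n + 2)).Iso (σ.degRep 0) → (irrep n).Iso (σ.degRep 1) →
        (∀ i : ℤ, i ≠ 0 → i ≠ 1 → σ.deg i = ⊥) →
        (1 ≤ n → ∃ x ∈ σ.deg 0, σ.IsHighestWeight (n + 1) x ∧
          σ.IsHighestWeight (n - 1) (σ.vm2 x)) →
        ρ.Iso σ := by
  obtain ⟨φ, hφ⟩ := exists_intertwines_deg_zero n
  obtain ⟨ψ, hψ⟩ := exists_intertwines_deg_one n
  have hρ := isStandard_annularRep n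
  refine ⟨LinearMap.ext partialZero_partialZero, annularRep n, isAnnularAction_annularRep n,
    bigradedIso_of_intertwines (Or.inl ⟨rfl, rfl⟩) hφ,
    bigradedIso_of_intertwines (Or.inr ⟨rfl, rfl⟩) hψ, fun _ => SKhDeg_eq_bot,
    hρ.isIndecomposable, fun hn _ => hρ.isHighestWeight_vm2 hn, ?_⟩
  intro M _ _ σ h0 h1 hbot hw
  exact hρ.iso ⟨h0, h1, hbot, hw⟩
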